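/- A temporal graph $\mathcal G=(G,\mathcal T)$ is a finite simple graph $G=(V,E)$ together with a map $\mathcal T$ assigning to each edge a non-empty finite set of positive integers; its time-edges are the pairs $(e,t)$ with $e\in E$, $t\in\mathcal T(e)$, and its lifetime is $T(\mathcal G)=\max\{t : t\in\mathcal T(e),\ e\in E\}$ (with $T(\mathcal G)=0$ if there are no edges). For positive integers $\Delta_1<\Delta_2$: - an edge $e$ is $\Delta_1$-dense in $[a,b]$ if for every integer $\tau\in[a,\max\{a,b-\Delta_1+1\}]$ some $t\in\mathcal T(e)$ lies in $[\tau,\tau+\Delta_1-1]$; - a template is a pair $(X,[a,b])$ with $X\subseteq V$ and $a\le b$; templates $(X,[a,b])$ and $(Y,[c,d])$ are $\Delta_2$-independent if $X\cap Y=\emptyset$ or $|s-t|\ge\Delta_2$ for all $s\in[a,b]$, $t\in[c,d]$; - $\mathcal G$ is a $(\Delta_1,\Delta_2)$-cluster temporal graph if there is a collection of pairwise $\Delta_2$-independent templates with intervals contained in $[1,T(\mathcal G)]$ such that for each time-edge $(xy,t)$ some template $(X,[a,b])$ of the collection has $x,y\in X$ and $t\in[a,b]$, and for each template $(X,[a,b])$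 of the collection and all distinct $x,y\in X$ the edge $xy$ is $\Delta_1$-dense in $[a,b]$. The problem ETC (Editing to Temporal Cliques) asks, for a temporal graph $\mathcal G$ and positive integers $k$ and $\Delta_1<\Delta_2$, whether $\mathcal G$ can be turned into a $(\Delta_1,\Delta_2)$-cluster temporal graph on the same vertex set by at most $k$ additions or deletions of time-edges (on arbitrary pairs of vertices and at arbitrary positive times). **Theorem.** There are a single word RAM program and constants $c,C$ such that the following holds for all $n\ge 2$ and $\sigma$. Let $(\mathcal P_n,\Delta_1,\Delta_2,k)$ be an instance of ETC, where the underlying graph of $\mathcal P_n$ is the path $P_n$ on $v_1,\dots,v_n$ with edges $v_iv_{i+1}$, and $|\mathcal T(e)|\le\sigma$ for every edge $e$. Let $T=T(\mathcal P_n)$. The instance is given as $n$, the number of edges, $\Delta_1$, $\Delta_2$, $k$ and a list, in any order, of the edges with the lists of their appearances; $\sigma$ is not part of the input. Then, on every word length $w$ with $2^w\ge (n+T+k+\Delta_1+\Delta_2)^{c\sigma}$ (so words of logarithmic length suffice for each fixed $\sigma$), the program decides this instance within at most $$C\cdot T^{4\sigma}\,\sigma^2\, n^{2\sigma+1}$$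 steps. That is, ETC on such instances is solvable in time $O(T^{4\sigma}\sigma^2 n^{2\sigma+1})$. -/

import Mathlib

/-! ## Temporal graphs -/

/-- A temporal graph on the vertex set `V`: an underlying simple graph together with a finite,
nonempty set of positive time labels for each of its edges. The labelling is extended by the empty
set to pairs that are not edges. -/
structure TemporalGraph (V : Type) where
  graph : SimpleGraph V
  times : Sym2 V → Finset ℕ
  times_nonempty_iff : ∀ e : Sym2 V, (times e).Nonempty ↔ e ∈ graph.edgeSet
  times_pos : ∀ e : Sym2 V, ∀ t ∈ times e, 0 < t

namespace TemporalGraph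

variable {V : Type}

/-- The set of time-edges (edge appearances). -/
def timeEdges (G : TemporalGraph V) : Set (Sym2 V × ℕ) :=
  {p | p.2 ∈ G.times p.1}

/-- The lifetime `T(G)`: the largest time label (`0` if there are no edges). -/
def lifetime [Fintype V] [DecidableEq V] (G : TemporalGraph V) : ℕ :=
  Finset.univ.sup fun e : Sym2 V => (G.times e).sup id

/-- `e` is `Δ₁`-dense in `[a, b]`: for every `τ ∈ [a, max {a, b - Δ₁ + 1}]` there is an appearance
of `e` in `[τ, τ + Δ₁ - 1]`. (If `b + 1 < Δ₁` the truncated difference is `0` and the maximum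
is `a`, as it should be.) -/
def IsDense (G : TemporalGraph V) (Δ₁ : ℕ) (e : Sym2 V) (a b : ℕ) : Prop :=
  ∀ τ, a ≤ τ → τ ≤ max a (b + 1 - Δ₁) → ∃ t ∈ G.times e, τ ≤ t ∧ t < τ + Δ₁

end TemporalGraph

/-- A template `(X, [a, b])`. -/
structure Template (V : Type) where
  verts : Finset V
  a : ℕ
  b : ℕ
  a_le_b : a ≤ b

/-- Two templates are `Δ₂`-independent if their vertex sets are disjoint or any two times taken
from their intervals are at distance at least `Δ₂`. -/
def Template.Independent {V : Type} (Δ₂ : ℕ) (C D : Template V) : Prop :=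
  Disjoint C.verts D.verts ∨
    ∀ s ∈ Set.Icc C.a C.b, ∀ t ∈ Set.Icc D.a D.b, (Δ₂ : ℤ) ≤ |(s : ℤ) - (t : ℤ)|

namespace TemporalGraph

variable {V : Type}

/-- `𝔗(G, Δ₂)`: collections of pairwise `Δ₂`-independent templates with intervals in
`[1, T(G)]`. -/
def templateCollections [Fintype V] [DecidableEq V] (G : TemporalGraph V) (Δ₂ : ℕ) :
    Set (Finset (Template V)) :=
  {𝒞 | (𝒞 : Set (Template V)).Pairwise (Template.Independent Δ₂) ∧
    ∀ C ∈ 𝒞, 1 ≤ C.a ∧ C.b ≤ G.lifetime}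

/-- `G` realises the collection `𝒞`. -/
def Realises (G : TemporalGraph V) (Δ₁ : ℕ) (𝒞 : Finset (Template V)) : Prop :=
  (∀ (x y : V) (t : ℕ), (s(x, y), t) ∈ G.timeEdges →
    ∃ C ∈ 𝒞, x ∈ C.verts ∧ y ∈ C.verts ∧ C.a ≤ t ∧ t ≤ C.b) ∧
  (∀ C ∈ 𝒞, ∀ x ∈ C.verts, ∀ y ∈ C.verts, x ≠ y → G.IsDense Δ₁ s(x, y) C.a C.b)

/-- `G` is a `(Δ₁, Δ₂)`-cluster temporal graph. -/
def IsCluster [Fintype V] [DecidableEq V] (G : TemporalGraph V) (Δ₁ Δ₂ : ℕ) : Prop :=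
  ∃ 𝒞 ∈ G.templateCollections Δ₂, G.Realises Δ₁ 𝒞

/-- The question of Editing to Temporal Cliques: is there a set `Pi` of at most `k` time-edge
modifications (additions or deletions) such that the modified temporal graph is a
`(Δ₁, Δ₂)`-cluster temporal graph? -/
def ETC [Fintype V] [DecidableEq V] (G : TemporalGraph V) (Δ₁ Δ₂ k : ℕ) : Prop :=
  ∃ Pi : Finset (Sym2 V × ℕ), Pi.card ≤ k ∧
    ∃ G' : TemporalGraph V,
      G'.timeEdges = symmDiff G.timeEdges (Pi : Set (Sym2 V × ℕ)) ∧ G'.IsCluster Δ₁ Δ₂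

/-- `L` lists `G`: every edge occurs in exactly one entry `(u, v, ts)` of `L`, and there `ts` lists
its appearances without repetition. The order of the entries, of the two endpoints and of the
appearances is arbitrary. -/
def IsListing {n : ℕ} (G : TemporalGraph (Fin n)) (L : List (Fin n × Fin n × List ℕ)) : Prop :=
  (L.map fun x => s(x.1, x.2.1)).Nodup ∧
  (∀ e, e ∈ (L.map fun x => s(x.1, x.2.1)) ↔ e ∈ G.graph.edgeSet) ∧
  (∀ x ∈ L, x.2.2.Nodup ∧ ∀ t, t ∈ x.2.2 ↔ t ∈ G.times s(x.1, x.2.1))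

end TemporalGraph

/-- The sequence of input words of an instance: `n`, the number of edges, `Δ₁`, `Δ₂`, `k`, and then
for each listed edge its two endpoints, its number of appearances and these appearances. -/
def etcInput {n : ℕ} (L : List (Fin n × Fin n × List ℕ)) (Δ₁ Δ₂ k : ℕ) : List ℕ :=
  [n, L.length, Δ₁, Δ₂, k] ++
    L.flatMap fun x => [(x.1 : ℕ), (x.2.1 : ℕ), x.2.2.length] ++ x.2.2

/-! ## The word RAM

A machine with word length `w` has registers `0, 1, 2, …` (a program mentions finitely many of them)
and a random access memory whose addresses and cells are words, that is, numbers below `2 ^ w`.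
Arithmetic is on words. Programs are given in structured form; every constant, register access,
memory access, arithmetic operation, assignment and test costs one time unit. -/

namespace WordRAM

/-- Binary word operations. -/
inductive Op where
  | add | sub | mul | div | lt | eq

/-- The value of an operation on words of length `w`: addition and multiplication modulo `2 ^ w`,
truncated subtraction, integer division (with value `0` for divisor `0`), and the comparisons
with value `1` for true and `0` for false. -/
def Op.eval (w : ℕ) : Op → ℕ → ℕ → ℕ
  | .add, x, y => (x + y) % 2 ^ w
  | .sub, x, y => x - y
  | .mul, x, y => (x * y) % 2 ^ w
  | .div, x, y => x / y
  | .lt, x, y => if x < y then 1 % 2 ^ w else 0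
  | .eq, x, y => if x = y then 1 % 2 ^ w else 0

/-- A machine state: the contents of the registers and of the memory. -/
structure State where
  reg : ℕ → ℕ
  mem : ℕ → ℕ

/-- Expressions; `load e` is the content of the memory cell with address `e`. -/
inductive Expr where
  | const (c : ℕ)
  | reg (i : ℕ)
  | load (e : Expr)
  | bin (o : Op) (e₁ e₂ : Expr)

def Expr.eval (w : ℕ) (s : State) : Expr → ℕ
  | .const c => c % 2 ^ w
  | .reg i => s.reg i
  | .load e => s.mem (e.eval w s)
  | .bin o e₁ e₂ => o.eval w (e₁.eval w s) (e₂.eval w s)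

/-- The time to evaluate an expression. -/
def Expr.cost : Expr → ℕ
  | .const _ => 1
  | .reg _ => 1
  | .load e => e.cost + 1
  | .bin _ e₁ e₂ => e₁.cost + e₂.cost + 1

/-- Programs: do nothing, assign to a register, write to a memory cell, sequential composition,
`if e ≠ 0 then p else q`, and `while e ≠ 0 do p`. -/
inductive Program where
  | nop
  | assign (i : ℕ) (e : Expr)
  | store (addr e : Expr)
  | seq (p q : Program)
  | branch (e : Expr) (p q : Program)
  | loop (e : Expr) (p : Program)

/-- `Exec w p s t s'`: with word length `w`, the program `p` started in the state `s` halts in the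
state `s'` after exactly `t` time units. -/
inductive Exec (w : ℕ) : Program → State → ℕ → State → Prop where
  | nop (s : State) : Exec w .nop s 1 s
  | assign (i : ℕ) (e : Expr) (s : State) :
      Exec w (.assign i e) s (e.cost + 1) ⟨Function.update s.reg i (e.eval w s), s.mem⟩
  | store (addr e : Expr) (s : State) :
      Exec w (.store addr e) s (addr.cost + e.cost + 1)
        ⟨s.reg, Function.update s.mem (addr.eval w s) (e.eval w s)⟩
  | seq {p q : Program} {s s' s'' : State} {t t' : ℕ} :
      Exec w p s t s' → Exec w q s' t' s'' → Exec w (.seq p q) s (t + t') s''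
  | branch_true {e : Expr} {p q : Program} {s s' : State} {t : ℕ} :
      e.eval w s ≠ 0 → Exec w p s t s' → Exec w (.branch e p q) s (e.cost + 1 + t) s'
  | branch_false {e : Expr} {p q : Program} {s s' : State} {t : ℕ} :
      e.eval w s = 0 → Exec w q s t s' → Exec w (.branch e p q) s (e.cost + 1 + t) s'
  | loop_true {e : Expr} {p : Program} {s s' s'' : State} {t t' : ℕ} :
      e.eval w s ≠ 0 → Exec w p s t s' → Exec w (.loop e p) s' t' s'' →
        Exec w (.loop e p) s (e.cost + 1 + t + t') s''
  | loop_false {e : Expr} {p : Program} {s : State} :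
      e.eval w s = 0 → Exec w (.loop e p) s (e.cost + 1) s

/-- The initial state: the input occupies the memory cells `0, 1, 2, …`; everything else is `0`. -/
def initial (w : ℕ) (input : List ℕ) : State :=
  ⟨fun _ => 0, fun i => input.getD i 0 % 2 ^ w⟩

/-- With word length `w`, the program `p` halts on the given input within `B` time units, with `1`
in register `0` if `Q` holds and with `0` in register `0` otherwise. -/
def DecidesWithin (w : ℕ) (p : Program) (input : List ℕ) (Q : Prop) (B : ℕ) : Prop :=
  ∃ (t : ℕ) (s : State), Exec w p (initial w input) t s ∧ t ≤ B ∧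
    (Q → s.reg 0 = 1) ∧ (¬ Q → s.reg 0 = 0)

end WordRAM

/-! Templates may be assumed to live on subpaths. In a cluster graph reached by editing, say that a
template crosses the edge {i, i + 1} if it contains both endpoints and its interval contains an
original time of this edge. Cut every template into its maximal runs of crossed edges, and its
interval at the original lifetime. The pieces, triples (l, a, b), cost no more than the given edits:
an original time that survives is still covered, since the template covering it crosses its edge,
and every pair inside a piece was already dense because of the template it comes from
(`exists_plan_of_etc`). Conversely, let a family of such pieces, called a plan, be spaced by Δ₂
wherever two pieces share a vertex. Deleting all uncovered times and completing the covered
intervals yields a cluster graph (`planGraph_isCluster`, `etc_of_plan`).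

The cost of a plan is a sum over pairs of vertices. Inside an interval the least number of additions
is found greedily: whenever Δ₁ consecutive times are absent, the last of them is added
(`addTimes_dense`, `addCost_le_card`). The hypothesis Δ₁ < Δ₂ ensures that a time witnessing density
at the start of a template is not owed to a different template. Pairs other than path edges carry no
times, so their cost depends only on the length of the interval, and the cost of all pairs {u, i +
1} with u ≤ i has a closed form (`sum_familyCost`).

The pieces crossing one edge have disjoint intervals, each containing a time of that edge. Hence
there are at most m of them, where m ≤ σ is the largest number of times of an edge. A row, that is
the set of pieces crossing an edge, is therefore coded by m digits in base T²n, which gives (T²n)^m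
codes. The plan conditions relate only consecutive rows, so a dynamic program over the edges decides
the question (`etc_iff_dpValue`). It examines fewer than n (T²n)^(2m) pairs of codes with order of
m² operations each, which is the claimed running time.

For the machine, a bound M on all stored values is carried along. If a fixed power of M is below
2^w, no evaluation overflows and expressions can be read over the natural numbers (`eval_eq_val`).
This reduces the analysis to loop invariants with time bounds (`Run.forUp`). -/

/-! ## Greedy completion of a set of times -/

/-- Scanning `a, a + 1, …`, the number of blocks of `Δ` consecutive times outside `P` cut off
greedily, and the length of the current incomplete block. -/
def greedyScan (Δ : ℕ) (P : Finset ℕ) (a : ℕ) : ℕ → ℕ × ℕ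
  | 0 => (0, 0)
  | j + 1 =>
    let r := if a + j ∈ P then 0 else (greedyScan Δ P a j).2 + 1
    if r = Δ then ((greedyScan Δ P a j).1 + 1, 0) else ((greedyScan Δ P a j).1, r)

/-- The times at which the greedy scan completes a block. -/
def greedyTimes (Δ : ℕ) (P : Finset ℕ) (a : ℕ) : ℕ → Finset ℕ
  | 0 => ∅
  | j + 1 =>
    if (if a + j ∈ P then 0 else (greedyScan Δ P a j).2 + 1) = Δ then
      insert (a + j) (greedyTimes Δ P a j)
    else greedyTimes Δ P a j

/-- The number of elements of `P` in `[a, a + l)`. -/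
def keepCount (P : Finset ℕ) (a l : ℕ) : ℕ := (P ∩ Finset.Ico a (a + l)).card

/-- The least number of times to add to `P` to make it `Δ`-dense in `[a, a + l)`. -/
def addCost (Δ : ℕ) (P : Finset ℕ) (a l : ℕ) : ℕ :=
  (greedyScan Δ P a l).1 + if keepCount P a l + (greedyScan Δ P a l).1 = 0 then 1 else 0

/-- Times whose addition makes `P` dense in `[a, a + l)`. -/
def addTimes (Δ : ℕ) (P : Finset ℕ) (a l : ℕ) : Finset ℕ :=
  greedyTimes Δ P a l ∪ if keepCount P a l + (greedyScan Δ P a l).1 = 0 then {a} else ∅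

lemma greedyScan_snd_lt {Δ : ℕ} (hΔ : 0 < Δ) (P : Finset ℕ) (a j : ℕ) :
    (greedyScan Δ P a j).2 < Δ := by
  induction j with
  | zero => simpa [greedyScan]
  | succ j ih =>
    simp only [greedyScan]
    split_ifs <;> simp <;> omega

lemma card_greedyTimes_le (Δ : ℕ) (P : Finset ℕ) (a j : ℕ) :
    (greedyTimes Δ P a j).card ≤ (greedyScan Δ P a j).1 := by
  induction j with
  | zero => simp [greedyTimes]
  | succ j ih =>
    simp only [greedyScan, greedyTimes]
    split_ifs
    all_goals first
      | exact ih
      | exact (Finset.card_insert_le _ _).trans (by simpa using ih)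

lemma card_addTimes_le (Δ : ℕ) (P : Finset ℕ) (a l : ℕ) :
    (addTimes Δ P a l).card ≤ addCost Δ P a l := by
  refine (Finset.card_union_le _ _).trans (Nat.add_le_add (card_greedyTimes_le Δ P a l) ?_)
  split_ifs <;> simp

lemma greedyTimes_subset (Δ : ℕ) (P : Finset ℕ) (a j : ℕ) :
    greedyTimes Δ P a j ⊆ Finset.Ico a (a + j) := by
  induction j with
  | zero => simp [greedyTimes]
  | succ j ih =>
    have h : greedyTimes Δ P a j ⊆ Finset.Ico a (a + (j + 1)) :=
      ih.trans (Finset.Ico_subset_Ico le_rfl (by omega))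
    simp only [greedyTimes]
    split_ifs
    all_goals first
      | exact h
      | exact Finset.insert_subset (by simp) h

lemma addTimes_subset (Δ : ℕ) (P : Finset ℕ) (a : ℕ) {l : ℕ} (hl : 0 < l) :
    addTimes Δ P a l ⊆ Finset.Ico a (a + l) := by
  refine Finset.union_subset (greedyTimes_subset Δ P a l) ?_
  split_ifs <;> simp [hl]

/-- Density of the prefix is not inductive alone. The current run either reaches back to `a` or is
preceded by a present time, and it is shorter than `Δ`; hence the one new window of length `Δ`,
which ends at the scan position, is not filled by it. -/
lemma greedyTimes_spec {Δ : ℕ} (hΔ : 0 < Δ) (P : Finset ℕ) (a j : ℕ) :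
    ((greedyScan Δ P a j).2 = j ∨ ((greedyScan Δ P a j).2 < j ∧
      a + j - (greedyScan Δ P a j).2 - 1 ∈ P ∪ greedyTimes Δ P a j)) ∧
    ∀ τ, a ≤ τ → τ + Δ ≤ a + j → ∃ t ∈ P ∪ greedyTimes Δ P a j, τ ≤ t ∧ t < τ + Δ := by
  induction j with
  | zero => exact ⟨by simp [greedyScan], fun τ h1 h2 => by omega⟩
  | succ j ih =>
    obtain ⟨ih1, ih2⟩ := ih
    have hlt := greedyScan_snd_lt hΔ P a (j + 1)
    have hsub : P ∪ greedyTimes Δ P a j ⊆ P ∪ greedyTimes Δ P a (j + 1) := by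
      apply Finset.union_subset_union le_rfl
      simp only [greedyTimes]
      split_ifs
      all_goals first
        | exact le_rfl
        | exact Finset.subset_insert _ _
    have h1 : (greedyScan Δ P a (j + 1)).2 = j + 1 ∨ ((greedyScan Δ P a (j + 1)).2 < j + 1 ∧
        a + (j + 1) - (greedyScan Δ P a (j + 1)).2 - 1 ∈ P ∪ greedyTimes Δ P a (j + 1)) := by
      by_cases hP : a + j ∈ P
      · right
        have h0 : (greedyScan Δ P a (j + 1)).2 = 0 := by
          simp [greedyScan, hP, hΔ.ne]
        rw [h0]
        exact ⟨by omega, Finset.mem_union_left _ (by simpa using hP)⟩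
      · by_cases hr : (greedyScan Δ P a j).2 + 1 = Δ
        · right
          have h0 : (greedyScan Δ P a (j + 1)).2 = 0 := by
            simp [greedyScan, hP, hr]
          rw [h0]
          refine ⟨by omega, Finset.mem_union_right _ ?_⟩
          simp [greedyTimes, hP, hr]
        · have h0 : (greedyScan Δ P a (j + 1)).2 = (greedyScan Δ P a j).2 + 1 := by
            simp [greedyScan, hP, hr]
          rw [h0]
          rcases ih1 with h | ⟨h, h'⟩
          · left; omega
          · right
            refine ⟨by omega, hsub ?_⟩
            convert h' using 1
            omega
    refine ⟨h1, fun τ hτ hτ' => ?_⟩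
    rcases Nat.lt_or_ge (a + j) (τ + Δ) with h | h
    · rcases h1 with h1 | ⟨h1, h2⟩
      · omega
      · exact ⟨_, h2, by omega, by omega⟩
    · obtain ⟨t, ht, ht'⟩ := ih2 τ hτ h
      exact ⟨t, hsub ht, ht'⟩

lemma addTimes_dense {Δ : ℕ} (hΔ : 0 < Δ) (P : Finset ℕ) {a b τ : ℕ} (hab : a ≤ b)
    (h1 : a ≤ τ) (h2 : τ ≤ max a (b + 1 - Δ)) :
    ∃ t ∈ (P ∩ Finset.Icc a b) ∪ addTimes Δ P a (b + 1 - a), τ ≤ t ∧ t < τ + Δ := by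
  have hsub := greedyTimes_subset Δ P a (b + 1 - a)
  -- A window reaching beyond `b` is demanded only at `τ = a`, when the interval is shorter than
  -- `Δ`.
  rcases Nat.lt_or_ge (b + 1) (τ + Δ) with h | h
  · have hτ : τ = a := by omega
    subst hτ
    by_cases h0 : keepCount P τ (b + 1 - τ) + (greedyScan Δ P τ (b + 1 - τ)).1 = 0
    · exact ⟨τ, by simp [addTimes, h0], le_rfl, by omega⟩
    · have : keepCount P τ (b + 1 - τ) ≠ 0 ∨ (greedyScan Δ P τ (b + 1 - τ)).1 ≠ 0 := by omega
      have hg : (greedyScan Δ P τ (b + 1 - τ)).1 = 0 := by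
        -- Fewer than `Δ` scanned times complete no block, so the nonzero count must come from a
        -- kept time.
        have key : ∀ j, j < Δ → (greedyScan Δ P τ j).1 = 0 ∧ (greedyScan Δ P τ j).2 ≤ j := by
          intro j
          induction j with
          | zero => simp [greedyScan]
          | succ j ih =>
            intro hj
            obtain ⟨i1, i2⟩ := ih (by omega)
            simp only [greedyScan]
            split_ifs <;> omega
        exact (key _ (by omega)).1
      have hk : (P ∩ Finset.Ico τ (τ + (b + 1 - τ))).Nonempty := by
        rw [← Finset.card_pos]
        have : keepCount P τ (b + 1 - τ) ≠ 0 := by omega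
        exact Nat.pos_of_ne_zero this
      obtain ⟨t, ht⟩ := hk
      simp only [Finset.mem_inter, Finset.mem_Ico] at ht
      refine ⟨t, Finset.mem_union_left _ ?_, ht.2.1, by omega⟩
      simp only [Finset.mem_inter, Finset.mem_Icc]
      exact ⟨ht.1, ht.2.1, by omega⟩
  · obtain ⟨t, ht, ht'⟩ := (greedyTimes_spec hΔ P a (b + 1 - a)).2 τ h1 (by omega)
    refine ⟨t, ?_, ht'⟩
    simp only [addTimes, Finset.mem_union, Finset.mem_inter, Finset.mem_Icc] at ht ⊢
    rcases ht with ht | ht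
    · exact Or.inl ⟨ht, by omega, by omega⟩
    · exact Or.inr (Or.inl ht)

/-- A completed block consists of `Δ` times outside `P`, so a dense `P'` has a time in it that is
new, and blocks are disjoint. For the induction, the current run is free of `P` and all new times
counted so far lie before it. -/
lemma greedyScan_fst_le {Δ : ℕ} {P P' : Finset ℕ} {a : ℕ} (j : ℕ)
    (h : ∀ τ, a ≤ τ → τ + Δ ≤ a + j → ∃ t ∈ P', τ ≤ t ∧ t < τ + Δ) :
    (greedyScan Δ P a j).2 ≤ j ∧
    (∀ t, a + j - (greedyScan Δ P a j).2 ≤ t → t < a + j → t ∉ P) ∧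
    (greedyScan Δ P a j).1 ≤
      ((P' \ P) ∩ Finset.Ico a (a + j - (greedyScan Δ P a j).2)).card := by
  induction j with
  | zero => simp [greedyScan]; omega
  | succ j ih =>
    obtain ⟨i1, i2, i3⟩ := ih fun τ h1 h2 => h τ h1 (by omega)
    have mono : ∀ c, a + j - (greedyScan Δ P a j).2 ≤ c → (greedyScan Δ P a j).1 ≤
        ((P' \ P) ∩ Finset.Ico a c).card := fun c hc =>
      i3.trans (Finset.card_le_card (Finset.inter_subset_inter le_rfl
        (Finset.Ico_subset_Ico le_rfl hc)))
    by_cases hP : a + j ∈ P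
    · by_cases hΔ : 0 = Δ
      · obtain ⟨t, -, h1, h2⟩ := h a le_rfl (by omega)
        omega
      · simp only [greedyScan, hP, if_true, hΔ, if_false]
        exact ⟨by omega, fun t h1 h2 => by omega, mono _ (by omega)⟩
    · by_cases hr : (greedyScan Δ P a j).2 + 1 = Δ
      · simp only [greedyScan, hP, if_false, hr, if_true]
        refine ⟨by omega, fun t h1 h2 => by omega, ?_⟩
        obtain ⟨t, ht, h1, h2⟩ := h (a + j - (greedyScan Δ P a j).2) (by omega) (by omega)
        have htP : t ∉ P := by
          rcases Nat.lt_or_ge t (a + j) with h3 | h3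
          · exact i2 t h1 h3
          · have : t = a + j := by omega
            rwa [this]
        have hsub : insert t ((P' \ P) ∩ Finset.Ico a (a + j - (greedyScan Δ P a j).2)) ⊆
            (P' \ P) ∩ Finset.Ico a (a + (j + 1) - 0) := by
          apply Finset.insert_subset
          · simp only [Finset.mem_inter, Finset.mem_sdiff, Finset.mem_Ico]
            exact ⟨⟨ht, htP⟩, by omega, by omega⟩
          · exact Finset.inter_subset_inter le_rfl (Finset.Ico_subset_Ico le_rfl (by omega))
        have := Finset.card_le_card hsub
        rw [Finset.card_insert_of_notMem (by simp; omega)] at this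
        omega
      · simp only [greedyScan, hP, if_false, hr]
        refine ⟨by omega, fun t h1 h2 => ?_, ?_⟩
        · rcases Nat.lt_or_ge t (a + j) with h3 | h3
          · exact i2 t (by omega) h3
          · have : t = a + j := by omega
            rwa [this]
        · exact mono _ (by omega)

lemma greedyScan_empty {Δ : ℕ} (hΔ : 0 < Δ) (a j : ℕ) :
    greedyScan Δ ∅ a j = (j / Δ, j % Δ) := by
  induction j with
  | zero => simp [greedyScan]
  | succ j ih =>
    simp only [greedyScan, ih, Finset.notMem_empty, if_false]
    have hm := Nat.div_add_mod j Δ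
    have hlt := Nat.mod_lt j hΔ
    by_cases h : j % Δ + 1 = Δ
    · have hj : j + 1 = Δ * (j / Δ + 1) := by rw [mul_add]; omega
      rw [if_pos h, hj, Nat.mul_div_cancel_left _ hΔ, Nat.mul_mod_right]
    · have hj : j + 1 = (j % Δ + 1) + Δ * (j / Δ) := by omega
      have hlt' : j % Δ + 1 < Δ := by omega
      rw [if_neg h, Prod.mk.injEq]
      constructor
      · conv_rhs => rw [hj]
        rw [Nat.add_mul_div_left _ _ hΔ, Nat.div_eq_of_lt hlt', zero_add]
      · conv_rhs => rw [hj]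
        rw [Nat.add_mul_mod_self_left, Nat.mod_eq_of_lt hlt']

lemma addCost_empty {Δ : ℕ} (hΔ : 0 < Δ) (a l : ℕ) :
    addCost Δ ∅ a l = l / Δ + if l / Δ = 0 then 1 else 0 := by
  simp [addCost, greedyScan_empty hΔ, keepCount]

/-- A set of times that is dense in `[a, b]` has `addCost` many elements of `[a, b]` outside `P`. -/
lemma addCost_le_card {Δ : ℕ} {P P' : Finset ℕ} {a b b' : ℕ} (hb : b' ≤ b) (hab : a ≤ b')
    (hP : ∀ t ∈ P, t ≤ b → t ≤ b')
    (hd : ∀ τ, a ≤ τ → τ ≤ max a (b + 1 - Δ) → ∃ t ∈ P', τ ≤ t ∧ t < τ + Δ)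
    (hin : ∀ t ∈ P', a ≤ t → t < a + Δ → t ≤ b) :
    addCost Δ P a (b' + 1 - a) ≤ ((P' \ P) ∩ Finset.Icc a b).card := by
  have hg := (greedyScan_fst_le (P := P) (P' := P') (a := a) (b' + 1 - a)
    fun τ h1 h2 => hd τ h1 (by omega)).2.2
  have hg' := hg.trans (Finset.card_le_card (t := (P' \ P) ∩ Finset.Icc a b)
    (Finset.inter_subset_inter le_rfl (fun t ht => by
      simp only [Finset.mem_Ico, Finset.mem_Icc] at ht ⊢; omega)))
  unfold addCost
  split_ifs with h0
  -- Nothing is kept and no block is completed: the window at `a` still demands one time, and `hin`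
  -- places it inside `[a, b]`.
  · obtain ⟨t, ht, h1, h2⟩ := hd a le_rfl (le_max_left _ _)
    have htb := hin t ht h1 h2
    have : t ∉ P := fun htP => by
      have hk : keepCount P a (b' + 1 - a) = 0 := by omega
      rw [keepCount, Finset.card_eq_zero, Finset.eq_empty_iff_forall_notMem] at hk
      have := hP t htP htb
      exact hk t (by simp only [Finset.mem_inter, Finset.mem_Ico]; exact ⟨htP, h1, by omega⟩)
    have : 0 < ((P' \ P) ∩ Finset.Icc a b).card := Finset.card_pos.mpr
      ⟨t, by simp only [Finset.mem_inter, Finset.mem_sdiff, Finset.mem_Icc]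
             exact ⟨⟨ht, this⟩, h1, htb⟩⟩
    omega
  · omega

/-! ## Distance of temporal graphs -/

namespace TemporalGraph

variable {n : ℕ}

/-- The times of the pair `{u, v}`, for natural numbers `u`, `v`. -/
def pairTimes (G : TemporalGraph (Fin n)) (u v : ℕ) : Finset ℕ :=
  if h : u < n ∧ v < n then G.times s(⟨u, h.1⟩, ⟨v, h.2⟩) else ∅

lemma pairTimes_fin (G : TemporalGraph (Fin n)) (u v : Fin n) :
    G.pairTimes u v = G.times s(u, v) := by
  simp [pairTimes]

lemma pairTimes_comm (G : TemporalGraph (Fin n)) (u v : ℕ) :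
    G.pairTimes u v = G.pairTimes v u := by
  unfold pairTimes
  by_cases h : u < n ∧ v < n
  · rw [dif_pos h, dif_pos h.symm, Sym2.eq_swap]
  · rw [dif_neg h, dif_neg (fun h' => h h'.symm)]

lemma times_diag (G : TemporalGraph (Fin n)) {e : Sym2 (Fin n)} (he : e.IsDiag) :
    G.times e = ∅ := by
  by_contra h
  exact G.graph.not_isDiag_of_mem_edgeSet
    ((G.times_nonempty_iff e).mp (Finset.nonempty_iff_ne_empty.mpr h)) he

/-- The number of time-edges in which two temporal graphs differ. -/
def editDist (G G' : TemporalGraph (Fin n)) : ℕ :=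
  ∑ v ∈ Finset.range n, ∑ u ∈ Finset.range v,
    (symmDiff (G.pairTimes u v) (G'.pairTimes u v)).card

/-- The edits leading from one graph to another are forced: they form the symmetric difference.
Loops carry no times, so each pair is counted once with its smaller vertex first. -/
lemma exists_edit_set (G G' : TemporalGraph (Fin n)) :
    ∃ Pi : Finset (Sym2 (Fin n) × ℕ),
      (Pi : Set (Sym2 (Fin n) × ℕ)) = symmDiff G.timeEdges G'.timeEdges ∧
      Pi.card = G.editDist G' := by
  classical
  set A := (Finset.univ : Finset (Fin n × Fin n)).filter fun p => p.1 < p.2 with hA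
  set D : Sym2 (Fin n) → Finset ℕ := fun e => symmDiff (G.times e) (G'.times e) with hD
  refine ⟨A.biUnion fun p => (D s(p.1, p.2)).image fun t => (s(p.1, p.2), t), ?_, ?_⟩
  · ext ⟨e, t⟩
    have hmem : (e, t) ∈ symmDiff G.timeEdges G'.timeEdges ↔ t ∈ D e := by
      simp [hD, Set.mem_symmDiff, Finset.mem_symmDiff, timeEdges]
    rw [hmem, Finset.mem_coe]
    simp only [Finset.mem_biUnion, Finset.mem_image, Prod.mk.injEq]
    constructor
    · rintro ⟨p, -, t', ht, rfl, rfl⟩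
      exact ht
    · intro ht
      induction e with
      | h x y =>
        rcases lt_trichotomy x y with h | h | h
        · exact ⟨(x, y), Finset.mem_filter.mpr ⟨Finset.mem_univ _, h⟩, t, ht, rfl, rfl⟩
        · subst h
          have hx : (s(x, x) : Sym2 (Fin n)).IsDiag := rfl
          rw [hD] at ht
          simp only [G.times_diag hx, G'.times_diag hx, symmDiff_self] at ht
          exact absurd ht (Finset.notMem_empty t)
        · exact ⟨(y, x), Finset.mem_filter.mpr ⟨Finset.mem_univ _, h⟩, t,
            (Sym2.eq_swap (a := x) (b := y)) ▸ ht, Sym2.eq_swap, rfl⟩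
  · rw [Finset.card_biUnion]
    · simp only [Finset.card_image_of_injective _ (Prod.mk_right_injective _)]
      rw [hA, Finset.sum_filter, Fintype.sum_prod_type, Finset.sum_comm, editDist,
        Finset.sum_range]
      refine Finset.sum_congr rfl fun v _ => ?_
      rw [← Finset.sum_filter]
      refine Finset.sum_bij' (fun u _ => (u : ℕ))
        (fun u hu => ⟨u, (Finset.mem_range.mp hu).trans v.2⟩) ?_ ?_ ?_ ?_ ?_
      · intro a ha; simpa using ha
      · intro a ha
        exact Finset.mem_filter.mpr ⟨Finset.mem_univ _, Finset.mem_range.mp ha⟩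
      · intro a ha; rfl
      · intro a ha; rfl
      · intro a ha; simp only [pairTimes_fin, hD]
    · intro p hp q hq hpq
      rw [Function.onFun, Finset.disjoint_left]
      intro x hx hx'
      simp only [Finset.mem_image] at hx hx'
      obtain ⟨t, -, rfl⟩ := hx
      obtain ⟨t', -, h⟩ := hx'
      simp only [Prod.mk.injEq, Sym2.eq_iff] at h
      simp only [hA, Finset.coe_filter, Finset.mem_univ, true_and, Set.mem_ofPred_eq] at hp hq
      rcases h.1 with h | h
      · exact hpq (Prod.ext h.1.symm h.2.symm)
      · rw [h.1, h.2] at hq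
        exact absurd hp hq.asymm

lemma etc_iff (G : TemporalGraph (Fin n)) (Δ₁ Δ₂ k : ℕ) :
    G.ETC Δ₁ Δ₂ k ↔ ∃ G' : TemporalGraph (Fin n), G'.IsCluster Δ₁ Δ₂ ∧ G.editDist G' ≤ k := by
  constructor
  · rintro ⟨Pi, hk, G', h, hG'⟩
    obtain ⟨Pi', h1, h2⟩ := G.exists_edit_set G'
    have : Pi' = Pi := by
      apply Finset.coe_injective
      rw [h1, h, ← symmDiff_assoc, symmDiff_self, bot_symmDiff]
    exact ⟨G', hG', by rw [← h2, this]; exact hk⟩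
  · rintro ⟨G', hG', hk⟩
    obtain ⟨Pi, h1, h2⟩ := G.exists_edit_set G'
    refine ⟨Pi, h2 ▸ hk, G', ?_, hG'⟩
    rw [h1, ← symmDiff_assoc, symmDiff_self, bot_symmDiff]

lemma le_lifetime {V : Type} [Fintype V] [DecidableEq V] (G : TemporalGraph V) {e : Sym2 V}
    {t : ℕ} (ht : t ∈ G.times e) : t ≤ G.lifetime :=
  (Finset.le_sup (f := id) ht).trans
    (Finset.le_sup (f := fun e : Sym2 V => (G.times e).sup id) (Finset.mem_univ e))

/-- Templates reaching beyond the lifetime may be cut off. -/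
lemma isCluster_of_realises {V : Type} [Fintype V] [DecidableEq V] {G : TemporalGraph V}
    {Δ₁ Δ₂ : ℕ} {𝒞 : Finset (Template V)}
    (hind : (𝒞 : Set (Template V)).Pairwise (Template.Independent Δ₂))
    (hpos : ∀ C ∈ 𝒞, 1 ≤ C.a) (hreal : G.Realises Δ₁ 𝒞) : G.IsCluster Δ₁ Δ₂ := by
  classical
  -- The outer `max` only serves to give a template for every `C`; those beginning after the
  -- lifetime are filtered out below.
  let clip : Template V → Template V := fun C =>
    ⟨C.verts, C.a, max C.a (min C.b G.lifetime), le_max_left _ _⟩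
  have hclip : ∀ C : Template V, (clip C).b ≤ C.b := fun C =>
    max_le C.a_le_b (min_le_left _ _)
  refine ⟨(𝒞.filter fun C => C.a ≤ G.lifetime).image clip, ⟨?_, ?_⟩, ?_, ?_⟩
  · intro C' hC' D' hD' hne
    simp only [Finset.coe_image, Finset.coe_filter, Set.mem_image, Set.mem_ofPred_eq] at hC' hD'
    obtain ⟨C, ⟨hC, -⟩, rfl⟩ := hC'
    obtain ⟨D, ⟨hD, -⟩, rfl⟩ := hD'
    rcases hind hC hD (fun h => hne (h ▸ rfl)) with h | h
    · exact Or.inl h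
    · exact Or.inr fun s hs t ht =>
        h s ⟨hs.1, hs.2.trans (hclip C)⟩ t ⟨ht.1, ht.2.trans (hclip D)⟩
  · intro C' hC'
    simp only [Finset.mem_image, Finset.mem_filter] at hC'
    obtain ⟨C, ⟨hC, hL⟩, rfl⟩ := hC'
    exact ⟨hpos C hC, max_le hL (min_le_right _ _)⟩
  · intro x y t ht
    obtain ⟨C, hC, hx, hy, h1, h2⟩ := hreal.1 x y t ht
    have htL : t ≤ G.lifetime := G.le_lifetime ht
    exact ⟨clip C, Finset.mem_image_of_mem _ (Finset.mem_filter.mpr ⟨hC, h1.trans htL⟩), hx, hy,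
      h1, le_max_of_le_right (le_min h2 htL)⟩
  · intro C' hC' x hx y hy hxy
    simp only [Finset.mem_image, Finset.mem_filter] at hC'
    obtain ⟨C, ⟨hC, hL⟩, rfl⟩ := hC'
    intro τ h1 h2
    refine hreal.2 C hC x hx y hy hxy τ h1 (h2.trans ?_)
    have := hclip C
    exact max_le_max le_rfl (by omega)

end TemporalGraph

/-! ## Plans -/

/-- The time intervals of two triples `(l, a, b)` are at distance at least `Δ₂`. -/
def Spaced (Δ₂ : ℕ) (τ τ' : ℕ × ℕ × ℕ) : Prop :=
  τ.2.2 + Δ₂ ≤ τ'.2.1 ∨ τ'.2.2 + Δ₂ ≤ τ.2.1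

/-- A plan prescribes for each edge `{i, i + 1}` of the path the set `S (i + 1)` of the templates
crossing it; a triple `(l, a, b)` is a template with leftmost vertex `l` and interval `[a, b]`. -/
structure IsPlan (n T Δ₂ m : ℕ) (S : ℕ → Finset (ℕ × ℕ × ℕ)) : Prop where
  empty : ∀ i, n ≤ i → S i = ∅
  bounds : ∀ i, ∀ τ ∈ S i, τ.1 < i ∧ 1 ≤ τ.2.1 ∧ τ.2.1 ≤ τ.2.2 ∧ τ.2.2 ≤ T
  cont : ∀ i, ∀ τ ∈ S (i + 1), τ.1 = i ∨ τ ∈ S i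
  within : ∀ i, ∀ τ ∈ S i, ∀ τ' ∈ S i, τ ≠ τ' → Spaced Δ₂ τ τ'
  cross : ∀ i, ∀ τ ∈ S i, ∀ τ' ∈ S (i + 1), τ ≠ τ' → Spaced Δ₂ τ τ'
  card_le : ∀ i, (S i).card ≤ m

/-- The cost caused by a family of intervals at a pair of vertices with set of times `P`. -/
def familyCost (Δ₁ : ℕ) (P : Finset ℕ) (F : Finset (ℕ × ℕ × ℕ)) : ℕ :=
  (P.card - ∑ τ ∈ F, keepCount P τ.2.1 (τ.2.2 + 1 - τ.2.1)) +
    ∑ τ ∈ F, addCost Δ₁ P τ.2.1 (τ.2.2 + 1 - τ.2.1)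

/-- The cost of the pairs `{u, i + 1}` with `u ≤ i`. -/
def edgeCost (Δ₁ i : ℕ) (P : Finset ℕ) (F : Finset (ℕ × ℕ × ℕ)) : ℕ :=
  (P.card - ∑ τ ∈ F, keepCount P τ.2.1 (τ.2.2 + 1 - τ.2.1)) +
    ∑ τ ∈ F, (addCost Δ₁ P τ.2.1 (τ.2.2 + 1 - τ.2.1) +
      (i - τ.1) * addCost Δ₁ ∅ τ.2.1 (τ.2.2 + 1 - τ.2.1))

/-- Only `u = i` can have times. A template with left end `l` concerns the `i - l` vertices `u` in
`[l, i)`, and at each of them it costs as much as on an empty set of times. -/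
lemma sum_familyCost (Δ₁ i : ℕ) (Q : ℕ → Finset ℕ) (F : Finset (ℕ × ℕ × ℕ))
    (hQ : ∀ u < i, Q u = ∅) (hF : ∀ τ ∈ F, τ.1 ≤ i) :
    ∑ u ∈ Finset.range (i + 1), familyCost Δ₁ (Q u) (F.filter fun τ => τ.1 ≤ u) =
      edgeCost Δ₁ i (Q i) F := by
  rw [Finset.sum_range_succ, Finset.filter_true_of_mem hF]
  have h : ∀ u ∈ Finset.range i, familyCost Δ₁ (Q u) (F.filter fun τ => τ.1 ≤ u) =
      ∑ τ ∈ F, if τ.1 ≤ u then addCost Δ₁ ∅ τ.2.1 (τ.2.2 + 1 - τ.2.1) else 0 := by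
    intro u hu
    rw [hQ u (Finset.mem_range.mp hu), familyCost, Finset.sum_filter, Finset.sum_filter]
    simp
  rw [Finset.sum_congr rfl h, Finset.sum_comm]
  have h' : ∀ τ ∈ F, (∑ u ∈ Finset.range i,
      if τ.1 ≤ u then addCost Δ₁ ∅ τ.2.1 (τ.2.2 + 1 - τ.2.1) else 0) =
      (i - τ.1) * addCost Δ₁ ∅ τ.2.1 (τ.2.2 + 1 - τ.2.1) := by
    intro τ _
    rw [← Finset.sum_filter, Finset.sum_const, smul_eq_mul]
    congr 1
    rw [← Nat.card_Ico]
    congr 1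
    ext u
    simp only [Finset.mem_filter, Finset.mem_range, Finset.mem_Ico]
    omega
  rw [Finset.sum_congr rfl h', familyCost, edgeCost, Finset.sum_add_distrib]
  ring

/-- The times that a family of intervals leaves at a pair of vertices with set of times `P`. -/
def filled (Δ₁ : ℕ) (P : Finset ℕ) (F : Finset (ℕ × ℕ × ℕ)) : Finset ℕ :=
  F.biUnion fun τ => (P ∩ Finset.Icc τ.2.1 τ.2.2) ∪ addTimes Δ₁ P τ.2.1 (τ.2.2 + 1 - τ.2.1)

lemma keepCount_eq (P : Finset ℕ) {a b : ℕ} (hab : a ≤ b) :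
    keepCount P a (b + 1 - a) = (P ∩ Finset.Icc a b).card := by
  unfold keepCount
  congr 2
  ext t
  simp only [Finset.mem_Ico, Finset.mem_Icc]
  omega

lemma sum_keepCount {P : Finset ℕ} {F : Finset (ℕ × ℕ × ℕ)} (hab : ∀ τ ∈ F, τ.2.1 ≤ τ.2.2)
    (hdis : ∀ τ ∈ F, ∀ τ' ∈ F, τ ≠ τ' →
      Disjoint (Finset.Icc τ.2.1 τ.2.2) (Finset.Icc τ'.2.1 τ'.2.2)) :
    ∑ τ ∈ F, keepCount P τ.2.1 (τ.2.2 + 1 - τ.2.1) =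
      (F.biUnion fun τ => P ∩ Finset.Icc τ.2.1 τ.2.2).card := by
  rw [Finset.card_biUnion]
  · exact Finset.sum_congr rfl fun τ hτ => keepCount_eq P (hab τ hτ)
  · intro τ hτ τ' hτ' hne
    exact (hdis τ hτ τ' hτ' hne).mono Finset.inter_subset_right Finset.inter_subset_right

lemma Spaced.disjoint {Δ₂ : ℕ} (hΔ : 0 < Δ₂) {τ τ' : ℕ × ℕ × ℕ} (h : Spaced Δ₂ τ τ') :
    Disjoint (Finset.Icc τ.2.1 τ.2.2) (Finset.Icc τ'.2.1 τ'.2.2) := by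
  rw [Finset.disjoint_left]
  intro t h1 h2
  simp only [Finset.mem_Icc] at h1 h2
  rcases h with h | h <;> omega

/-- Deleted are the times outside all intervals, added at most the greedy ones. Disjointness of the
intervals makes the kept times add up. -/
lemma card_symmDiff_filled_le {Δ₁ : ℕ} {P : Finset ℕ} {F : Finset (ℕ × ℕ × ℕ)}
    (hab : ∀ τ ∈ F, τ.2.1 ≤ τ.2.2)
    (hdis : ∀ τ ∈ F, ∀ τ' ∈ F, τ ≠ τ' →
      Disjoint (Finset.Icc τ.2.1 τ.2.2) (Finset.Icc τ'.2.1 τ'.2.2)) :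
    (symmDiff P (filled Δ₁ P F)).card ≤ familyCost Δ₁ P F := by
  have hsub : symmDiff P (filled Δ₁ P F) ⊆
      (P \ F.biUnion fun τ => P ∩ Finset.Icc τ.2.1 τ.2.2) ∪
        F.biUnion fun τ => addTimes Δ₁ P τ.2.1 (τ.2.2 + 1 - τ.2.1) := by
    intro t ht
    simp only [Finset.mem_symmDiff, filled, Finset.mem_biUnion, Finset.mem_union,
      Finset.mem_sdiff, Finset.mem_inter] at ht ⊢
    grind
  refine (Finset.card_le_card hsub).trans ((Finset.card_union_le _ _).trans ?_)
  rw [familyCost, sum_keepCount hab hdis, Finset.card_sdiff_of_subset]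
  · exact Nat.add_le_add_left (Finset.card_biUnion_le.trans
      (Finset.sum_le_sum fun τ _ => card_addTimes_le _ _ _ _)) _
  · exact Finset.biUnion_subset.mpr fun τ _ => Finset.inter_subset_left

namespace TemporalGraph

variable {n : ℕ}

/-- The times of the graph described by a plan. -/
def planTimes (G : TemporalGraph (Fin n)) (Δ₁ : ℕ) (S : ℕ → Finset (ℕ × ℕ × ℕ))
    (e : Sym2 (Fin n)) : Finset ℕ :=
  if e.IsDiag then ∅
  else filled Δ₁ (G.times e) ((S (e.sup : Fin n)).filter fun τ => τ.1 ≤ (e.inf : Fin n))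

/-- The temporal graph described by a plan. -/
def planGraph (G : TemporalGraph (Fin n)) (Δ₁ : ℕ) {T Δ₂ m : ℕ}
    {S : ℕ → Finset (ℕ × ℕ × ℕ)} (hS : IsPlan n T Δ₂ m S) : TemporalGraph (Fin n) where
  graph := SimpleGraph.fromEdgeSet {e | (G.planTimes Δ₁ S e).Nonempty}
  times := G.planTimes Δ₁ S
  times_nonempty_iff e := by
    rw [SimpleGraph.edgeSet_fromEdgeSet]
    constructor
    · intro h
      refine ⟨h, fun hd => ?_⟩
      have hd' : e.IsDiag := hd
      simp [planTimes, hd'] at h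
    · exact fun h => h.1
  times_pos e t ht := by
    unfold planTimes at ht
    split_ifs at ht with hd
    · simp at ht
    · simp only [filled, Finset.mem_biUnion, Finset.mem_filter, Finset.mem_union,
        Finset.mem_inter] at ht
      obtain ⟨τ, ⟨hτ, -⟩, ht⟩ := ht
      have hb := hS.bounds _ τ hτ
      rcases ht with ht | ht
      · exact G.times_pos e t ht.1
      · have := addTimes_subset Δ₁ (G.times e) τ.2.1 (l := τ.2.2 + 1 - τ.2.1) (by omega) ht
        simp only [Finset.mem_Ico] at this
        omega

lemma planTimes_of_lt (G : TemporalGraph (Fin n)) (Δ₁ : ℕ) (S : ℕ → Finset (ℕ × ℕ × ℕ))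
    {u v : Fin n} (h : u < v) :
    G.planTimes Δ₁ S s(u, v) =
      filled Δ₁ (G.times s(u, v)) ((S v).filter fun τ => τ.1 ≤ u) := by
  have : ¬ (s(u, v) : Sym2 (Fin n)).IsDiag := by simpa using h.ne
  rw [planTimes, if_neg this, Sym2.sup_mk, Sym2.inf_mk, sup_eq_right.mpr h.le,
    inf_eq_left.mpr h.le]

end TemporalGraph

/-- Going left, a triple leaves the rows only at its left end. So the rows containing it are
consecutive, and the vertex set of its template is a subpath. -/
lemma IsPlan.mem_of_le {n T Δ₂ m : ℕ} {S : ℕ → Finset (ℕ × ℕ × ℕ)} (hS : IsPlan n T Δ₂ m S)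
    {i j : ℕ} {τ : ℕ × ℕ × ℕ} (hτ : τ ∈ S i) (h1 : τ.1 < j) (h2 : j ≤ i) : τ ∈ S j := by
  induction i, h2 using Nat.le_induction with
  | base => exact hτ
  | succ i hi ih =>
    rcases hS.cont i τ hτ with h | h
    · omega
    · exact ih h

namespace TemporalGraph

variable {n : ℕ}

lemma planGraph_isCluster (G : TemporalGraph (Fin n)) {Δ₁ T Δ₂ m : ℕ} (h1 : 0 < Δ₁)
    {S : ℕ → Finset (ℕ × ℕ × ℕ)} (hS : IsPlan n T Δ₂ m S) :
    (G.planGraph Δ₁ hS).IsCluster Δ₁ Δ₂ := by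
  classical
  let U := (Finset.range n).biUnion S
  -- Row `j` belongs to the edge entering `j`, so only the left end is missing from the rows.
  let vs : ℕ × ℕ × ℕ → Finset (Fin n) := fun τ =>
    Finset.univ.filter fun j => (j : ℕ) = τ.1 ∨ τ ∈ S j
  let tp : ℕ × ℕ × ℕ → Template (Fin n) := fun τ =>
    ⟨vs τ, τ.2.1, max τ.2.1 τ.2.2, le_max_left _ _⟩
  have hU : ∀ τ ∈ U, τ ∈ S (τ.1 + 1) ∧ 1 ≤ τ.2.1 ∧ τ.2.1 ≤ τ.2.2 := by
    intro τ hτ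
    obtain ⟨i, -, hi⟩ := Finset.mem_biUnion.mp hτ
    have hb := hS.bounds i τ hi
    exact ⟨hS.mem_of_le hi (by omega) (by omega), hb.2.1, hb.2.2.1⟩
  have hindep : ∀ τ τ', Spaced Δ₂ τ τ' → τ.2.1 ≤ τ.2.2 → τ'.2.1 ≤ τ'.2.2 →
      (tp τ).Independent Δ₂ (tp τ') := by
    intro τ τ' h ha ha'
    refine Or.inr fun s hs t ht => ?_
    simp only [tp, max_eq_right ha, max_eq_right ha', Set.mem_Icc] at hs ht
    rw [le_abs]
    rcases h with h | h <;> omega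
  refine isCluster_of_realises (𝒞 := U.image tp) ?_ ?_ ⟨?_, ?_⟩
  · intro C hC D hD hne
    simp only [Finset.coe_image, Set.mem_image, Finset.mem_coe] at hC hD
    obtain ⟨τ, hτ, rfl⟩ := hC
    obtain ⟨τ', hτ', rfl⟩ := hD
    have hne' : τ ≠ τ' := fun h => hne (h ▸ rfl)
    by_cases hd : Disjoint (vs τ) (vs τ')
    · exact Or.inl hd
    · rw [Finset.not_disjoint_iff] at hd
      obtain ⟨j, hj, hj'⟩ := hd
      simp only [vs, Finset.mem_filter, Finset.mem_univ, true_and] at hj hj'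
      obtain ⟨a1, -, a2⟩ := hU τ hτ
      obtain ⟨b1, -, b2⟩ := hU τ' hτ'
      refine hindep τ τ' ?_ a2 b2
      -- At a common vertex `j`, both templates begin there (row `j + 1`), or one begins there while
      -- the other arrives through row `j` (condition `cross`), or both arrive through row `j`.
      rcases hj with hj | hj <;> rcases hj' with hj' | hj'
      · rw [← hj'] at b1
        rw [← hj] at a1
        exact hS.within _ τ a1 τ' b1 hne'
      · rw [← hj] at a1
        exact (hS.cross _ τ' hj' τ a1 hne'.symm).symm
      · rw [← hj'] at b1
        exact hS.cross _ τ hj τ' b1 hne'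
      · exact hS.within _ τ hj τ' hj' hne'
  · intro C hC
    simp only [Finset.mem_image] at hC
    obtain ⟨τ, hτ, rfl⟩ := hC
    exact (hU τ hτ).2.1
  · have key : ∀ x y : Fin n, x < y → ∀ t, t ∈ G.planTimes Δ₁ S s(x, y) →
        ∃ C ∈ U.image tp, x ∈ C.verts ∧ y ∈ C.verts ∧ C.a ≤ t ∧ t ≤ C.b := by
      intro x y hxy t ht
      rw [planTimes_of_lt _ _ _ hxy] at ht
      simp only [filled, Finset.mem_biUnion, Finset.mem_filter, Finset.mem_union,
        Finset.mem_inter] at ht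
      obtain ⟨τ, ⟨hτ, hτx⟩, ht⟩ := ht
      have hb := hS.bounds _ τ hτ
      refine ⟨tp τ, Finset.mem_image_of_mem _ (Finset.mem_biUnion.mpr
        ⟨y, Finset.mem_range.mpr y.2, hτ⟩), ?_, ?_, ?_⟩
      · simp only [tp, vs, Finset.mem_filter, Finset.mem_univ, true_and]
        rcases hτx.lt_or_eq with h | h
        · exact Or.inr (hS.mem_of_le hτ h (le_of_lt hxy))
        · exact Or.inl h.symm
      · simp only [tp, vs, Finset.mem_filter, Finset.mem_univ, true_and]
        exact Or.inr hτ
      · simp only [tp, max_eq_right hb.2.2.1]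
        rcases ht with ht | ht
        · exact Finset.mem_Icc.mp ht.2
        · have := addTimes_subset Δ₁ _ τ.2.1 (l := τ.2.2 + 1 - τ.2.1) (by omega) ht
          simp only [Finset.mem_Ico] at this
          omega
    intro x y t ht
    rcases lt_trichotomy x y with h | h | h
    · exact key x y h t ht
    · subst h
      have : t ∈ (G.planGraph Δ₁ hS).times s(x, x) := ht
      simp [times_diag] at this
    · obtain ⟨C, hC, h1, h2, h3⟩ := key y x h t (by rw [Sym2.eq_swap]; exact ht)
      exact ⟨C, hC, h2, h1, h3⟩
  · have key : ∀ τ ∈ U, ∀ x ∈ vs τ, ∀ y ∈ vs τ, x < y →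
        (G.planGraph Δ₁ hS).IsDense Δ₁ s(x, y) τ.2.1 τ.2.2 := by
      intro τ hτ x hx y hy hxy σ hσ hσ'
      simp only [vs, Finset.mem_filter, Finset.mem_univ, true_and] at hx hy
      have hx' : τ.1 ≤ x := by
        rcases hx with h | h
        · exact h.ge
        · exact (hS.bounds _ _ h).1.le
      have hy' : τ ∈ S y := by
        rcases hy with h | h
        · have : (x : ℕ) < y := hxy
          omega
        · exact h
      obtain ⟨t, ht, ht'⟩ := addTimes_dense h1 (G.times s(x, y)) (hU τ hτ).2.2 hσ hσ'
      refine ⟨t, ?_, ht'⟩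
      show t ∈ G.planTimes Δ₁ S s(x, y)
      rw [planTimes_of_lt _ _ _ hxy]
      exact Finset.mem_biUnion.mpr ⟨τ, Finset.mem_filter.mpr ⟨hy', hx'⟩, ht⟩
    intro C hC x hx y hy hxy
    simp only [Finset.mem_image] at hC
    obtain ⟨τ, hτ, rfl⟩ := hC
    simp only [tp, max_eq_right (hU τ hτ).2.2] at hx hy ⊢
    rcases lt_or_gt_of_ne hxy with h | h
    · exact key τ hτ x hx y hy h
    · rw [Sym2.eq_swap]
      exact key τ hτ y hy x hx h

lemma editDist_eq (G G' : TemporalGraph (Fin n)) :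
    G.editDist G' = ∑ i ∈ Finset.range (n - 1), ∑ u ∈ Finset.range (i + 1),
      (symmDiff (G.pairTimes u (i + 1)) (G'.pairTimes u (i + 1))).card := by
  unfold editDist
  cases n with
  | zero => simp
  | succ n => rw [Finset.sum_range_succ']; simp

/-- The times of the edge `{i, i + 1}`. -/
def pathTimes (G : TemporalGraph (Fin n)) (i : ℕ) : Finset ℕ := G.pairTimes i (i + 1)

lemma pairTimes_eq_empty {G : TemporalGraph (Fin n)} (hG : G.graph = SimpleGraph.pathGraph n)
    {u i : ℕ} (h : u < i) : G.pairTimes u (i + 1) = ∅ := by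
  unfold pairTimes
  split_ifs with hn
  · by_contra hne
    have := (G.times_nonempty_iff _).mp (Finset.nonempty_iff_ne_empty.mpr hne)
    rw [hG, SimpleGraph.mem_edgeSet, SimpleGraph.pathGraph_adj] at this
    simp only at this
    omega
  · rfl

lemma etc_of_plan {G : TemporalGraph (Fin n)} (hG : G.graph = SimpleGraph.pathGraph n)
    {Δ₁ Δ₂ T m k : ℕ} (h1 : 0 < Δ₁) (h2 : 0 < Δ₂) {S : ℕ → Finset (ℕ × ℕ × ℕ)}
    (hS : IsPlan n T Δ₂ m S)
    (hk : ∑ i ∈ Finset.range (n - 1), edgeCost Δ₁ i (G.pathTimes i) (S (i + 1)) ≤ k) :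
    G.ETC Δ₁ Δ₂ k := by
  rw [etc_iff]
  refine ⟨G.planGraph Δ₁ hS, G.planGraph_isCluster h1 hS, le_trans ?_ hk⟩
  rw [editDist_eq]
  refine Finset.sum_le_sum fun i hi => ?_
  rw [pathTimes, ← sum_familyCost Δ₁ i (fun u => G.pairTimes u (i + 1)) (S (i + 1))
    (fun u hu => pairTimes_eq_empty hG hu)
    (fun τ hτ => Nat.lt_succ_iff.mp (hS.bounds _ τ hτ).1)]
  refine Finset.sum_le_sum fun u hu => ?_
  have hi' := Finset.mem_range.mp hi
  have hu' := Finset.mem_range.mp hu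
  have hun : u < n := by omega
  have hin : i + 1 < n := by omega
  have e1 : (G.planGraph Δ₁ hS).pairTimes u (i + 1) =
      filled Δ₁ (G.pairTimes u (i + 1)) ((S (i + 1)).filter fun τ => τ.1 ≤ u) := by
    have := G.planTimes_of_lt Δ₁ S (u := ⟨u, hun⟩) (v := ⟨i + 1, hin⟩) hu'
    rw [pairTimes, pairTimes, dif_pos ⟨hun, hin⟩, dif_pos ⟨hun, hin⟩]
    exact this
  rw [e1]
  refine card_symmDiff_filled_le ?_ ?_
  · intro τ hτ
    exact (hS.bounds _ τ (Finset.mem_filter.mp hτ).1).2.2.1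
  · intro τ hτ τ' hτ' hne
    exact (hS.within _ τ (Finset.mem_filter.mp hτ).1 τ' (Finset.mem_filter.mp hτ').1
      hne).disjoint h2

end TemporalGraph

/-! ## From cluster temporal graphs to plans -/

/-- The lower bound at one pair of vertices. Surviving times of `P` lie in the intervals, which
bounds the deletions. Additions are found in disjoint host sets `J c`, which may be larger than the
intervals because templates are cut off at the lifetime. -/
lemma familyCost_image_le {ι : Type} {Δ₁ : ℕ} {P P' : Finset ℕ} (A : Finset ι)
    (f : ι → ℕ × ℕ × ℕ) (J : ι → Finset ℕ) (hinj : Set.InjOn f A)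
    (hJ : ∀ c ∈ A, ∀ d ∈ A, c ≠ d → Disjoint (J c) (J d))
    (hab : ∀ c ∈ A, (f c).2.1 ≤ (f c).2.2)
    (hsub : ∀ c ∈ A, Finset.Icc (f c).2.1 (f c).2.2 ⊆ J c)
    (hcov : ∀ t ∈ P, t ∈ P' → ∃ c ∈ A, t ∈ Finset.Icc (f c).2.1 (f c).2.2)
    (hadd : ∀ c ∈ A, addCost Δ₁ P (f c).2.1 ((f c).2.2 + 1 - (f c).2.1) ≤
      ((P' \ P) ∩ J c).card) :
    familyCost Δ₁ P (A.image f) ≤ (symmDiff P P').card := by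
  have hunion : (symmDiff P P').card = (P \ P').card + (P' \ P).card := by
    rw [symmDiff_def, Finset.sup_eq_union, Finset.card_union_of_disjoint]
    exact disjoint_sdiff_sdiff
  rw [hunion, familyCost]
  refine Nat.add_le_add ?_ ?_
  · rw [sum_keepCount]
    · rw [← Finset.card_sdiff_of_subset
        (Finset.biUnion_subset.mpr fun τ _ => Finset.inter_subset_left)]
      refine Finset.card_le_card fun t ht => ?_
      simp only [Finset.mem_sdiff, Finset.mem_biUnion, not_exists, not_and] at ht ⊢
      refine ⟨ht.1, fun h => ?_⟩
      obtain ⟨c, hc, h'⟩ := hcov t ht.1 h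
      exact ht.2 _ (Finset.mem_image_of_mem f hc) (Finset.mem_inter.mpr ⟨ht.1, h'⟩)
    · simpa using hab
    · intro τ hτ τ' hτ' hne
      obtain ⟨c, hc, rfl⟩ := Finset.mem_image.mp hτ
      obtain ⟨d, hd, rfl⟩ := Finset.mem_image.mp hτ'
      exact (hJ c hc d hd fun h => hne (h ▸ rfl)).mono (hsub c hc) (hsub d hd)
  · rw [Finset.sum_image hinj]
    refine (Finset.sum_le_sum hadd).trans ?_
    rw [← Finset.card_biUnion]
    · exact Finset.card_le_card (Finset.biUnion_subset.mpr fun c _ => Finset.inter_subset_left)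
    · intro c hc d hd hne
      exact (hJ c hc d hd hne).mono Finset.inter_subset_right Finset.inter_subset_right

/-! ### Cutting templates into crossing pieces -/

section Extract

variable {n : ℕ}

/-- The template contains both endpoints of the edge `{i, i + 1}` and one of its times in `P i`. -/
def Crosses (P : ℕ → Finset ℕ) (i : ℕ) (C : Template (Fin n)) : Prop :=
  (∃ h : i + 1 < n, (⟨i, by omega⟩ : Fin n) ∈ C.verts ∧ (⟨i + 1, h⟩ : Fin n) ∈ C.verts) ∧
    (P i ∩ Finset.Icc C.a C.b).Nonempty

open Classical in
/-- The leftmost vertex from which the template crosses all edges up to the vertex `i`. -/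
noncomputable def leftEnd (P : ℕ → Finset ℕ) (C : Template (Fin n)) : ℕ → ℕ
  | 0 => 0
  | i + 1 => if Crosses P i C then leftEnd P C i else i + 1

/-- The triple describing a template that crosses the edge `{i, i + 1}`. -/
noncomputable def tripleOf (P : ℕ → Finset ℕ) (T i : ℕ) (C : Template (Fin n)) : ℕ × ℕ × ℕ :=
  (leftEnd P C i, C.a, min C.b T)

open Classical in
/-- The plan of a collection of templates. -/
noncomputable def extractPlan (P : ℕ → Finset ℕ) (T : ℕ) (𝒞 : Finset (Template (Fin n))) :
    ℕ → Finset (ℕ × ℕ × ℕ)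
  | 0 => ∅
  | i + 1 => (𝒞.filter (Crosses P i)).image (tripleOf P T i)

lemma leftEnd_le (P : ℕ → Finset ℕ) (C : Template (Fin n)) (i : ℕ) : leftEnd P C i ≤ i := by
  induction i with
  | zero => simp [leftEnd]
  | succ i ih =>
    simp only [leftEnd]
    split_ifs <;> omega

lemma crosses_of_leftEnd_le {P : ℕ → Finset ℕ} {C : Template (Fin n)} {i u : ℕ}
    (h : leftEnd P C i ≤ u) (hu : u < i) : Crosses P u C := by
  induction i with
  | zero => omega
  | succ i ih =>
    simp only [leftEnd] at h
    split_ifs at h with hc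
    · rcases Nat.lt_succ_iff_lt_or_eq.mp hu with h' | h'
      · exact ih h h'
      · exact h' ▸ hc
    · omega

lemma Template.Independent.disjoint {Δ₂ : ℕ} {C D : Template (Fin n)} {x : Fin n}
    (h : C.Independent Δ₂ D) (hx : x ∈ C.verts) (hx' : x ∈ D.verts) :
    ∀ s t, C.a ≤ s → s ≤ C.b → D.a ≤ t → t ≤ D.b → s + Δ₂ ≤ t ∨ t + Δ₂ ≤ s := by
  intro s t h1 h2 h3 h4
  rcases h with h | h
  · exact absurd hx' (Finset.disjoint_left.mp h hx)
  · have := h s ⟨h1, h2⟩ t ⟨h3, h4⟩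
    rw [le_abs] at this
    rcases this with h | h <;> omega

lemma Template.Independent.spaced {Δ₂ : ℕ} (hΔ : 0 < Δ₂) {C D : Template (Fin n)} {x : Fin n}
    (h : C.Independent Δ₂ D) (hx : x ∈ C.verts) (hx' : x ∈ D.verts) :
    C.b + Δ₂ ≤ D.a ∨ D.b + Δ₂ ≤ C.a := by
  have key := h.disjoint hx hx'
  have hC := C.a_le_b
  have hD := D.a_le_b
  rcases key C.b D.a hC le_rfl le_rfl hD with h1 | h1
  · exact Or.inl h1
  · rcases key C.a D.b le_rfl hC hD le_rfl with h2 | h2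
    -- Here the intervals overlap, so the later of the two starting times lies in both and has
    -- distance 0 from itself.
    · exfalso
      have h3 := key C.a D.a le_rfl hC le_rfl hD
      have h4 := key C.b D.b hC le_rfl hD le_rfl
      rcases h3 with h3 | h3
      · have h5 := key D.a D.a (by omega) (by omega) le_rfl hD
        omega
      · have h5 := key C.a C.a le_rfl hC (by omega) (by omega)
        omega
    · exact Or.inr h2

lemma Crosses.le_lifetime {P : ℕ → Finset ℕ} {T i : ℕ} {C : Template (Fin n)}
    (h : Crosses P i C) (hT : ∀ t ∈ P i, t ≤ T) : C.a ≤ T := by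
  obtain ⟨-, t, ht⟩ := h
  simp only [Finset.mem_inter, Finset.mem_Icc] at ht
  exact ht.2.1.trans (hT t ht.1)

lemma spaced_tripleOf {P : ℕ → Finset ℕ} {T Δ₂ i j : ℕ} {C D : Template (Fin n)}
    (h : C.b + Δ₂ ≤ D.a ∨ D.b + Δ₂ ≤ C.a) : Spaced Δ₂ (tripleOf P T i C) (tripleOf P T j D) := by
  have h1 := min_le_left C.b T
  have h2 := min_le_left D.b T
  rcases h with h | h
  · exact Or.inl (by simp only [tripleOf]; omega)
  · exact Or.inr (by simp only [tripleOf]; omega)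

lemma extractPlan_isPlan {P : ℕ → Finset ℕ} {T Δ₂ m : ℕ} {𝒞 : Finset (Template (Fin n))}
    (hΔ : 0 < Δ₂) (hT : ∀ i, ∀ t ∈ P i, t ≤ T) (hm : ∀ i, (P i).card ≤ m)
    (hind : (𝒞 : Set (Template (Fin n))).Pairwise (Template.Independent Δ₂))
    (hpos : ∀ C ∈ 𝒞, 1 ≤ C.a) :
    IsPlan n T Δ₂ m (extractPlan P T 𝒞) where
  empty i hi := by
    classical
    cases i with
    | zero => rfl
    | succ i =>
      rw [extractPlan, Finset.image_eq_empty, Finset.filter_eq_empty_iff]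
      rintro C - ⟨⟨h, -⟩, -⟩
      omega
  bounds i τ hτ := by
    cases i with
    | zero => simp [extractPlan] at hτ
    | succ i =>
      simp only [extractPlan, Finset.mem_image, Finset.mem_filter] at hτ
      obtain ⟨C, ⟨hC, hcr⟩, rfl⟩ := hτ
      exact ⟨Nat.lt_succ_of_le (leftEnd_le P C i), hpos C hC,
        le_min C.a_le_b (hcr.le_lifetime (hT i)), min_le_right _ _⟩
  cont i τ hτ := by
    simp only [extractPlan, Finset.mem_image, Finset.mem_filter] at hτ
    obtain ⟨C, ⟨hC, hcr⟩, rfl⟩ := hτ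
    cases i with
    | zero => exact Or.inl rfl
    | succ i =>
      -- If the preceding edge is crossed too, the left end is inherited and the triple is the same;
      -- otherwise a new piece begins.
      by_cases hc : Crosses P i C
      · right
        simp only [extractPlan, Finset.mem_image, Finset.mem_filter]
        exact ⟨C, ⟨hC, hc⟩, by simp [tripleOf, leftEnd, hc]⟩
      · left
        simp [tripleOf, leftEnd, hc]
  within i τ hτ τ' hτ' hne := by
    cases i with
    | zero => simp [extractPlan] at hτ
    | succ i =>
      simp only [extractPlan, Finset.mem_image, Finset.mem_filter] at hτ hτ'
      obtain ⟨C, ⟨hC, hcr⟩, rfl⟩ := hτ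
      obtain ⟨D, ⟨hD, hdr⟩, rfl⟩ := hτ'
      obtain ⟨⟨h, hx, -⟩, -⟩ := hcr
      obtain ⟨⟨h', hx', -⟩, -⟩ := hdr
      exact spaced_tripleOf ((hind hC hD fun h => hne (h ▸ rfl)).spaced hΔ hx hx')
  cross i τ hτ τ' hτ' hne := by
    cases i with
    | zero => simp [extractPlan] at hτ
    | succ i =>
      simp only [extractPlan, Finset.mem_image, Finset.mem_filter] at hτ hτ'
      obtain ⟨C, ⟨hC, hcr⟩, rfl⟩ := hτ
      obtain ⟨D, ⟨hD, hdr⟩, rfl⟩ := hτ'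
      -- One template crossing both edges yields the same triple in both rows, so different triples
      -- come from different templates.
      have hCD : C ≠ D := by
        rintro rfl
        exact hne (by simp [tripleOf, leftEnd, hcr])
      obtain ⟨⟨h, -, hx⟩, -⟩ := hcr
      obtain ⟨⟨h', hx', -⟩, -⟩ := hdr
      exact spaced_tripleOf ((hind hC hD hCD).spaced hΔ hx hx')
  card_le i := by
    classical
    cases i with
    | zero => simp [extractPlan]
    | succ i =>
      refine Finset.card_image_le.trans (le_trans ?_ (hm i))
      -- Choosing a time of the edge in each crossing template is injective, as the intervals are
      -- disjoint. This bounds the length of the rows.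
      have hne : ∀ C ∈ 𝒞.filter (Crosses P i), ∃ t ∈ P i, C.a ≤ t ∧ t ≤ C.b := by
        intro C hC
        obtain ⟨-, t, ht⟩ := (Finset.mem_filter.mp hC).2
        simp only [Finset.mem_inter, Finset.mem_Icc] at ht
        exact ⟨t, ht⟩
      choose! g hg hg' using hne
      refine Finset.card_le_card_of_injOn g (fun C hC => hg C hC) ?_
      intro C hC D hD hCD
      by_contra hne
      have hC' := Finset.mem_filter.mp hC
      have hD' := Finset.mem_filter.mp hD
      obtain ⟨⟨h, hx, -⟩, -⟩ := hC'.2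
      obtain ⟨⟨h', hx', -⟩, -⟩ := hD'.2
      have h1 := (hind hC'.1 hD'.1 hne).spaced hΔ hx hx'
      have h2 := hg' C hC
      have h3 := hg' D hD
      have hCD' : g C = g D := hCD
      omega

end Extract

namespace TemporalGraph

variable {n : ℕ}

lemma exists_plan_of_etc {G : TemporalGraph (Fin n)} (hG : G.graph = SimpleGraph.pathGraph n)
    {Δ₁ Δ₂ m k : ℕ} (h12 : Δ₁ < Δ₂)
    (hm : ∀ i, (G.pathTimes i).card ≤ m) (hetc : G.ETC Δ₁ Δ₂ k) :
    ∃ S : ℕ → Finset (ℕ × ℕ × ℕ), IsPlan n G.lifetime Δ₂ m S ∧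
      ∑ i ∈ Finset.range (n - 1), edgeCost Δ₁ i (G.pathTimes i) (S (i + 1)) ≤ k := by
  classical
  rw [etc_iff] at hetc
  obtain ⟨G', ⟨𝒞, ⟨hind, hbd⟩, hreal⟩, hk⟩ := hetc
  have hΔ : 0 < Δ₂ := by omega
  have hT : ∀ i, ∀ t ∈ G.pathTimes i, t ≤ G.lifetime := by
    intro i t ht
    unfold pathTimes pairTimes at ht
    split_ifs at ht
    · exact G.le_lifetime ht
    · simp at ht
  set P := G.pathTimes with hP
  set T := G.lifetime with hTdef
  have hplan : IsPlan n T Δ₂ m (extractPlan P T 𝒞) :=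
    extractPlan_isPlan hΔ hT hm hind fun C hC => (hbd C hC).1
  refine ⟨extractPlan P T 𝒞, hplan, le_trans ?_ hk⟩
  rw [editDist_eq]
  refine Finset.sum_le_sum fun i hi => ?_
  rw [hP, pathTimes, ← sum_familyCost Δ₁ i (fun u => G.pairTimes u (i + 1)) _
    (fun u hu => pairTimes_eq_empty hG hu)
    (fun τ hτ => Nat.lt_succ_iff.mp (hplan.bounds _ τ hτ).1)]
  refine Finset.sum_le_sum fun u hu => ?_
  have hi' := Finset.mem_range.mp hi
  have hu' := Finset.mem_range.mp hu
  have hun : u < n := by omega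
  have hin : i + 1 < n := by omega
  set x : Fin n := ⟨u, hun⟩ with hx
  set y : Fin n := ⟨i + 1, hin⟩ with hy
  have hxy : x ≠ y := by
    intro h
    have : u = i + 1 := congrArg Fin.val h
    omega
  have ePT : G.pairTimes u (i + 1) = G.times s(x, y) := G.pairTimes_fin x y
  have ePT' : G'.pairTimes u (i + 1) = G'.times s(x, y) := G'.pairTimes_fin x y
  rw [extractPlan, Finset.filter_image]
  -- A left end of at most `u` means that all edges from `u` to `i + 1` are crossed, so the template
  -- contains `u`.
  have hverts : ∀ C ∈ (𝒞.filter (Crosses P i)).filter (fun C => (tripleOf P T i C).1 ≤ u),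
      C ∈ 𝒞 ∧ x ∈ C.verts ∧ y ∈ C.verts ∧ C.a ≤ T := by
    intro C hC
    simp only [Finset.mem_filter] at hC
    obtain ⟨⟨hC, hcr⟩, hl⟩ := hC
    have hcr' := hcr
    obtain ⟨⟨h, h1, h2⟩, -⟩ := hcr
    refine ⟨hC, ?_, h2, hcr'.le_lifetime (hT i)⟩
    rcases Nat.lt_succ_iff_lt_or_eq.mp hu' with h' | h'
    · obtain ⟨⟨h, h1, h2⟩, -⟩ := crosses_of_leftEnd_le hl h'
      exact h1
    · subst h'
      exact h1
  have hspaced : ∀ C ∈ (𝒞.filter (Crosses P i)).filter (fun C => (tripleOf P T i C).1 ≤ u),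
      ∀ D ∈ (𝒞.filter (Crosses P i)).filter (fun C => (tripleOf P T i C).1 ≤ u), C ≠ D →
      C.b + Δ₂ ≤ D.a ∨ D.b + Δ₂ ≤ C.a := by
    intro C hC D hD hne
    obtain ⟨hC1, -, hC2, -⟩ := hverts C hC
    obtain ⟨hD1, -, hD2, -⟩ := hverts D hD
    exact (hind hC1 hD1 hne).spaced hΔ hC2 hD2
  refine familyCost_image_le _ _ (fun C => Finset.Icc C.a C.b) ?_ ?_ ?_ ?_ ?_ ?_
  · intro C hC D hD hCD
    by_contra hne
    have h1 := hspaced C hC D hD hne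
    have h2 : C.a = D.a := congrArg (fun τ => τ.2.1) hCD
    have h3 := C.a_le_b
    have h4 := D.a_le_b
    omega
  · intro C hC D hD hne
    rw [Finset.disjoint_left]
    intro t ht ht'
    have h1 := hspaced C hC D hD hne
    simp only [Finset.mem_Icc] at ht ht'
    omega
  · intro C hC
    exact le_min C.a_le_b (hverts C hC).2.2.2
  · intro C hC
    exact Finset.Icc_subset_Icc le_rfl (min_le_left _ _)
  -- An original time exists only for `u = i`. The template covering a surviving one crosses the
  -- edge by definition, so it is part of the row.
  · intro t ht ht'
    have hui : u = i := by
      by_contra hne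
      rw [pairTimes_eq_empty hG (by omega)] at ht
      simp at ht
    have htT : t ≤ T := by
      rw [ePT] at ht
      exact G.le_lifetime ht
    rw [ePT'] at ht'
    obtain ⟨C, hC, h1, h2, h3, h4⟩ := hreal.1 x y t ht'
    refine ⟨C, ?_, ?_⟩
    · simp only [Finset.mem_filter]
      refine ⟨⟨hC, ⟨hin, ?_, h2⟩, t, ?_⟩, ?_⟩
      · subst hui
        exact h1
      · subst hui
        exact Finset.mem_inter.mpr ⟨ht, Finset.mem_Icc.mpr ⟨h3, h4⟩⟩
      · rw [hui]
        exact leftEnd_le P C i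
    · exact Finset.mem_Icc.mpr ⟨h3, le_min h4 htT⟩
  · intro C hC
    obtain ⟨hC1, hCx, hCy, hCT⟩ := hverts C hC
    rw [ePT, ePT']
    refine addCost_le_card (min_le_left _ _) (le_min C.a_le_b hCT) ?_ ?_ ?_
    -- Cutting the interval at the lifetime of `G` loses no original time.
    · intro t ht htb
      exact le_min htb (G.le_lifetime ht)
    · exact hreal.2 C hC1 x hCx y hCy hxy
    -- A time in `[a, a + Δ₁)` covered by another template would put that template, which also
    -- contains `x`, at distance less than `Δ₂` from `a`. This is where `Δ₁ < Δ₂` is needed.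
    · intro t ht h1 h2
      change C.a ≤ t at h1
      change t < C.a + Δ₁ at h2
      obtain ⟨D, hD, h3, -, h5, h6⟩ := hreal.1 x y t ht
      by_cases hCD : C = D
      · exact hCD ▸ h6
      · have := (hind hC1 hD hCD).disjoint hCx h3 C.a t le_rfl C.a_le_b h5 h6
        omega

end TemporalGraph

/-! ## Codes of plan rows and the dynamic program -/

/-- The digit at position `q` of `y` in base `B`. -/
def digit (B y q : ℕ) : ℕ := y / B ^ q % B

/-- The triple `(l, a, b)` coded by a digit. -/
def decode (T z : ℕ) : ℕ × ℕ × ℕ := (z / T / T, z % T + 1, z / T % T + 1)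

/-- The digit codes a template with leftmost vertex before `r`. -/
def IsTpl (T r z : ℕ) : Prop := z / T / T < r ∧ z % T + 1 ≤ z / T % T + 1

instance (T r z : ℕ) : Decidable (IsTpl T r z) := inferInstanceAs (Decidable (_ ∧ _))

/-- The intervals of two coded templates are at distance less than `Δ₂`. -/
def Conflict (T Δ₂ z z' : ℕ) : Prop := z' % T + 1 < z / T % T + 1 + Δ₂ ∧ z % T + 1 < z' / T % T + 1 + Δ₂

instance (T Δ₂ z z' : ℕ) : Decidable (Conflict T Δ₂ z z') := inferInstanceAs (Decidable (_ ∧ _))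

/-- The templates coded by a row. -/
def codeSet (T B m r y : ℕ) : Finset (ℕ × ℕ × ℕ) :=
  ((Finset.range m).filter fun q => IsTpl T r (digit B y q)).image fun q => decode T (digit B y q)

/-- The number of slots of row `i` that hold the template in slot `q` of row `i + 1`, counting one
more if that template begins at the vertex `i`. -/
def foundCount (T B m i x z : ℕ) : ℕ :=
  (if z / T / T = i then 1 else 0) +
    ∑ p ∈ Finset.range m, if IsTpl T i (digit B x p) ∧ digit B x p = z then 1 else 0

/-- The conflicts of slot `q` of row `i + 1` with slot `p` of both rows. -/
def clashCount (T Δ₂ B i x y q p : ℕ) : ℕ :=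
  (if IsTpl T (i + 1) (digit B y q) ∧ IsTpl T i (digit B x p) ∧ digit B x p ≠ digit B y q ∧
      Conflict T Δ₂ (digit B x p) (digit B y q) then 1 else 0) +
  (if IsTpl T (i + 1) (digit B y q) ∧ IsTpl T (i + 1) (digit B y p) ∧ p ≠ q ∧
      Conflict T Δ₂ (digit B y p) (digit B y q) then 1 else 0)

/-- The number of violations of the plan conditions between the rows `i` and `i + 1`. -/
def badCount (T Δ₂ B m i x y : ℕ) : ℕ :=
  ∑ q ∈ Finset.range m, ((∑ p ∈ Finset.range m, clashCount T Δ₂ B i x y q p) +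
    if IsTpl T (i + 1) (digit B y q) ∧ foundCount T B m i x (digit B y q) = 0 then 1 else 0)

/-- The number of times of `P` covered by the templates of a row. -/
def rowGain (T B m i : ℕ) (P : Finset ℕ) (y : ℕ) : ℕ :=
  ∑ q ∈ Finset.range m, if IsTpl T (i + 1) (digit B y q) then
    keepCount P (decode T (digit B y q)).2.1
      ((decode T (digit B y q)).2.2 + 1 - (decode T (digit B y q)).2.1) else 0

/-- The number of times to be added for the templates of a row. -/
def rowLoss (Δ₁ T B m i : ℕ) (P : Finset ℕ) (y : ℕ) : ℕ :=
  ∑ q ∈ Finset.range m, if IsTpl T (i + 1) (digit B y q) then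
    addCost Δ₁ P (decode T (digit B y q)).2.1
      ((decode T (digit B y q)).2.2 + 1 - (decode T (digit B y q)).2.1) +
    (i - (decode T (digit B y q)).1) * addCost Δ₁ ∅ (decode T (digit B y q)).2.1
      ((decode T (digit B y q)).2.2 + 1 - (decode T (digit B y q)).2.1) else 0

/-- One more than the largest remaining budget after the edges before the vertex `i`, over the plans
whose row `i` is coded by `y`; `0` if there are none within the budget `k`. -/
def dpValue (Δ₁ Δ₂ T B m k : ℕ) (P : ℕ → Finset ℕ) : ℕ → ℕ → ℕ
  | 0, y => if y = 0 then k + 1 else 0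
  | i + 1, y => (Finset.range (B ^ m)).sup fun x =>
      if badCount T Δ₂ B m i x y = 0 then
        dpValue Δ₁ Δ₂ T B m k P i x + rowGain T B m i (P i) y -
          ((P i).card + rowLoss Δ₁ T B m i (P i) y)
      else 0

lemma not_conflict_iff {T Δ₂ z z' : ℕ} :
    ¬ Conflict T Δ₂ z z' ↔ Spaced Δ₂ (decode T z) (decode T z') := by
  simp only [Conflict, Spaced, decode]
  omega

lemma badCount_eq_zero {T Δ₂ B m i x y : ℕ} :
    badCount T Δ₂ B m i x y = 0 ↔ ∀ q < m, IsTpl T (i + 1) (digit B y q) →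
      (digit B y q / T / T = i ∨ ∃ p < m, IsTpl T i (digit B x p) ∧ digit B x p = digit B y q) ∧
      ∀ p < m, (IsTpl T i (digit B x p) → digit B x p ≠ digit B y q →
          ¬ Conflict T Δ₂ (digit B x p) (digit B y q)) ∧
        (p ≠ q → IsTpl T (i + 1) (digit B y p) → ¬ Conflict T Δ₂ (digit B y p) (digit B y q)) := by
  have hf : ∀ z, foundCount T B m i x z = 0 ↔
      ¬ (z / T / T = i ∨ ∃ p < m, IsTpl T i (digit B x p) ∧ digit B x p = z) := by
    intro z
    simp only [foundCount, Nat.add_eq_zero_iff, Finset.sum_eq_zero_iff, Finset.mem_range,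
      ite_eq_right_iff, one_ne_zero, imp_false]
    push Not
    rfl
  simp only [badCount, Finset.sum_eq_zero_iff, Nat.add_eq_zero_iff, Finset.mem_range, clashCount,
    ite_eq_right_iff, one_ne_zero, imp_false, hf]
  constructor
  · intro h q hq ht
    obtain ⟨h1, h2⟩ := h q hq
    refine ⟨by_contra fun hc => h2 ⟨ht, hc⟩, fun p hp => ⟨fun a b c => (h1 p hp).1 ⟨ht, a, b, c⟩,
      fun a b c => (h1 p hp).2 ⟨ht, b, a, c⟩⟩⟩
  · intro h q hq
    refine ⟨fun p hp => ⟨fun ⟨ht, a, b, c⟩ => ((h q hq ht).2 p hp).1 a b c,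
      fun ⟨ht, a, b, c⟩ => ((h q hq ht).2 p hp).2 b a c⟩, fun ⟨ht, hc⟩ => hc (h q hq ht).1⟩

lemma decode_injective {T : ℕ} : Function.Injective (decode T) := by
  intro z z' h
  simp only [decode, Prod.mk.injEq, Nat.add_right_cancel_iff] at h
  rw [← Nat.div_add_mod z T, ← Nat.div_add_mod z' T, ← Nat.div_add_mod (z / T) T,
    ← Nat.div_add_mod (z' / T) T, h.1, h.2.1, h.2.2]

lemma mem_codeSet {T B m r y : ℕ} {τ : ℕ × ℕ × ℕ} :
    τ ∈ codeSet T B m r y ↔ ∃ q < m, IsTpl T r (digit B y q) ∧ decode T (digit B y q) = τ := by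
  simp [codeSet, and_assoc]

/-- The program sums over slots, the plan over a set of triples; the sums agree as soon as no
template occupies two slots. -/
lemma edgeCost_codeSet {Δ₁ T B m i y : ℕ} {P : Finset ℕ}
    (hinj : ∀ q < m, ∀ p < m, IsTpl T (i + 1) (digit B y q) → IsTpl T (i + 1) (digit B y p) →
      digit B y q = digit B y p → q = p) :
    edgeCost Δ₁ i P (codeSet T B m (i + 1) y) =
      P.card - rowGain T B m i P y + rowLoss Δ₁ T B m i P y := by
  have hI : Set.InjOn (fun q => decode T (digit B y q))
      ((Finset.range m).filter fun q => IsTpl T (i + 1) (digit B y q)) := by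
    intro q hq p hp h
    simp only [Finset.coe_filter, Finset.mem_range, Set.mem_ofPred_eq] at hq hp
    exact hinj q hq.1 p hp.1 hq.2 hp.2 (decode_injective h)
  rw [edgeCost, codeSet, Finset.sum_image hI, Finset.sum_image hI, rowGain, rowLoss,
    Finset.sum_filter, Finset.sum_filter]

/-- Consecutive rows satisfy the plan conditions. -/
structure IsRowChain (T Δ₂ B m i : ℕ) (x : ℕ → ℕ) : Prop where
  zero : x 0 = 0
  lt : ∀ j, x j < B ^ m
  bad : ∀ j < i, badCount T Δ₂ B m j (x j) (x (j + 1)) = 0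

/-- Within a row, clashes are tested between different slots rather than different codes. So a
repeated template clashes with itself, and rows without violations have no repetitions. -/
lemma IsTpl.conflict_self {T Δ₂ r z : ℕ} (h : 0 < Δ₂) (hz : IsTpl T r z) :
    Conflict T Δ₂ z z := by
  simp only [IsTpl, Conflict] at *
  omega

lemma digit_injOn_of_bad {T Δ₂ B m i x y : ℕ} (hΔ : 0 < Δ₂)
    (h : badCount T Δ₂ B m i x y = 0) :
    ∀ q < m, ∀ p < m, IsTpl T (i + 1) (digit B y q) → IsTpl T (i + 1) (digit B y p) →
      digit B y q = digit B y p → q = p := by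
  intro q hq p hp hq' hp' he
  by_contra hne
  refine ((badCount_eq_zero.mp h q hq hq').2 p hp).2 (fun h => hne h.symm) hp' ?_
  rw [he]
  exact hp'.conflict_self hΔ

/-- Templates without conflict have disjoint intervals. Consequently a transition never raises the
budget, and an exhausted budget stays at `0` under truncated subtraction. -/
lemma rowGain_le {T Δ₂ B m i x y : ℕ} {P : Finset ℕ} (hΔ : 0 < Δ₂)
    (h : badCount T Δ₂ B m i x y = 0) : rowGain T B m i P y ≤ P.card := by
  have hb := badCount_eq_zero.mp h
  rw [rowGain, ← Finset.sum_filter]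
  simp only [keepCount]
  rw [← Finset.card_biUnion]
  · exact Finset.card_le_card (Finset.biUnion_subset.mpr fun q _ => Finset.inter_subset_left)
  · intro q hq p hp hne
    have hq := Finset.mem_filter.mp hq
    have hp := Finset.mem_filter.mp hp
    have := not_conflict_iff.mp (((hb q (Finset.mem_range.mp hq.1) hq.2).2 p
      (Finset.mem_range.mp hp.1)).2 (fun h => hne h.symm) hp.2)
    have h1 := hq.2.2
    have h2 := hp.2.2
    rw [Function.onFun, Finset.disjoint_left]
    intro t ht ht'
    simp only [Finset.mem_inter, Finset.mem_Ico, Spaced, decode] at ht ht' this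
    omega

/-! ### Table entries and chains of rows -/

section Chain

variable {Δ₁ Δ₂ T B m k : ℕ} {P : ℕ → Finset ℕ}

/-- Trace back the maximising predecessors. Along a positive entry no subtraction is truncated, so
the budget drops by exactly the cost of each row. -/
lemma exists_chain_of_dpValue (hΔ : 0 < Δ₂) (hB : 0 < B) (i : ℕ) :
    ∀ y < B ^ m, 0 < dpValue Δ₁ Δ₂ T B m k P i y → ∃ x : ℕ → ℕ, x i = y ∧
      IsRowChain T Δ₂ B m i x ∧ dpValue Δ₁ Δ₂ T B m k P i y +
        ∑ j ∈ Finset.range i, edgeCost Δ₁ j (P j) (codeSet T B m (j + 1) (x (j + 1))) ≤ k + 1 := by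
  induction i with
  | zero =>
    intro y _ h0
    have hy : y = 0 := by
      by_contra hne
      simp [dpValue, hne] at h0
    refine ⟨fun _ => 0, hy.symm, ⟨rfl, fun _ => pow_pos hB m, by simp⟩, by simp [dpValue, hy]⟩
  | succ i ih =>
    intro y hy h0
    obtain ⟨x₀, hx₀, hmax⟩ := Finset.exists_mem_eq_sup (Finset.range (B ^ m))
      ⟨0, Finset.mem_range.mpr (pow_pos hB m)⟩ (fun x => if badCount T Δ₂ B m i x y = 0 then
        dpValue Δ₁ Δ₂ T B m k P i x + rowGain T B m i (P i) y -
          ((P i).card + rowLoss Δ₁ T B m i (P i) y)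
      else 0)
    rw [dpValue, hmax] at h0 ⊢
    split_ifs at h0 ⊢ with hbad
    swap
    · exact absurd h0 (lt_irrefl 0)
    have hg := rowGain_le (P := P i) hΔ hbad
    -- The predecessor is positive too: with entry `0`, a gain of at most the number of times could
    -- not leave anything.
    obtain ⟨x, hx1, hx2, hx3⟩ := ih x₀ (Finset.mem_range.mp hx₀) (by omega)
    have hcongr : ∀ j ≤ i, Function.update x (i + 1) y j = x j := fun j hj =>
      Function.update_of_ne (by omega) _ _
    refine ⟨Function.update x (i + 1) y, by simp, ⟨?_, ?_, ?_⟩, ?_⟩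
    · rw [hcongr 0 (by omega), hx2.zero]
    · intro j
      by_cases hj : j = i + 1
      · subst hj; simpa using hy
      · rw [Function.update_of_ne hj]; exact hx2.lt j
    · intro j hj
      rcases Nat.lt_succ_iff_lt_or_eq.mp hj with h | h
      · rw [hcongr j (by omega), hcongr (j + 1) (by omega)]
        exact hx2.bad j h
      · subst h
        rw [hcongr j le_rfl, hx1]
        simpa using hbad
    · rw [Finset.sum_range_succ]
      have : ∀ j ∈ Finset.range i, edgeCost Δ₁ j (P j)
          (codeSet T B m (j + 1) (Function.update x (i + 1) y (j + 1))) =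
          edgeCost Δ₁ j (P j) (codeSet T B m (j + 1) (x (j + 1))) := fun j hj => by
        rw [hcongr (j + 1) (Finset.mem_range.mp hj)]
      rw [Finset.sum_congr rfl this, Function.update_self,
        edgeCost_codeSet (digit_injOn_of_bad hΔ hbad)]
      omega

/-- Both the maximum over predecessors and the truncation can only increase an entry, so it is at
least the budget left by the given chain. -/
lemma le_dpValue_of_chain (hΔ : 0 < Δ₂) (i : ℕ) {x : ℕ → ℕ} (hx : IsRowChain T Δ₂ B m i x) :
    k + 1 ≤ dpValue Δ₁ Δ₂ T B m k P i (x i) +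
      ∑ j ∈ Finset.range i, edgeCost Δ₁ j (P j) (codeSet T B m (j + 1) (x (j + 1))) := by
  induction i with
  | zero => simp [dpValue, hx.zero]
  | succ i ih =>
    have h1 := ih ⟨hx.zero, hx.lt, fun j hj => hx.bad j (by omega)⟩
    have hbad := hx.bad i (by omega)
    have h2 := Finset.le_sup (f := fun x' => if badCount T Δ₂ B m i x' (x (i + 1)) = 0 then
        dpValue Δ₁ Δ₂ T B m k P i x' + rowGain T B m i (P i) (x (i + 1)) -
          ((P i).card + rowLoss Δ₁ T B m i (P i) (x (i + 1)))
      else 0) (Finset.mem_range.mpr (hx.lt i))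
    simp only [hbad, if_true] at h2
    rw [Finset.sum_range_succ, dpValue, edgeCost_codeSet (digit_injOn_of_bad hΔ hbad)]
    have hg := rowGain_le (P := P i) hΔ hbad
    omega

end Chain

lemma exists_digits {B : ℕ} (m : ℕ) (f : ℕ → ℕ) (hf : ∀ q < m, f q < B) :
    ∃ y < B ^ m, ∀ q < m, digit B y q = f q := by
  induction m generalizing f with
  | zero => exact ⟨0, by simp, by simp⟩
  | succ m ih =>
    obtain ⟨y, hy, hd⟩ := ih (fun q => f (q + 1)) fun q hq => hf (q + 1) (by omega)
    have h0 := hf 0 (by omega)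
    have hdiv : (f 0 + B * y) / B = y := by
      rw [Nat.add_mul_div_left _ _ (by omega), Nat.div_eq_of_lt h0, zero_add]
    refine ⟨f 0 + B * y, ?_, ?_⟩
    · calc f 0 + B * y < B * (y + 1) := by rw [mul_add]; omega
        _ ≤ B * B ^ m := Nat.mul_le_mul_left _ hy
        _ = B ^ (m + 1) := by ring
    · intro q hq
      cases q with
      | zero => simp [digit, Nat.mod_eq_of_lt h0]
      | succ q =>
        rw [digit, pow_succ', ← Nat.div_div_eq_div_mul, hdiv]
        exact hd q (by omega)

lemma exists_code {n T m r : ℕ} (hr : r < n) (hT : 0 < T) (F : Finset (ℕ × ℕ × ℕ))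
    (hcard : F.card ≤ m)
    (hF : ∀ τ ∈ F, τ.1 < r ∧ 1 ≤ τ.2.1 ∧ τ.2.1 ≤ τ.2.2 ∧ τ.2.2 ≤ T) :
    ∃ y < (T * T * n) ^ m, codeSet T (T * T * n) m r y = F ∧
      ∀ q < m, ∀ p < m, IsTpl T r (digit (T * T * n) y q) →
        IsTpl T r (digit (T * T * n) y p) →
        digit (T * T * n) y q = digit (T * T * n) y p → q = p := by
  let enc : ℕ × ℕ × ℕ → ℕ := fun τ => (τ.2.1 - 1) + T * ((τ.2.2 - 1) + T * τ.1)
  have henc : ∀ l a b, 1 ≤ a → a ≤ T → 1 ≤ b → b ≤ T → decode T (enc (l, a, b)) = (l, a, b) := by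
    intro l a b h1 h2 h3 h4
    have e1 : enc (l, a, b) / T = (b - 1) + T * l := by
      simp only [enc]
      rw [Nat.add_mul_div_left _ _ hT, Nat.div_eq_of_lt (by omega), zero_add]
    have e2 : enc (l, a, b) % T = a - 1 := by
      simp only [enc]
      rw [Nat.add_mul_mod_self_left, Nat.mod_eq_of_lt (by omega)]
    rw [decode, e1, e2, Nat.add_mul_div_left _ _ hT, Nat.add_mul_mod_self_left,
      Nat.div_eq_of_lt (by omega), Nat.mod_eq_of_lt (show b - 1 < T by omega)]
    simp only [Prod.mk.injEq]
    omega
  have hbound : ∀ l a b, l < n → 1 ≤ a → a ≤ T → 1 ≤ b → b ≤ T → enc (l, a, b) < T * T * n := by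
    intro l a b h0 h1 h2 h3 h4
    have e1 : (b - 1) + T * l < T * n := by
      have := Nat.mul_le_mul_left T (Nat.succ_le_of_lt h0)
      rw [Nat.mul_succ] at this
      omega
    have e2 := Nat.mul_le_mul_left T (Nat.succ_le_of_lt e1)
    rw [Nat.mul_succ] at e2
    simp only [enc]
    rw [mul_assoc]
    omega
  let L := F.toList
  have hL : L.length ≤ m := by simpa [L] using hcard
  have hLmem : ∀ τ, τ ∈ L ↔ τ ∈ F := fun τ => Finset.mem_toList
  -- Unused slots receive the left end `n - 1`. It is not before `r`, as `r < n`, so they code no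
  -- template.
  let f : ℕ → ℕ := fun q => enc (L.getD q (n - 1, 1, 1))
  have hf : ∀ q < m, f q < T * T * n ∧ decode T (f q) = L.getD q (n - 1, 1, 1) := by
    intro q _
    by_cases hq : q < L.length
    · have hm : L[q] ∈ F := (hLmem _).mp (List.getElem_mem hq)
      obtain ⟨h1, h2, h3, h4⟩ := hF _ hm
      simp only [f, List.getD_eq_getElem _ _ hq]
      have h5 := h3.trans h4
      have h6 := h2.trans h3
      exact ⟨hbound _ _ _ (h1.trans hr) h2 h5 h6 h4, henc _ _ _ h2 h5 h6 h4⟩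
    · simp only [f, List.getD_eq_default _ _ (Nat.le_of_not_lt hq)]
      exact ⟨hbound _ _ _ (by omega) le_rfl hT le_rfl hT, henc _ _ _ le_rfl hT le_rfl hT⟩
  obtain ⟨y, hy, hd⟩ := exists_digits m f fun q hq => (hf q hq).1
  have htpl : ∀ q < m, IsTpl T r (digit (T * T * n) y q) ↔ q < L.length := by
    intro q hq
    have hq' := (hf q hq).2
    rw [hd q hq]
    have hi : IsTpl T r (f q) ↔ (decode T (f q)).1 < r ∧
        (decode T (f q)).2.1 ≤ (decode T (f q)).2.2 := Iff.rfl
    rw [hi, hq']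
    constructor
    · intro h
      by_contra hc
      rw [List.getD_eq_default _ _ (Nat.le_of_not_lt hc)] at h
      simp only at h
      omega
    · intro h
      rw [List.getD_eq_getElem _ _ h]
      have hm : L[q] ∈ F := (hLmem _).mp (List.getElem_mem h)
      exact ⟨(hF _ hm).1, (hF _ hm).2.2.1⟩
  refine ⟨y, hy, ?_, ?_⟩
  · ext τ
    rw [mem_codeSet, ← hLmem, List.mem_iff_getElem]
    constructor
    · rintro ⟨q, hq, ht, he⟩
      have hl := (htpl q hq).mp ht
      refine ⟨q, hl, ?_⟩
      rw [← he, hd q hq, (hf q hq).2, List.getD_eq_getElem _ _ hl]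
    · rintro ⟨q, hq, he⟩
      have hqm : q < m := by omega
      refine ⟨q, hqm, (htpl q hqm).mpr hq, ?_⟩
      rw [hd q hqm, (hf q hqm).2, List.getD_eq_getElem _ _ hq, he]
  · intro q hq p hp hq' hp' he
    have hql := (htpl q hq).mp hq'
    have hpl := (htpl p hp).mp hp'
    have := congrArg (decode T) he
    rw [hd q hq, hd p hp, (hf q hq).2, (hf p hp).2, List.getD_eq_getElem _ _ hql,
      List.getD_eq_getElem _ _ hpl] at this
    exact (List.Nodup.getElem_inj_iff F.nodup_toList).mp this

/-! ### Chains of rows are plans -/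

section Correctness

variable {n Δ₁ Δ₂ T m k : ℕ} {P : ℕ → Finset ℕ}

lemma isPlan_of_chain {B : ℕ} (hT : 0 < T) {x : ℕ → ℕ}
    (hx : IsRowChain T Δ₂ B m (n - 1) x) :
    IsPlan n T Δ₂ m fun r => if r < n then codeSet T B m r (x r) else ∅ := by
  have hzero : ∀ y τ, τ ∉ codeSet T B m 0 y := by
    intro y τ h
    obtain ⟨q, -, h, -⟩ := mem_codeSet.mp h
    exact absurd h.1 (Nat.not_lt_zero _)
  have hmem : ∀ r τ, τ ∈ (if r < n then codeSet T B m r (x r) else ∅) →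
      r < n ∧ τ ∈ codeSet T B m r (x r) := by
    intro r τ h
    split_ifs at h with hr
    · exact ⟨hr, h⟩
    · simp at h
  have hbad : ∀ i, i + 1 < n → _ := fun i hi => badCount_eq_zero.mp (hx.bad i (by omega))
  refine ⟨fun i hi => if_neg (by omega), ?_, ?_, ?_, ?_, ?_⟩
  · intro i τ hτ
    obtain ⟨q, -, h, rfl⟩ := mem_codeSet.mp (hmem i τ hτ).2
    have := Nat.mod_lt (digit B (x i) q / T) hT
    exact ⟨h.1, by simp [decode], h.2, by simpa [decode] using this⟩
  · intro i τ hτ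
    obtain ⟨hi, hτ⟩ := hmem _ τ hτ
    obtain ⟨q, hq, h, rfl⟩ := mem_codeSet.mp hτ
    rcases (hbad i hi q hq h).1 with h' | ⟨p, hp, h1, h2⟩
    · exact Or.inl h'
    · right
      rw [if_pos (by omega), mem_codeSet]
      exact ⟨p, hp, h1, by rw [h2]⟩
  · intro i τ hτ τ' hτ' hne
    obtain ⟨hi, hτ⟩ := hmem _ τ hτ
    obtain ⟨-, hτ'⟩ := hmem _ τ' hτ'
    cases i with
    | zero => exact absurd hτ (hzero _ _)
    | succ i =>
      obtain ⟨p, hp, h, rfl⟩ := mem_codeSet.mp hτ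
      obtain ⟨q, hq, h', rfl⟩ := mem_codeSet.mp hτ'
      exact not_conflict_iff.mp (((hbad i hi q hq h').2 p hp).2 (fun h => hne (by rw [h])) h)
  · intro i τ hτ τ' hτ' hne
    obtain ⟨-, hτ⟩ := hmem _ τ hτ
    obtain ⟨hi, hτ'⟩ := hmem _ τ' hτ'
    obtain ⟨p, hp, h, rfl⟩ := mem_codeSet.mp hτ
    obtain ⟨q, hq, h', rfl⟩ := mem_codeSet.mp hτ'
    exact not_conflict_iff.mp (((hbad i hi q hq h').2 p hp).1 h (fun h => hne (by rw [h])))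
  · intro i
    split_ifs
    · exact Finset.card_image_le.trans ((Finset.card_filter_le _ _).trans (by simp))
    · simp

lemma exists_chain_of_plan (hn : 0 < n) (hT : 0 < T) {S : ℕ → Finset (ℕ × ℕ × ℕ)}
    (hS : IsPlan n T Δ₂ m S) :
    ∃ x : ℕ → ℕ, IsRowChain T Δ₂ (T * T * n) m (n - 1) x ∧
      ∀ i < n, codeSet T (T * T * n) m i (x i) = S i := by
  have hpos : 0 < T * T * n := by positivity
  have h : ∀ r, ∃ y < (T * T * n) ^ m, (r = 0 → y = 0) ∧ (r < n →
      codeSet T (T * T * n) m r y = S r ∧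
      ∀ q < m, ∀ p < m, IsTpl T r (digit (T * T * n) y q) →
        IsTpl T r (digit (T * T * n) y p) →
        digit (T * T * n) y q = digit (T * T * n) y p → q = p) := by
    intro r
    -- Every code describes the empty row 0, but the table starts with a budget only at the code
    -- `0`.
    by_cases h0 : r = 0
    · subst h0
      refine ⟨0, pow_pos hpos m, fun _ => rfl, fun _ => ⟨?_, fun q _ p _ h => ?_⟩⟩
      · have h1 : S 0 = ∅ := Finset.eq_empty_of_forall_notMem fun τ hτ =>
          absurd (hS.bounds 0 τ hτ).1 (Nat.not_lt_zero _)
        rw [h1]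
        refine Finset.eq_empty_of_forall_notMem fun τ hτ => ?_
        obtain ⟨q, -, h, -⟩ := mem_codeSet.mp hτ
        exact absurd h.1 (Nat.not_lt_zero _)
      · exact absurd h.1 (Nat.not_lt_zero _)
    · by_cases hr : r < n
      · obtain ⟨y, h1, h2, h3⟩ := exists_code hr hT (S r) (hS.card_le r) (hS.bounds r)
        exact ⟨y, h1, fun h => absurd h h0, fun _ => ⟨h2, h3⟩⟩
      · exact ⟨0, pow_pos hpos m, fun _ => rfl, fun h => absurd h hr⟩
  choose x hx1 hx2 hx3 using h
  refine ⟨x, ⟨hx2 0 rfl, hx1, fun i hi => ?_⟩, fun i hi => (hx3 i hi).1⟩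
  obtain ⟨e1, i1⟩ := hx3 i (by omega)
  obtain ⟨e2, i2⟩ := hx3 (i + 1) (by omega)
  rw [badCount_eq_zero]
  intro q hq ht
  have hτ : decode T (digit (T * T * n) (x (i + 1)) q) ∈ S (i + 1) := by
    rw [← e2, mem_codeSet]
    exact ⟨q, hq, ht, rfl⟩
  refine ⟨?_, fun p hp => ⟨fun h1 h2 => ?_, fun h1 h2 => ?_⟩⟩
  · rcases hS.cont i _ hτ with h | h
    · exact Or.inl h
    · right
      rw [← e1, mem_codeSet] at h
      obtain ⟨p, hp, h1, h2⟩ := h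
      exact ⟨p, hp, h1, decode_injective h2⟩
  · have hσ : decode T (digit (T * T * n) (x i) p) ∈ S i := by
      rw [← e1, mem_codeSet]
      exact ⟨p, hp, h1, rfl⟩
    exact not_conflict_iff.mpr (hS.cross i _ hσ _ hτ fun h => h2 (decode_injective h))
  · have hσ : decode T (digit (T * T * n) (x (i + 1)) p) ∈ S (i + 1) := by
      rw [← e2, mem_codeSet]
      exact ⟨p, hp, h2, rfl⟩
    exact not_conflict_iff.mpr (hS.within _ _ hσ _ hτ fun h =>
      h1 (i2 p hp q hq h2 ht (decode_injective h)))

end Correctness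

/-- The dynamic program is correct. -/
theorem TemporalGraph.etc_iff_dpValue {n Δ₁ Δ₂ m k : ℕ} {G : TemporalGraph (Fin n)}
    (hG : G.graph = SimpleGraph.pathGraph n) (hn : 0 < n) (h1 : 0 < Δ₁) (h12 : Δ₁ < Δ₂)
    (hT : 0 < G.lifetime) (hm : ∀ i, (G.pathTimes i).card ≤ m) :
    G.ETC Δ₁ Δ₂ k ↔ ∃ y < (G.lifetime * G.lifetime * n) ^ m,
      0 < dpValue Δ₁ Δ₂ G.lifetime (G.lifetime * G.lifetime * n) m k G.pathTimes (n - 1) y := by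
  have h2 : 0 < Δ₂ := by omega
  constructor
  · intro h
    obtain ⟨S, hS, hk⟩ := exists_plan_of_etc hG h12 hm h
    obtain ⟨x, hx, hxS⟩ := exists_chain_of_plan hn hT hS
    refine ⟨x (n - 1), hx.lt _, ?_⟩
    have := le_dpValue_of_chain (Δ₁ := Δ₁) (k := k) (P := G.pathTimes) h2 (n - 1) hx
    have he : ∑ j ∈ Finset.range (n - 1), edgeCost Δ₁ j (G.pathTimes j)
        (codeSet G.lifetime (G.lifetime * G.lifetime * n) m (j + 1) (x (j + 1))) =
        ∑ j ∈ Finset.range (n - 1), edgeCost Δ₁ j (G.pathTimes j) (S (j + 1)) :=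
      Finset.sum_congr rfl fun j hj => by
        rw [hxS (j + 1) (by have := Finset.mem_range.mp hj; omega)]
    omega
  · rintro ⟨y, hy, h0⟩
    obtain ⟨x, hxy, hx, hk⟩ := exists_chain_of_dpValue h2 (by positivity) (n - 1) y hy h0
    refine etc_of_plan hG h1 h2 (isPlan_of_chain hT hx) ?_
    have he : ∑ j ∈ Finset.range (n - 1), edgeCost Δ₁ j (G.pathTimes j)
        (codeSet G.lifetime (G.lifetime * G.lifetime * n) m (j + 1) (x (j + 1))) =
        ∑ j ∈ Finset.range (n - 1), edgeCost Δ₁ j (G.pathTimes j)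
          (if j + 1 < n then codeSet G.lifetime (G.lifetime * G.lifetime * n) m (j + 1)
            (x (j + 1)) else ∅) :=
      Finset.sum_congr rfl fun j hj => by
        rw [if_pos (by have := Finset.mem_range.mp hj; omega)]
    omega

/-! ## A program logic for the word RAM -/

namespace WordRAM

/-- Operations on natural numbers of unbounded size. -/
def Op.natEval : Op → ℕ → ℕ → ℕ
  | .add, x, y => x + y
  | .sub, x, y => x - y
  | .mul, x, y => x * y
  | .div, x, y => x / y
  | .lt, x, y => if x < y then 1 else 0
  | .eq, x, y => if x = y then 1 else 0

namespace Expr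

/-- The value of an expression if no word overflows. -/
def val (s : State) : Expr → ℕ
  | .const c => c
  | .reg i => s.reg i
  | .load e => s.mem (e.val s)
  | .bin o e₁ e₂ => o.natEval (e₁.val s) (e₂.val s)

/-- If all registers and cells are at most `M`, all values in the evaluation of an expression are
at most `M` to the power of its degree. -/
def deg : Expr → ℕ
  | .const c => c + 1
  | .reg _ => 1
  | .load e => e.deg + 1
  | .bin _ e₁ e₂ => e₁.deg + e₂.deg

instance : Add Expr := ⟨.bin .add⟩
instance : Sub Expr := ⟨.bin .sub⟩
instance : Mul Expr := ⟨.bin .mul⟩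
instance : Div Expr := ⟨.bin .div⟩

/-- Comparison. -/
abbrev less (e₁ e₂ : Expr) : Expr := .bin .lt e₁ e₂

/-- Test for equality. -/
abbrev same (e₁ e₂ : Expr) : Expr := .bin .eq e₁ e₂

/-- Remainder. -/
def rem (e₁ e₂ : Expr) : Expr := e₁ - e₁ / e₂ * e₂

variable (s : State) (e₁ e₂ : Expr) (c : ℕ)

@[simp] lemma val_add : (e₁ + e₂).val s = e₁.val s + e₂.val s := id rfl
@[simp] lemma val_sub : (e₁ - e₂).val s = e₁.val s - e₂.val s := id rfl
@[simp] lemma val_mul : (e₁ * e₂).val s = e₁.val s * e₂.val s := id rfl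
@[simp] lemma val_div : (e₁ / e₂).val s = e₁.val s / e₂.val s := id rfl
@[simp] lemma val_lt : (bin .lt e₁ e₂).val s = if e₁.val s < e₂.val s then 1 else 0 := id rfl
@[simp] lemma val_eq : (bin .eq e₁ e₂).val s = if e₁.val s = e₂.val s then 1 else 0 := id rfl
@[simp] lemma val_const : (const c).val s = c := id rfl
@[simp] lemma val_reg (i : ℕ) : (reg i).val s = s.reg i := id rfl
@[simp] lemma val_load : (load e₁).val s = s.mem (e₁.val s) := id rfl
@[simp] lemma val_rem : (rem e₁ e₂).val s = e₁.val s % e₂.val s := by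
  simp only [rem, val_sub, val_mul, val_div]
  have := Nat.div_add_mod (e₁.val s) (e₂.val s)
  rw [mul_comm] at this
  omega

lemma deg_pos : 0 < e₁.deg := by
  induction e₁ with
  | const c => simp [deg]
  | reg i => simp [deg]
  | load e ih => simp [deg]
  | bin o e₁ e₂ ih₁ ih₂ => simp only [deg]; omega

end Expr

/-- All registers and cells are at most `M`. -/
def Bounded (M : ℕ) (s : State) : Prop := (∀ r, s.reg r ≤ M) ∧ ∀ a, s.mem a ≤ M

/-- Degrees are chosen so that constants fit (`c ≤ 2 ^ c`) and a sum is at most a product, both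
bounding powers being at least 2. -/
lemma Expr.val_le {M : ℕ} (hM : 2 ≤ M) {s : State} (hs : Bounded M s) (e : Expr) :
    e.val s ≤ M ^ e.deg := by
  have h1 : 1 ≤ M := by omega
  induction e with
  | const c =>
    calc c ≤ 2 ^ c := Nat.lt_two_pow_self.le
      _ ≤ 2 ^ (c + 1) := Nat.pow_le_pow_right (by omega) (by omega)
      _ ≤ M ^ (c + 1) := Nat.pow_le_pow_left hM _
  | reg i => simpa [val, deg] using hs.1 i
  | load e ih => exact (hs.2 _).trans (Nat.le_self_pow (by simp [deg]) M)
  | bin o e₁ e₂ ih₁ ih₂ =>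
    have p1 : M ≤ M ^ e₁.deg := Nat.le_self_pow e₁.deg_pos.ne' M
    have p2 : M ≤ M ^ e₂.deg := Nat.le_self_pow e₂.deg_pos.ne' M
    have hle : e₁.val s ≤ M ^ (e₁.deg + e₂.deg) :=
      ih₁.trans (Nat.pow_le_pow_right h1 (by omega))
    have hone : 1 ≤ M ^ (e₁.deg + e₂.deg) := Nat.one_le_pow _ _ h1
    cases o with
    | add =>
      simp only [val, deg, Op.natEval]
      rw [pow_add]
      calc e₁.val s + e₂.val s ≤ M ^ e₁.deg + M ^ e₂.deg := Nat.add_le_add ih₁ ih₂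
        _ ≤ M ^ e₁.deg * M ^ e₂.deg := Nat.add_le_mul (hM.trans p1) (hM.trans p2)
    | sub => exact (Nat.sub_le _ _).trans hle
    | mul =>
      simp only [val, deg, Op.natEval]
      rw [pow_add]
      exact Nat.mul_le_mul ih₁ ih₂
    | div => exact (Nat.div_le_self _ _).trans hle
    | lt =>
      simp only [val, deg, Op.natEval]
      split_ifs <;> omega
    | eq =>
      simp only [val, deg, Op.natEval]
      split_ifs <;> omega

/-- Subexpressions have no larger degree, so none of them wraps around. Intermediate values may thus
exceed `M`; only stored values must not. -/
lemma Expr.eval_eq_val {M w : ℕ} (hM : 2 ≤ M) {s : State} (hs : Bounded M s) (e : Expr)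
    (hw : M ^ e.deg < 2 ^ w) : e.eval w s = e.val s := by
  have h1 : 1 ≤ M := by omega
  induction e with
  | const c => exact Nat.mod_eq_of_lt (((Expr.const c).val_le hM hs).trans_lt hw)
  | reg i => rfl
  | load e ih =>
    simp only [eval, val]
    rw [ih ((Nat.pow_le_pow_right h1 (by simp [deg])).trans_lt hw)]
  | bin o e₁ e₂ ih₁ ih₂ =>
    have hv := (Expr.bin o e₁ e₂).val_le hM hs
    have hone : 1 % 2 ^ w = 1 := Nat.mod_eq_of_lt ((Nat.one_le_pow _ _ h1).trans_lt hw)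
    simp only [eval]
    rw [ih₁ ((Nat.pow_le_pow_right h1 (by simp [deg])).trans_lt hw),
      ih₂ ((Nat.pow_le_pow_right h1 (by simp [deg])).trans_lt hw)]
    cases o with
    | add => exact Nat.mod_eq_of_lt (hv.trans_lt hw)
    | sub => rfl
    | mul => exact Nat.mod_eq_of_lt (hv.trans_lt hw)
    | div => rfl
    | lt => simp only [Op.eval, hone]; rfl
    | eq => simp only [Op.eval, hone]; rfl

/-! ### Machine states and rules for programs -/

/-- Assignment to a register. -/
def State.set (s : State) (i v : ℕ) : State := ⟨Function.update s.reg i v, s.mem⟩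

/-- Writing to a memory cell. -/
def State.put (s : State) (a v : ℕ) : State := ⟨s.reg, Function.update s.mem a v⟩

@[simp] lemma State.set_reg (s : State) (i v r : ℕ) :
    (s.set i v).reg r = if r = i then v else s.reg r := by
  simp [State.set, Function.update_apply]

@[simp] lemma State.set_mem (s : State) (i v : ℕ) : (s.set i v).mem = s.mem := rfl

@[simp] lemma State.put_reg (s : State) (a v : ℕ) : (s.put a v).reg = s.reg := rfl

lemma State.put_mem (s : State) (a v c : ℕ) :
    (s.put a v).mem c = if c = a then v else s.mem c := by
  simp [State.put, Function.update_apply]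

lemma Bounded.set {M : ℕ} {s : State} (hs : Bounded M s) {i v : ℕ} (hv : v ≤ M) :
    Bounded M (s.set i v) := by
  refine ⟨fun r => ?_, hs.2⟩
  rw [State.set_reg]
  split_ifs
  · exact hv
  · exact hs.1 r

lemma Bounded.put {M : ℕ} {s : State} (hs : Bounded M s) {a v : ℕ} (hv : v ≤ M) :
    Bounded M (s.put a v) := by
  refine ⟨hs.1, fun r => ?_⟩
  rw [State.put_mem]
  split_ifs
  · exact hv
  · exact hs.2 r

/-- The largest degree of the expressions in a program to which the program logic applies. -/
def maxDeg : ℕ := 300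

/-- Started in the state `s`, the program halts within `b` steps in a state with `Q`, and all
values written are at most `M`, provided that the words are long enough for `M`. -/
def Run (w M : ℕ) (p : Program) (s : State) (b : ℕ) (Q : State → Prop) : Prop :=
  2 ≤ M → M ^ maxDeg < 2 ^ w → Bounded M s →
    ∃ t s', Exec w p s t s' ∧ t ≤ b ∧ Bounded M s' ∧ Q s'

variable {w M : ℕ} {s : State}

lemma eval_eq_val_of_deg_le (hM : 2 ≤ M) (hw : M ^ maxDeg < 2 ^ w) (hs : Bounded M s) {e : Expr}
    (he : e.deg ≤ maxDeg) : e.eval w s = e.val s :=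
  e.eval_eq_val hM hs ((Nat.pow_le_pow_right (by omega) he).trans_lt hw)

lemma Run.mono {p : Program} {b b' : ℕ} {Q Q' : State → Prop} (h : Run w M p s b Q)
    (hb : b ≤ b') (hQ : ∀ s', Q s' → Q' s') : Run w M p s b' Q' := by
  intro hM hw hs
  obtain ⟨t, s', h1, h2, h3, h4⟩ := h hM hw hs
  exact ⟨t, s', h1, h2.trans hb, h3, hQ s' h4⟩

lemma Run.of_bounded {p : Program} {b : ℕ} {Q : State → Prop}
    (h : Bounded M s → Run w M p s b Q) : Run w M p s b Q :=
  fun hM hw hs => h hs hM hw hs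

lemma Run.seq {p q : Program} {b b' : ℕ} {Q : State → Prop}
    (h : Run w M p s b fun s' => Run w M q s' b' Q) : Run w M (.seq p q) s (b + b') Q := by
  intro hM hw hs
  obtain ⟨t, s', h1, h2, h3, h4⟩ := h hM hw hs
  obtain ⟨t', s'', h1', h2', h3', h4'⟩ := h4 hM hw h3
  exact ⟨_, s'', h1.seq h1', by omega, h3', h4'⟩

lemma Run.assign {i : ℕ} {e : Expr} {Q : State → Prop} (he : e.deg ≤ maxDeg) (hv : e.val s ≤ M)
    (hQ : Q (s.set i (e.val s))) : Run w M (.assign i e) s (e.cost + 1) Q := by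
  intro hM hw hs
  refine ⟨_, _, Exec.assign i e s, le_rfl, ?_, ?_⟩ <;> rw [eval_eq_val_of_deg_le hM hw hs he]
  · exact hs.set hv
  · exact hQ

lemma Run.store {a e : Expr} {Q : State → Prop} (ha : a.deg ≤ maxDeg) (he : e.deg ≤ maxDeg)
    (hv : e.val s ≤ M) (hQ : Q (s.put (a.val s) (e.val s))) :
    Run w M (.store a e) s (a.cost + e.cost + 1) Q := by
  intro hM hw hs
  refine ⟨_, _, Exec.store a e s, le_rfl, ?_, ?_⟩ <;>
    rw [eval_eq_val_of_deg_le hM hw hs he, eval_eq_val_of_deg_le hM hw hs ha]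
  · exact hs.put hv
  · exact hQ

/-- A sequence of assignments. -/
def block : List (ℕ × Expr) → Program
  | [] => .nop
  | x :: l => .seq (.assign x.1 x.2) (block l)

/-- The state after a sequence of assignments. -/
def blockState : List (ℕ × Expr) → State → State
  | [], s => s
  | x :: l, s => blockState l (s.set x.1 (x.2.val s))

/-- All values assigned are at most `M`. -/
def BlockLe (M : ℕ) : List (ℕ × Expr) → State → Prop
  | [], _ => True
  | x :: l, s => x.2.val s ≤ M ∧ BlockLe M l (s.set x.1 (x.2.val s))

/-- The running time of a sequence of assignments. -/
def blockCost : List (ℕ × Expr) → ℕ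
  | [] => 1
  | x :: l => x.2.cost + 1 + blockCost l

lemma Run.block {l : List (ℕ × Expr)} {Q : State → Prop} (hl : ∀ x ∈ l, x.2.deg ≤ maxDeg)
    (hv : BlockLe M l s) (hQ : Q (blockState l s)) :
    Run w M (WordRAM.block l) s (blockCost l) Q := by
  induction l generalizing s with
  | nil => exact fun hM hw hs => ⟨1, s, Exec.nop s, le_rfl, hs, hQ⟩
  | cons x l ih =>
    refine Run.seq (Run.assign (hl x (by simp)) hv.1 ?_)
    exact ih (fun y hy => hl y (by simp [hy])) hv.2 hQ

lemma Run.seq_le {p q : Program} {b b' c : ℕ} {Q : State → Prop}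
    (h : Run w M p s b fun s' => Run w M q s' b' Q) (hc : b + b' ≤ c) :
    Run w M (.seq p q) s c Q :=
  (Run.seq h).mono hc fun _ h => h

lemma Run.block_le {l : List (ℕ × Expr)} {c : ℕ} {Q : State → Prop}
    (hl : ∀ x ∈ l, x.2.deg ≤ maxDeg) (hc : blockCost l ≤ c) (hv : BlockLe M l s)
    (hQ : Q (blockState l s)) : Run w M (WordRAM.block l) s c Q :=
  (Run.block hl hv hQ).mono hc fun _ h => h

lemma Run.block_seq {l : List (ℕ × Expr)} {q : Program} (b : ℕ) {c b' : ℕ} {Q : State → Prop}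
    (hl : ∀ x ∈ l, x.2.deg ≤ maxDeg) (hb : blockCost l ≤ b) (hc : b + b' ≤ c)
    (hv : BlockLe M l s) (h : Run w M q (blockState l s) b' Q) :
    Run w M (.seq (WordRAM.block l) q) s c Q :=
  Run.seq_le (Run.block_le hl hb hv h) hc

/-- The registers below `L` agree. -/
def Frame (L : ℕ) (s s' : State) : Prop := ∀ r < L, s'.reg r = s.reg r

lemma Frame.refl (L : ℕ) (s : State) : Frame L s s := fun _ _ => rfl

lemma Frame.trans {L : ℕ} {s s' s'' : State} (h : Frame L s s') (h' : Frame L s' s'') :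
    Frame L s s'' := fun r hr => (h' r hr).trans (h r hr)

lemma Frame.mono {L L' : ℕ} {s s' : State} (h : Frame L s s') (hL : L' ≤ L) : Frame L' s s' :=
  fun r hr => h r (hr.trans_le hL)

lemma Frame.set {L : ℕ} {s s' : State} (h : Frame L s s') {i v : ℕ} (hi : L ≤ i) :
    Frame L s (s'.set i v) := by
  intro r hr
  rw [State.set_reg, if_neg (by omega)]
  exact h r hr

lemma Frame.blockState {L : ℕ} {l : List (ℕ × Expr)} (hl : ∀ x ∈ l, L ≤ x.1) {s₀ s : State}
    (h : Frame L s₀ s) : Frame L s₀ (blockState l s) := by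
  induction l generalizing s with
  | nil => exact h
  | cons x l ih =>
    exact ih (fun y hy => hl y (by simp [hy])) (h.set (hl x (by simp)))

@[simp] lemma blockState_mem (l : List (ℕ × Expr)) (s : State) :
    (blockState l s).mem = s.mem := by
  induction l generalizing s with
  | nil => rfl
  | cons x l ih => rw [blockState, ih, State.set_mem]

/-- `for r = 0, …, (register l) - 1 do p`; the body must not change the registers up to `r`. -/
def forUp (r l : ℕ) (p : Program) : Program :=
  .seq (.assign r (.const 0)) (.loop (.bin .lt (.reg r) (.reg l))
    (.seq p (.assign r (.bin .add (.reg r) (.const 1)))))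

/-- Induction on the number of remaining rounds. Each round adds 8 steps, 4 for the test and 4 for
the increment; the initial assignment takes 2 and the final failing test 4. Nested loops use
counters of increasing index, so `Frame` protects the outer ones. -/
lemma Run.forUp {r l N c : ℕ} {p : Program} {Q : State → Prop} (I : ℕ → State → Prop)
    (hl : l < r) (hN : s.reg l = N) (h0 : I 0 (s.set r 0))
    (hbody : ∀ j < N, ∀ s', Frame r s s' → s'.reg r = j → I j s' →
      Run w M p s' c fun s'' => Frame (r + 1) s' s'' ∧ I (j + 1) (s''.set r (j + 1)))
    (hQ : ∀ s', Frame r s s' → I N s' → Q s') {b : ℕ} (hb : N * (c + 8) + 6 ≤ b) :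
    Run w M (WordRAM.forUp r l p) s b Q := by
  refine Run.mono (b := N * (c + 8) + 6) ?_ hb fun _ h => h
  intro hM hw hs
  have hNM : N ≤ M := hN ▸ hs.1 l
  have hdeg : ∀ d ≤ maxDeg, M ^ d < 2 ^ w := fun d hd =>
    (Nat.pow_le_pow_right (by omega) hd).trans_lt hw
  have key : ∀ d j s', d + j = N → Frame r s s' → s'.reg r = j → I j s' → Bounded M s' →
      ∃ t s'', Exec w (.loop (.bin .lt (.reg r) (.reg l))
        (.seq p (.assign r (.bin .add (.reg r) (.const 1))))) s' t s'' ∧ t ≤ d * (c + 8) + 4 ∧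
        Bounded M s'' ∧ Q s'' := by
    intro d
    induction d with
    | zero =>
      intro j s' hj hf hr hI hs'
      refine ⟨_, s', Exec.loop_false ?_, by simp [Expr.cost], hs', hQ s' hf ?_⟩
      · rw [eval_eq_val_of_deg_le hM hw hs' (by simp [Expr.deg, maxDeg])]
        simp only [Expr.val_lt, Expr.val_reg, hr, hf l hl, hN]
        simp
        omega
      · rwa [show N = j by omega]
    | succ d ih =>
      intro j s' hj hf hr hI hs'
      obtain ⟨t, s1, h1, h2, h3, h4, h5⟩ := hbody j (by omega) s' hf hr hI hM hw hs'
      have hr1 : s1.reg r = j := (h4 r (by omega)).trans hr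
      have h6 : Run w M (.assign r (.bin .add (.reg r) (.const 1))) s1 4
          (fun s2 => s2 = s1.set r (j + 1)) :=
        Run.assign (by simp [Expr.deg, maxDeg])
          (by simp only [Expr.val, Op.natEval, hr1]; omega)
          (by simp only [Expr.val, Op.natEval, hr1])
      obtain ⟨t', s2, h7, h8, h9, rfl⟩ := h6 hM hw h3
      obtain ⟨t'', s3, h10, h11, h12⟩ := ih (j + 1) _ (by omega)
        ((hf.trans (h4.mono (by omega))).set le_rfl) (by simp) h5 h9
      refine ⟨_, s3, Exec.loop_true ?_ (h1.seq h7) h10, ?_, h12⟩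
      · rw [eval_eq_val_of_deg_le hM hw hs' (by simp [Expr.deg, maxDeg])]
        simp only [Expr.val_lt, Expr.val_reg, hr, hf l hl, hN]
        simp
        omega
      · simp only [Expr.cost, Nat.succ_mul]
        omega
  have hinit : Run w M (.assign r (.const 0)) s 2 (fun s2 => s2 = s.set r 0) :=
    Run.assign (by simp [Expr.deg, maxDeg]) (by simp [Expr.val]) (by simp [Expr.val])
  obtain ⟨t, s1, h1, h2, h3, rfl⟩ := hinit hM hw hs
  obtain ⟨t', s2, h4, h5, h6⟩ := key N 0 _ (by omega) ((Frame.refl r s).set le_rfl) (by simp)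
    h0 h3
  exact ⟨_, s2, h1.seq h4, by omega, h6⟩

end WordRAM

/-! ## The program -/

namespace WordRAM

open WordRAM.Expr

/-- Whether `z` codes a template with leftmost vertex before `r`; register 6 holds `T`. -/
def tplE (r z : Expr) : Expr :=
  less (z / reg 6 / reg 6) r * less (rem z (reg 6) + const 1) (rem (z / reg 6) (reg 6) + const 2)

/-- Whether two codes are in conflict; register 3 holds `Δ₂` and register 6 holds `T`. -/
def conflictE (z z' : Expr) : Expr :=
  less (rem z' (reg 6) + const 1) (rem (z / reg 6) (reg 6) + const 1 + reg 3) *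
    less (rem z (reg 6) + const 1) (rem (z' / reg 6) (reg 6) + const 1 + reg 3)

lemma ite_mul_ite (p q : Prop) [Decidable p] [Decidable q] [Decidable (p ∧ q)] :
    ((if p then 1 else 0) * (if q then 1 else 0) : ℕ) = if p ∧ q then 1 else 0 := by
  by_cases hp : p <;> by_cases hq : q <;> simp [hp, hq]

lemma val_tplE (s : State) (r z : Expr) :
    (tplE r z).val s = if IsTpl (s.reg 6) (r.val s) (z.val s) then 1 else 0 := by
  simp only [tplE, less, val_mul, val_lt, val_div, val_reg, val_add, val_rem, val_const]
  rw [ite_mul_ite]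
  refine if_congr ?_ rfl rfl
  simp only [IsTpl]
  omega

lemma val_conflictE (s : State) (z z' : Expr) :
    (conflictE z z').val s =
      if Conflict (s.reg 6) (s.reg 3) (z.val s) (z'.val s) then 1 else 0 := by
  simp only [conflictE, less, val_mul, val_lt, val_div, val_reg, val_add, val_rem, val_const,
    ite_mul_ite]
  rfl

/-- The greedy scan of `[a, a + l)` for the edge `{i, i + 1}`, where `i` is in register 20, `a` in
register 40 and `l` in register 41. -/
def scanProg : Program :=
  .seq (block [(43, const 0), (44, const 0), (45, const 0)]) (forUp 42 41 (block
    -- Register 46 is the bit of the current time, 43 counts the kept times, 44 the completed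
    -- blocks, and 45 is the length of the current run, reset by a present time or a completed
    -- block.
    [(46, load (reg 7 + reg 1 * (reg 40 + reg 42) + reg 20)),
      (43, reg 43 + reg 46),
      (45, (reg 45 + const 1) * (const 1 - reg 46)),
      (44, reg 44 + same (reg 45) (reg 2)),
      (45, reg 45 * (const 1 - same (reg 45) (reg 2)))]))

end WordRAM

lemma keepCount_succ (P : Finset ℕ) (a j : ℕ) :
    keepCount P a (j + 1) = keepCount P a j + if a + j ∈ P then 1 else 0 := by
  unfold keepCount
  have h : Finset.Ico a (a + (j + 1)) = insert (a + j) (Finset.Ico a (a + j)) := by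
    ext t
    simp only [Finset.mem_Ico, Finset.mem_insert]
    omega
  rw [h]
  split_ifs with hP
  · rw [Finset.inter_insert_of_mem hP, Finset.card_insert_of_notMem (by simp)]
  · rw [Finset.inter_insert_of_notMem hP, add_zero]

lemma keepCount_le (P : Finset ℕ) (a j : ℕ) : keepCount P a j ≤ j := by
  unfold keepCount
  exact (Finset.card_le_card Finset.inter_subset_right).trans (by simp)

lemma greedyScan_succ (Δ : ℕ) (P : Finset ℕ) (a j : ℕ) :
    greedyScan Δ P a (j + 1) =
      if (if a + j ∈ P then 0 else (greedyScan Δ P a j).2 + 1) = Δ then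
        ((greedyScan Δ P a j).1 + 1, 0)
      else ((greedyScan Δ P a j).1, if a + j ∈ P then 0 else (greedyScan Δ P a j).2 + 1) := rfl

lemma greedyScan_fst_le_self (Δ : ℕ) (P : Finset ℕ) (a j : ℕ) : (greedyScan Δ P a j).1 ≤ j := by
  induction j with
  | zero => simp [greedyScan]
  | succ j ih =>
    simp only [greedyScan]
    split_ifs <;> simp only <;> omega

namespace WordRAM

open WordRAM.Expr

variable {w M : ℕ} {s : State}

lemma scanProg_run {n Δ F i a l : ℕ} {P : Finset ℕ} (hΔ : 0 < Δ)
    (h1 : s.reg 1 = n) (h2 : s.reg 2 = Δ) (h7 : s.reg 7 = F) (h20 : s.reg 20 = i)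
    (h40 : s.reg 40 = a) (h41 : s.reg 41 = l)
    (hmem : ∀ t, a ≤ t → t < a + l → s.mem (F + n * t + i) = if t ∈ P then 1 else 0) :
    Run w M scanProg s (50 * l + 20) fun s' => Frame 42 s s' ∧ s'.mem = s.mem ∧
      s'.reg 43 = keepCount P a l ∧ s'.reg 44 = (greedyScan Δ P a l).1 := by
  refine Run.of_bounded fun hs => ?_
  have hlM : l ≤ M := h41 ▸ hs.1 41
  have hΔM : Δ ≤ M := h2 ▸ hs.1 2
  refine Run.block_seq 10 (by decide) (by decide) (b' := 50 * l + 10) (by omega)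
    (by simp [BlockLe]) ?_
  refine Run.forUp (N := l) (c := 40) (fun j s' => s'.mem = s.mem ∧ s'.reg 43 = keepCount P a j ∧
      s'.reg 44 = (greedyScan Δ P a j).1 ∧ s'.reg 45 = (greedyScan Δ P a j).2)
    (by norm_num) (by simpa [blockState]) (by simp [blockState, keepCount, greedyScan])
    (fun j hj s' hf hr hI => ?_) (fun s' hf hI => ?_) (by omega)
  · obtain ⟨i1, i2, i3, i4⟩ := hI
    have hf0 : Frame 42 s s' := ((Frame.refl _ _).blockState (by decide)).trans hf
    have f1 : s'.reg 1 = n := by rw [hf0 1 (by norm_num), h1]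
    have f2 : s'.reg 2 = Δ := by rw [hf0 2 (by norm_num), h2]
    have f7 : s'.reg 7 = F := by rw [hf0 7 (by norm_num), h7]
    have f20 : s'.reg 20 = i := by rw [hf0 20 (by norm_num), h20]
    have f40 : s'.reg 40 = a := by rw [hf0 40 (by norm_num), h40]
    have hm := hmem (a + j) (by omega) (by omega)
    have k1 := keepCount_succ P a j
    have k2 := keepCount_le P a (j + 1)
    have k3 := greedyScan_fst_le_self Δ P a (j + 1)
    have k4 := greedyScan_snd_lt hΔ P a j
    have k5 := greedyScan_fst_le_self Δ P a j
    have g1 := greedyScan_succ Δ P a j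
    refine Run.block_le (by decide) (by decide) ?_ ⟨(Frame.refl _ _).blockState (by decide), ?_⟩
    · simp only [BlockLe, val_load, val_add, val_mul, val_reg, val_sub, val_const, val_eq,
        State.set_reg, f1, f2, f7, f20, f40, hr, i1, i2, i3, i4, hm]
      by_cases hP : a + j ∈ P
      · simp [hP, hΔ.ne] at *
        omega
      · by_cases hd : (greedyScan Δ P a j).2 + 1 = Δ
        · simp [hP, hd] at *
          omega
        · simp [hP, hd] at *
          omega
    · simp only [blockState, val_load, val_add, val_mul, val_reg, val_sub, val_const, val_eq,
        State.set_reg, State.set_mem, f1, f2, f7, f20, f40, hr, i1, i2, i3, i4, hm]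
      by_cases hP : a + j ∈ P
      · simp [hP, hΔ.ne] at *
        simp [*]
      · by_cases hd : (greedyScan Δ P a j).2 + 1 = Δ
        · simp [hP, hd] at *
          simp [*]
        · simp [hP, hd] at *
          simp [*]
  · exact ⟨((Frame.refl _ _).blockState (by decide)).trans hf, hI.1, hI.2.1, hI.2.2.1⟩

end WordRAM

/-- All times are counted. -/
lemma keepCount_eq_card {P : Finset ℕ} {T : ℕ} (hP : ∀ t ∈ P, 1 ≤ t ∧ t ≤ T) :
    keepCount P 1 T = P.card := by
  unfold keepCount
  rw [Finset.inter_eq_left.mpr]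
  intro t ht
  have := hP t ht
  rw [Finset.mem_Ico]
  omega

/-! ### Gain and loss of a row -/

namespace WordRAM

open WordRAM.Expr

variable {w M : ℕ} {s : State}

/-- The registers 1 to 11 hold the parameters of the dynamic program. -/
structure Params (n Δ₁ Δ₂ k T F m S D : ℕ) (s : State) : Prop where
  r1 : s.reg 1 = n
  r2 : s.reg 2 = Δ₁
  r3 : s.reg 3 = Δ₂
  r4 : s.reg 4 = k
  r5 : s.reg 5 = n - 1
  r6 : s.reg 6 = T
  r7 : s.reg 7 = F
  r8 : s.reg 8 = m
  r9 : s.reg 9 = T * T * n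
  r10 : s.reg 10 = S
  r11 : s.reg 11 = D

lemma Params.frame {n Δ₁ Δ₂ k T F m S D L : ℕ} {s' : State}
    (h : Params n Δ₁ Δ₂ k T F m S D s) (hf : Frame L s s') (hL : 12 ≤ L) :
    Params n Δ₁ Δ₂ k T F m S D s' := by
  constructor
  · rw [hf 1 (by omega), h.r1]
  · rw [hf 2 (by omega), h.r2]
  · rw [hf 3 (by omega), h.r3]
  · rw [hf 4 (by omega), h.r4]
  · rw [hf 5 (by omega), h.r5]
  · rw [hf 6 (by omega), h.r6]
  · rw [hf 7 (by omega), h.r7]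
  · rw [hf 8 (by omega), h.r8]
  · rw [hf 9 (by omega), h.r9]
  · rw [hf 10 (by omega), h.r10]
  · rw [hf 11 (by omega), h.r11]

/-- The templates of the row in register 21: their gain in register 24, and their loss plus the
number of all times of the edge in register 25. -/
def rowProg : Program :=
  .seq (block [(40, const 1), (41, reg 6)]) (.seq scanProg (.seq
    (block [(23, reg 21), (24, const 0), (25, reg 43)])
    (forUp 22 8 (.seq
      (block [(26, rem (reg 23) (reg 9)),
        (23, reg 23 / reg 9),
        (27, tplE (reg 20 + const 1) (reg 26)),
        (40, rem (reg 26) (reg 6) + const 1),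
        (41, reg 27 * (rem (reg 26 / reg 6) (reg 6) + const 1 + const 1 - reg 40))])
      (.seq scanProg (block
        [(24, reg 24 + reg 43),
          (25, reg 25 + reg 27 * (reg 44 + same (reg 43 + reg 44) (const 0) +
            -- The pairs without times need no scan, thanks to the closed form `addCost_empty`.
            (reg 20 - reg 26 / reg 6 / reg 6) *
              (reg 41 / reg 2 + same (reg 41 / reg 2) (const 0))))]))))))

lemma rowGain_succ (T B m i : ℕ) (P : Finset ℕ) (y : ℕ) :
    rowGain T B (m + 1) i P y = rowGain T B m i P y +
      if IsTpl T (i + 1) (digit B y m) then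
        keepCount P (digit B y m % T + 1)
          (digit B y m / T % T + 1 + 1 - (digit B y m % T + 1)) else 0 :=
  Finset.sum_range_succ _ _

lemma rowLoss_succ (Δ₁ T B m i : ℕ) (P : Finset ℕ) (y : ℕ) :
    rowLoss Δ₁ T B (m + 1) i P y = rowLoss Δ₁ T B m i P y +
      if IsTpl T (i + 1) (digit B y m) then
        addCost Δ₁ P (digit B y m % T + 1)
          (digit B y m / T % T + 1 + 1 - (digit B y m % T + 1)) +
        (i - digit B y m / T / T) * addCost Δ₁ ∅ (digit B y m % T + 1)
          (digit B y m / T % T + 1 + 1 - (digit B y m % T + 1)) else 0 :=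
  Finset.sum_range_succ _ _

lemma rowProg_run {n Δ₁ Δ₂ k T F m S D i y : ℕ} {P : Finset ℕ} (hΔ : 0 < Δ₁) (hT : 0 < T)
    (hn : 0 < n) (hp : Params n Δ₁ Δ₂ k T F m S D s) (h20 : s.reg 20 = i) (h21 : s.reg 21 = y)
    (hP : ∀ t ∈ P, 1 ≤ t ∧ t ≤ T)
    (hmem : ∀ t ≤ T, s.mem (F + n * t + i) = if t ∈ P then 1 else 0)
    (hgain : ∀ j ≤ m, rowGain T (T * T * n) j i P y ≤ M)
    (hloss : ∀ j ≤ m, P.card + rowLoss Δ₁ T (T * T * n) j i P y ≤ M)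
    (hTM : T + 1 ≤ M) :
    Run w M rowProg s (50 * T + 60 + m * (50 * T + 240)) fun s' =>
      Frame 22 s s' ∧ s'.mem = s.mem ∧ s'.reg 24 = rowGain T (T * T * n) m i P y ∧
        s'.reg 25 = P.card + rowLoss Δ₁ T (T * T * n) m i P y := by
  have hcard := keepCount_eq_card hP
  refine Run.block_seq 10 (by decide) (by decide) (b' := 50 * T + 50 + m * (50 * T + 240))
    (by omega) ?_ ?_
  · simp [BlockLe, hp.r6]
    omega
  refine Run.seq_le (b := 50 * T + 20) (b' := 30 + m * (50 * T + 240)) (Run.mono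
    (scanProg_run (n := n) (Δ := Δ₁) (F := F) (i := i) (a := 1) (l := T) (P := P) hΔ ?_ ?_ ?_ ?_
      ?_ ?_ ?_) le_rfl (fun s1 h1 => Run.of_bounded fun hs1 => ?_)) (by omega)
  · simpa [blockState] using hp.r1
  · simpa [blockState] using hp.r2
  · simpa [blockState] using hp.r7
  · simpa [blockState] using h20
  · simp [blockState]
  · simpa [blockState] using hp.r6
  · intro t h1 h2
    simpa using hmem t (by omega)
  obtain ⟨f1, e1, e2, e3⟩ := h1
  have hf1 : Frame 40 s s1 := ((Frame.refl _ _).blockState (by decide)).trans (f1.mono (by omega))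
  rw [blockState_mem] at e1
  have a21 : s1.reg 21 = y := by rw [hf1 21 (by norm_num), h21]
  have hyM : y ≤ M := a21 ▸ hs1.1 21
  refine Run.block_seq 10 (by decide) (by decide) (b' := 6 + m * (50 * T + 240)) (by omega) ?_ ?_
  · have := hloss 0 (by omega)
    simp [BlockLe, e2, hcard, a21]
    omega
  refine Run.forUp (N := m) (c := 50 * T + 220) (fun j s' => s'.mem = s.mem ∧
      s'.reg 23 = y / (T * T * n) ^ j ∧ s'.reg 24 = rowGain T (T * T * n) j i P y ∧
      s'.reg 25 = P.card + rowLoss Δ₁ T (T * T * n) j i P y)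
    (by norm_num) ?_ ?_ (fun j hj s' hf hr hI => ?_) (fun s' hf hI => ?_) (by
      rw [Nat.mul_add, Nat.mul_add, Nat.mul_add]; omega)
  · simpa [blockState, hp.r8] using hf1 8 (by norm_num)
  · simp [blockState, a21, e1, e2, hcard, rowGain, rowLoss]
  · obtain ⟨i1, i2, i3, i4⟩ := hI
    have hf2 : Frame 22 s s' := (hf1.mono (by omega)).trans
      (((Frame.refl _ _).blockState (by decide)).trans hf)
    have hp' := hp.frame hf2 (by omega)
    have a20 : s'.reg 20 = i := by rw [hf2 20 (by norm_num), h20]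
    set z := digit (T * T * n) y j with hz
    have hz' : y / (T * T * n) ^ j % (T * T * n) = z := rfl
    have hdiv : y / (T * T * n) ^ j / (T * T * n) = y / (T * T * n) ^ (j + 1) := by
      rw [Nat.div_div_eq_div_mul, pow_succ]
    have hbT := Nat.mod_lt (z / T) hT
    have haT := Nat.mod_lt z hT
    have hzM : z ≤ M := by
      have h9 := hs1.1 9
      rw [(hp.frame hf1 (by omega)).r9] at h9
      refine le_trans ?_ h9
      exact (Nat.mod_lt _ (by positivity)).le
    have hy'M : y / (T * T * n) ^ (j + 1) ≤ M := (Nat.div_le_self _ _).trans hyM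
    -- An empty slot gets length 0: its scan counts nothing and reads no cell. Its loss is cancelled
    -- by the factor in register 27.
    set l := if IsTpl T (i + 1) z then z / T % T + 1 + 1 - (z % T + 1) else 0 with hl
    have hlT : l ≤ T := by
      rw [hl]
      split_ifs <;> omega
    have hl' : (if IsTpl T (i + 1) z then 1 else 0) * (z / T % T + 1 + 1 - (z % T + 1)) = l := by
      rw [hl]
      split_ifs <;> simp
    refine Run.block_seq 100 (by decide) (by decide) (b' := 50 * T + 120) (by omega) ?_ ?_
    · simp only [BlockLe, val_tplE, val_rem, val_reg, val_const, val_div, val_add, val_sub,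
        val_mul, State.set_reg, hp'.r9, hp'.r6, i2, a20, hz']
      simp only [Nat.reduceEqDiff, if_true, if_false, hl', hdiv]
      refine ⟨hzM, hy'M, ?_, by omega, by omega, trivial⟩
      split_ifs <;> omega
    refine Run.seq_le (b := 50 * T + 20) (Run.mono
      (scanProg_run (n := n) (Δ := Δ₁) (F := F) (i := i) (a := z % T + 1) (l := l) (P := P)
        hΔ ?_ ?_ ?_ ?_ ?_ ?_ ?_) (by omega) (fun s3 h3 => ?_)) (b' := 100) (by omega)
    · simpa [blockState] using hp'.r1
    · simpa [blockState] using hp'.r2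
    · simpa [blockState] using hp'.r7
    · simpa [blockState] using a20
    · simp [blockState, hp'.r9, hp'.r6, i2, hz']
    · simpa [blockState, hp'.r9, hp'.r6, i2, hz', val_tplE, a20] using hl'
    · intro t h1 h2
      rw [blockState_mem, i1]
      refine hmem t ?_
      rw [hl] at h2
      split_ifs at h2 <;> omega
    obtain ⟨f3, m3, k3, g3⟩ := h3
    rw [blockState_mem] at m3
    have f3' : Frame 23 s' s3 := ((Frame.refl _ _).blockState (by decide)).trans
      (f3.mono (by omega))
    have hp3 := hp'.frame f3' (by omega)
    have c20 : s3.reg 20 = i := by rw [f3' 20 (by norm_num), a20]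
    have c23 : s3.reg 23 = y / (T * T * n) ^ (j + 1) := by
      rw [f3 23 (by norm_num)]
      simp [blockState, hp'.r9, i2, hdiv]
    have c24 : s3.reg 24 = rowGain T (T * T * n) j i P y := by
      rw [f3 24 (by norm_num)]
      simp [blockState, i3]
    have c25 : s3.reg 25 = P.card + rowLoss Δ₁ T (T * T * n) j i P y := by
      rw [f3 25 (by norm_num)]
      simp [blockState, i4]
    have c26 : s3.reg 26 = z := by
      rw [f3 26 (by norm_num)]
      simp [blockState, i2, hp'.r9, hz']
    have c27 : s3.reg 27 = if IsTpl T (i + 1) z then 1 else 0 := by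
      rw [f3 27 (by norm_num)]
      simp [blockState, i2, hp'.r9, hp'.r6, hz', val_tplE, a20]
    have c41 : s3.reg 41 = l := by
      rw [f3 41 (by norm_num)]
      simpa [blockState, hp'.r9, hp'.r6, i2, hz', val_tplE, a20] using hl'
    have e24 : rowGain T (T * T * n) j i P y + keepCount P (z % T + 1) l =
        rowGain T (T * T * n) (j + 1) i P y := by
      rw [rowGain_succ, ← hz, hl]
      split_ifs
      · rfl
      · simp [keepCount]
    have e25 : P.card + rowLoss Δ₁ T (T * T * n) j i P y + (if IsTpl T (i + 1) z then 1 else 0) *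
        ((greedyScan Δ₁ P (z % T + 1) l).1 +
          (if keepCount P (z % T + 1) l + (greedyScan Δ₁ P (z % T + 1) l).1 = 0 then 1 else 0) +
          (i - z / T / T) * (l / Δ₁ + if l / Δ₁ = 0 then 1 else 0)) =
        P.card + rowLoss Δ₁ T (T * T * n) (j + 1) i P y := by
      rw [rowLoss_succ, ← hz, hl]
      by_cases ht : IsTpl T (i + 1) z
      · rw [if_pos ht, if_pos ht, if_pos ht, addCost_empty hΔ, one_mul, addCost, add_assoc]
      · simp only [if_neg ht, zero_mul, add_zero]
    refine Run.block_le (by decide) (by decide) ?_ ⟨f3'.blockState (by decide), ?_⟩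
    · simp only [BlockLe, val_add, val_mul, val_reg, val_const, val_sub, val_div, val_eq,
        State.set_reg, hp3.r2, hp3.r6, c20, c24, c25, c26, c27, c41, k3, g3]
      simp only [Nat.reduceEqDiff, if_false]
      rw [e24, e25]
      exact ⟨hgain _ hj, hloss _ hj, trivial⟩
    · simp only [blockState, val_add, val_mul, val_reg, val_const, val_sub, val_div, val_eq,
        State.set_reg, State.set_mem, hp3.r2, hp3.r6, c20, c24, c25, c26, c27, c41, k3, g3]
      simp only [Nat.reduceEqDiff, if_true, if_false, c23]
      rw [e24, e25]
      refine ⟨m3.trans i1, ?_, ?_, ?_⟩ <;> trivial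
  · exact ⟨(hf1.mono (by omega)).trans (((Frame.refl _ _).blockState (by decide)).trans hf),
      hI.1, hI.2.2.1, hI.2.2.2⟩

end WordRAM

/-! ### Violations between consecutive rows -/

namespace WordRAM

open WordRAM.Expr

variable {w M : ℕ} {s : State}

/-- The number of violations between the row `i` in register 28 and the row `i + 1` in register 21,
computed in register 37. -/
def checkProg : Program :=
  .seq (block [(30, reg 21), (37, const 0)]) (forUp 29 8 (.seq
    (block [(32, rem (reg 30) (reg 9)),
      (30, reg 30 / reg 9),
      (31, tplE (reg 20 + const 1) (reg 32)),
      -- Copies of both rows for the inner loop, which strips their digits by division. Register 36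
      -- counts occurrences of the current template in the old row, starting at 1 if it begins at
      -- the current vertex.
      (34, reg 28),
      (35, reg 21),
      (36, same (reg 32 / reg 6 / reg 6) (reg 20))])
    (.seq
      (forUp 33 8 (block
        [(38, rem (reg 34) (reg 9)),
          (34, reg 34 / reg 9),
          (39, rem (reg 35) (reg 9)),
          (35, reg 35 / reg 9),
          (40, tplE (reg 20) (reg 38)),
          (41, same (reg 38) (reg 32)),
          (36, reg 36 + reg 40 * reg 41),
          (37, reg 37 + (reg 31 * (reg 40 * ((const 1 - reg 41) * conflictE (reg 38) (reg 32))) +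
            reg 31 * (tplE (reg 20 + const 1) (reg 39) * ((const 1 - same (reg 33) (reg 29)) *
              conflictE (reg 39) (reg 32)))))]))
      (block [(37, reg 37 + reg 31 * same (reg 36) (const 0))]))))

lemma one_sub_ite (p : Prop) [Decidable p] :
    (1 - (if p then 1 else 0) : ℕ) = if ¬ p then 1 else 0 := by
  by_cases hp : p <;> simp [hp]

lemma clashCount_le (T Δ₂ B i x y q p : ℕ) : clashCount T Δ₂ B i x y q p ≤ 2 := by
  unfold clashCount
  split_ifs <;> omega

lemma sum_clashCount_le (T Δ₂ B i x y q j : ℕ) :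
    ∑ p ∈ Finset.range j, clashCount T Δ₂ B i x y q p ≤ 2 * j := by
  refine (Finset.sum_le_card_nsmul _ _ 2 fun p _ => clashCount_le T Δ₂ B i x y q p).trans ?_
  rw [Finset.card_range, smul_eq_mul, mul_comm]

lemma foundCount_le (T B j i x z : ℕ) : foundCount T B j i x z ≤ j + 1 := by
  unfold foundCount
  have : (∑ p ∈ Finset.range j, if IsTpl T i (digit B x p) ∧ digit B x p = z then 1 else 0) ≤ j := by
    rw [← Finset.card_filter]
    exact (Finset.card_filter_le _ _).trans (by simp)
  split_ifs <;> omega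

lemma foundCount_succ (T B j i x z : ℕ) : foundCount T B (j + 1) i x z =
    foundCount T B j i x z +
      if IsTpl T i (digit B x j) ∧ digit B x j = z then 1 else 0 := by
  rw [foundCount, foundCount, Finset.sum_range_succ, add_assoc]

lemma digit_eq (B y j : ℕ) : y / B ^ j % B = digit B y j := rfl

lemma div_pow_succ (B y j : ℕ) : y / B ^ j / B = y / B ^ (j + 1) := by
  rw [Nat.div_div_eq_div_mul, pow_succ]

lemma checkProg_run {n Δ₁ Δ₂ k T F m S D i x y : ℕ} (hn : 0 < n) (hT : 0 < T)
    (hp : Params n Δ₁ Δ₂ k T F m S D s) (h20 : s.reg 20 = i) (h21 : s.reg 21 = y)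
    (h28 : s.reg 28 = x) (hM : m * (2 * m + 1) + m + 1 ≤ M) :
    Run w M checkProg s (20 + m * (m * 400 + 300)) fun s' =>
      Frame 29 s s' ∧ s'.mem = s.mem ∧ s'.reg 37 = badCount T Δ₂ (T * T * n) m i x y := by
  refine Run.of_bounded fun hs => ?_
  have hxM : x ≤ M := h28 ▸ hs.1 28
  have hyM : y ≤ M := h21 ▸ hs.1 21
  set B := T * T * n with hB
  have hB0 : 0 < B := by positivity
  have hBM : B ≤ M := by
    have := hs.1 9
    rwa [hp.r9] at this
  refine Run.block_seq 10 (by decide) (by decide) (b' := 10 + m * (m * 400 + 300)) (by omega)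
    (by simp [BlockLe, h21, hyM]) ?_
  have hf1 : Frame 29 s (blockState [(30, reg 21), (37, const 0)] s) :=
    (Frame.refl _ _).blockState (by decide)
  refine Run.forUp (N := m) (c := m * 400 + 290) (fun j s' => s'.mem = s.mem ∧
      s'.reg 30 = y / B ^ j ∧ s'.reg 37 = ∑ q ∈ Finset.range j,
        ((∑ p ∈ Finset.range m, clashCount T Δ₂ B i x y q p) +
          if IsTpl T (i + 1) (digit B y q) ∧ foundCount T B m i x (digit B y q) = 0
            then 1 else 0))
    (by norm_num) (by simpa [blockState] using hp.r8) (by simp [blockState, h21])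
    (fun j hj s' hf hr hI => ?_) (fun s' hf hI => ?_) (by
      rw [show m * 400 + 290 + 8 = m * 400 + 298 by ring, Nat.mul_add, Nat.mul_add]; omega)
  swap
  · exact ⟨hf1.trans hf, hI.1, hI.2.2⟩
  obtain ⟨i1, i2, i3⟩ := hI
  set acc := ∑ q ∈ Finset.range j, ((∑ p ∈ Finset.range m, clashCount T Δ₂ B i x y q p) +
    if IsTpl T (i + 1) (digit B y q) ∧ foundCount T B m i x (digit B y q) = 0
      then 1 else 0) with hacc
  -- Each slot causes at most two clashes per slot `p` and one missing predecessor.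
  have haccle : acc ≤ j * (2 * m + 1) := by
    have := Finset.sum_le_card_nsmul (Finset.range j) (fun q =>
      (∑ p ∈ Finset.range m, clashCount T Δ₂ B i x y q p) +
        if IsTpl T (i + 1) (digit B y q) ∧ foundCount T B m i x (digit B y q) = 0
          then 1 else 0) (2 * m + 1) fun q _ => by
            have := sum_clashCount_le T Δ₂ B i x y q m
            split_ifs <;> omega
    simpa using this
  have haccM : acc + (2 * m + 1) ≤ M := by
    have := Nat.mul_le_mul_right (2 * m + 1) (Nat.succ_le_of_lt hj)
    rw [Nat.succ_mul] at this
    omega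
  have hf2 : Frame 29 s s' := hf1.trans hf
  have hp' := hp.frame hf2 (by omega)
  have a20 : s'.reg 20 = i := by rw [hf2 20 (by norm_num), h20]
  have a21 : s'.reg 21 = y := by rw [hf2 21 (by norm_num), h21]
  have a28 : s'.reg 28 = x := by rw [hf2 28 (by norm_num), h28]
  set z := digit B y j with hz
  have hzM : z ≤ M := (Nat.mod_lt _ hB0).le.trans hBM
  have hy'M : ∀ j, y / B ^ j ≤ M := fun j => (Nat.div_le_self _ _).trans hyM
  have hx'M : ∀ j, x / B ^ j ≤ M := fun j => (Nat.div_le_self _ _).trans hxM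
  have hite : ∀ (p : Prop) [Decidable p], (if p then 1 else 0 : ℕ) ≤ M := by
    intro p _
    split_ifs <;> omega
  refine Run.block_seq 120 (by decide) (by decide) (b' := m * 400 + 150) (by omega) ?_ ?_
  · simp only [BlockLe, val_tplE, val_rem, val_reg, val_const, val_div, val_add, val_eq,
      State.set_reg, hp'.r9, hp'.r6, i2, a20, a21, a28, digit_eq, ← hB]
    simp only [Nat.reduceEqDiff, if_true, if_false, div_pow_succ]
    exact ⟨hzM, hy'M _, hite _, hxM, hyM, hite _, trivial⟩
  set s2 := blockState [(32, rem (reg 30) (reg 9)), (30, reg 30 / reg 9),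
      (31, tplE (reg 20 + const 1) (reg 32)), (34, reg 28), (35, reg 21),
      (36, same (reg 32 / reg 6 / reg 6) (reg 20))] s' with hs2
  have hf3 : Frame 30 s' s2 := (Frame.refl _ _).blockState (by decide)
  have b29 : s2.reg 29 = j := by rw [hf3 29 (by norm_num), hr]
  have b30 : s2.reg 30 = y / B ^ (j + 1) := by
    simp [hs2, blockState, hp'.r9, i2, div_pow_succ, ← hB]
  have b31 : s2.reg 31 = if IsTpl T (i + 1) z then 1 else 0 := by
    simp [hs2, blockState, hp'.r9, hp'.r6, i2, digit_eq, ← hB, ← hz, val_tplE, a20]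
  have b32 : s2.reg 32 = z := by
    simp [hs2, blockState, hp'.r9, i2, digit_eq, ← hB, ← hz]
  have b34 : s2.reg 34 = x := by simp [hs2, blockState, a28]
  have b35 : s2.reg 35 = y := by simp [hs2, blockState, a21]
  have b36 : s2.reg 36 = if z / T / T = i then 1 else 0 := by
    simp [hs2, blockState, hp'.r9, hp'.r6, i2, digit_eq, ← hB, ← hz, a20]
  have b37 : s2.reg 37 = acc := by simp [hs2, blockState, i3]
  have bm : s2.mem = s.mem := by rw [hs2, blockState_mem, i1]
  refine Run.seq_le (b := m * 400 + 6) (b' := 100) (Run.forUp (N := m) (c := 390) (fun l s3 =>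
      s3.mem = s.mem ∧ s3.reg 34 = x / B ^ l ∧ s3.reg 35 = y / B ^ l ∧
      s3.reg 36 = foundCount T B l i x z ∧
      s3.reg 37 = acc + ∑ p ∈ Finset.range l, clashCount T Δ₂ B i x y j p)
    (by norm_num) ?_ ?_ (fun l hl s3 hfl hrl hIl => ?_) (fun s3 hfl hIl => ?_) (by omega)) (by omega)
  · rw [hf3 8 (by norm_num), hp'.r8]
  · simp [bm, b34, b35, b36, b37, foundCount]
  · obtain ⟨j1, j2, j3, j4, j5⟩ := hIl
    have hp3 := hp'.frame ((hf3.mono (by omega)).trans (hfl.mono (by omega)) : Frame 30 s' s3)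
      (by omega)
    have c20 : s3.reg 20 = i := by rw [hfl 20 (by norm_num), hf3 20 (by norm_num), a20]
    have c29 : s3.reg 29 = j := by rw [hfl 29 (by norm_num), b29]
    have c31 : s3.reg 31 = if IsTpl T (i + 1) z then 1 else 0 := by rw [hfl 31 (by norm_num), b31]
    have c32 : s3.reg 32 = z := by rw [hfl 32 (by norm_num), b32]
    have hfc := foundCount_le T B (l + 1) i x z
    have hcl := sum_clashCount_le T Δ₂ B i x y j (l + 1)
    have e36 : foundCount T B l i x z + (if IsTpl T i (digit B x l) then 1 else 0) *
        (if digit B x l = z then 1 else 0) = foundCount T B (l + 1) i x z := by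
      rw [foundCount_succ, ite_mul_ite]
    have e37 : acc + ∑ p ∈ Finset.range l, clashCount T Δ₂ B i x y j p +
        ((if IsTpl T (i + 1) z then 1 else 0) * ((if IsTpl T i (digit B x l) then 1 else 0) *
          ((1 - if digit B x l = z then 1 else 0) *
            (if Conflict T Δ₂ (digit B x l) z then 1 else 0))) +
        (if IsTpl T (i + 1) z then 1 else 0) * ((if IsTpl T (i + 1) (digit B y l) then 1 else 0) *
          ((1 - if l = j then 1 else 0) *
            (if Conflict T Δ₂ (digit B y l) z then 1 else 0)))) =
        acc + ∑ p ∈ Finset.range (l + 1), clashCount T Δ₂ B i x y j p := by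
      rw [Finset.sum_range_succ, one_sub_ite, one_sub_ite]
      simp only [ite_mul_ite]
      rw [add_assoc]
      rfl
    refine Run.block_le (by decide) (by decide) ?_ ⟨(Frame.refl _ _).blockState (by decide), ?_⟩
    · simp only [BlockLe, val_tplE, val_conflictE, val_rem, val_reg, val_const, val_div, val_add,
        val_mul, val_sub, val_eq, State.set_reg, hp3.r9, hp3.r6, hp3.r3, j2, j3, j4, j5, c20, c29,
        c31, c32, digit_eq, ← hB]
      simp only [Nat.reduceEqDiff, if_true, if_false, digit_eq, div_pow_succ, ← hB, hrl]
      rw [e36, e37]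
      refine ⟨?_, hx'M _, ?_, hy'M _, hite _, hite _, by omega, by omega, trivial⟩
      · exact (Nat.mod_lt _ hB0).le.trans hBM
      · exact (Nat.mod_lt _ hB0).le.trans hBM
    · simp only [blockState, val_tplE, val_conflictE, val_rem, val_reg, val_const, val_div, val_add,
        val_mul, val_sub, val_eq, State.set_reg, State.set_mem, hp3.r9, hp3.r6, hp3.r3, j2, j3, j4,
        j5, c20, c29, c31, c32, digit_eq, ← hB]
      simp only [Nat.reduceEqDiff, if_true, if_false, digit_eq, div_pow_succ, ← hB, hrl]
      rw [e36, e37]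
      refine ⟨j1, ?_, ?_, ?_, ?_⟩ <;> trivial
  · obtain ⟨j1, j2, j3, j4, j5⟩ := hIl
    have c30 : s3.reg 30 = y / B ^ (j + 1) := by rw [hfl 30 (by norm_num), b30]
    have c31 : s3.reg 31 = if IsTpl T (i + 1) z then 1 else 0 := by rw [hfl 31 (by norm_num), b31]
    have hcl := sum_clashCount_le T Δ₂ B i x y j m
    have e37 : acc + ∑ p ∈ Finset.range m, clashCount T Δ₂ B i x y j p +
        (if IsTpl T (i + 1) z then 1 else 0) * (if foundCount T B m i x z = 0 then 1 else 0) =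
        ∑ q ∈ Finset.range (j + 1), ((∑ p ∈ Finset.range m, clashCount T Δ₂ B i x y q p) +
          if IsTpl T (i + 1) (digit B y q) ∧ foundCount T B m i x (digit B y q) = 0
            then 1 else 0) := by
      rw [Finset.sum_range_succ, ← hacc, ite_mul_ite, add_assoc]
    have hle : acc + ∑ p ∈ Finset.range m, clashCount T Δ₂ B i x y j p +
        (if IsTpl T (i + 1) z then 1 else 0) * (if foundCount T B m i x z = 0 then 1 else 0) ≤
        M := by
      rw [ite_mul_ite]
      split_ifs <;> omega
    refine Run.block_le (by decide) (by decide) ?_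
      ⟨(((hf3.trans (hfl.mono (by omega))) : Frame 30 s' s3)).blockState (by decide), ?_⟩
    · simp only [BlockLe, val_reg, val_const, val_add, val_mul, val_eq, j4, j5, c31]
      exact ⟨hle, trivial⟩
    · simp only [blockState, val_reg, val_const, val_add, val_mul, val_eq, State.set_reg,
        State.set_mem, j4, j5, c31]
      simp only [Nat.reduceEqDiff, if_true, if_false, c30]
      exact ⟨j1, trivial, e37⟩

end WordRAM

/-! ### Transitions and the table -/

namespace WordRAM

open WordRAM.Expr

variable {w M : ℕ} {s : State}

/-- The address of the entry for the row in register 21 after the current edge. -/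
def newAddr : Expr := reg 11 + (reg 20 + const 1) * reg 10 + reg 21

/-- The address of the entry for the row in register 28 before the current edge. -/
def oldAddr : Expr := reg 11 + reg 20 * reg 10 + reg 28

/-- All transitions to the row in register 21. -/
def updateProg : Program :=
  -- With truncated subtraction, `a + (b - a)` is the maximum of `a` and `b`; the test of register
  -- 37 discards inadmissible predecessors.
  forUp 28 10 (.seq checkProg (.store newAddr (load newAddr +
    ((load oldAddr + reg 24 - reg 25) * same (reg 37) (const 0) - load newAddr))))

/-- The bound `hle` is needed for admissible predecessors only: otherwise the budget is multiplied
by 0 before it is stored. The entry must start at 0 for the running maximum. -/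
lemma updateProg_run {n Δ₁ Δ₂ k T F m S D i y g l c : ℕ} {v : ℕ → ℕ} (hn : 0 < n) (hT : 0 < T)
    (hp : Params n Δ₁ Δ₂ k T F m S D s) (h20 : s.reg 20 = i)
    (h21 : s.reg 21 = y) (h24 : s.reg 24 = g) (h25 : s.reg 25 = l)
    (hM : m * (2 * m + 1) + m + 1 ≤ M)
    (hv : ∀ x < S, s.mem (D + i * S + x) = v x)
    (hz : s.mem (D + (i + 1) * S + y) = 0)
    (hle : ∀ x < S, badCount T Δ₂ (T * T * n) m i x y = 0 → v x + g - l ≤ M)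
    (hc : S * (m * (m * 400 + 300) + 130) + 6 ≤ c) :
    Run w M updateProg s c fun s' => Frame 28 s s' ∧
      (∀ a, a ≠ D + (i + 1) * S + y → s'.mem a = s.mem a) ∧
      s'.mem (D + (i + 1) * S + y) = (Finset.range S).sup fun x =>
        if badCount T Δ₂ (T * T * n) m i x y = 0 then v x + g - l else 0 := by
  set A := D + (i + 1) * S + y with hA
  set f : ℕ → ℕ := fun x =>
    if badCount T Δ₂ (T * T * n) m i x y = 0 then v x + g - l else 0 with hf
  have hfM : ∀ x < S, f x ≤ M := by
    intro x hx
    simp only [hf]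
    split_ifs with h
    · exact hle x hx h
    · omega
  refine Run.forUp (N := S) (c := 20 + m * (m * 400 + 300) + 100) (fun j s' =>
      (∀ a, a ≠ A → s'.mem a = s.mem a) ∧ s'.mem A = (Finset.range j).sup f)
    (by norm_num) hp.r10 ⟨fun a _ => rfl, by simpa using hz⟩
    (fun x hx s' hfr hr hI => ?_) (fun s' hfr hI => ⟨hfr, hI⟩) (le_trans (Nat.add_le_add_right
      (Nat.mul_le_mul_left S (by omega)) 6) hc)
  obtain ⟨i1, i2⟩ := hI
  have hp' := hp.frame hfr (by omega)
  have a20 : s'.reg 20 = i := by rw [hfr 20 (by norm_num), h20]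
  have a21 : s'.reg 21 = y := by rw [hfr 21 (by norm_num), h21]
  have a24 : s'.reg 24 = g := by rw [hfr 24 (by norm_num), h24]
  have a25 : s'.reg 25 = l := by rw [hfr 25 (by norm_num), h25]
  refine Run.seq_le ((checkProg_run hn hT hp' a20 a21 hr hM).mono le_rfl fun s2 h2 => ?_)
    (b' := 100) le_rfl
  obtain ⟨f2, m2, e2⟩ := h2
  have hp2 := hp'.frame f2 (by omega)
  have b20 : s2.reg 20 = i := by rw [f2 20 (by norm_num), a20]
  have b21 : s2.reg 21 = y := by rw [f2 21 (by norm_num), a21]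
  have b24 : s2.reg 24 = g := by rw [f2 24 (by norm_num), a24]
  have b25 : s2.reg 25 = l := by rw [f2 25 (by norm_num), a25]
  have b28 : s2.reg 28 = x := by rw [f2 28 (by norm_num), hr]
  have hnew : newAddr.val s2 = A := by
    simp [newAddr, hp2.r11, hp2.r10, b20, b21, hA]
  have hold : s2.mem (oldAddr.val s2) = v x := by
    have h1 : oldAddr.val s2 = D + i * S + x := by
      simp [oldAddr, hp2.r11, hp2.r10, b20, b28]
    have h2 : D + i * S + x ≠ A := by
      rw [hA, Nat.succ_mul]
      omega
    rw [h1, m2, i1 _ h2, hv x hx]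
  have hcur : s2.mem A = (Finset.range x).sup f := by rw [m2, i2]
  have hval : (load newAddr + ((load oldAddr + reg 24 - reg 25) * same (reg 37) (const 0) -
      load newAddr)).val s2 = (Finset.range (x + 1)).sup f := by
    simp only [val_add, val_sub, val_mul, val_load, val_eq, val_reg, val_const, hold, hnew, hcur,
      b24, b25, e2, mul_ite, mul_one, mul_zero]
    rw [Finset.range_add_one, Finset.sup_insert]
    have : (if badCount T Δ₂ (T * T * n) m i x y = 0 then v x + g - l else 0) = f x := rfl
    rw [this]
    rcases le_total (f x) ((Finset.range x).sup f) with h | h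
    · rw [sup_eq_right.mpr h]
      omega
    · rw [sup_eq_left.mpr h]
      omega
  refine (Run.store (by decide) (by decide) ?_ ?_).mono (b := _) (by decide) fun _ h => h
  · rw [hval]
    exact Finset.sup_le fun x' hx' => hfM x' (by
      have := Finset.mem_range.mp hx'
      omega)
  · rw [hval, hnew]
    refine ⟨fun r hr => (f2.mono le_rfl) r hr, ?_, ?_⟩
    · intro a ha
      rw [State.set_mem, State.put_mem, if_neg ha, m2, i1 a ha]
    · rw [State.set_mem, State.put_mem, if_pos rfl]

/-- Entries never exceed the initial budget, so the whole table fits into words. -/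
lemma dpValue_le {Δ₁ Δ₂ T B m k : ℕ} {P : ℕ → Finset ℕ} (hΔ : 0 < Δ₂) (i : ℕ) :
    ∀ y, dpValue Δ₁ Δ₂ T B m k P i y ≤ k + 1 := by
  induction i with
  | zero =>
    intro y
    simp only [dpValue]
    split_ifs <;> omega
  | succ i ih =>
    intro y
    rw [dpValue]
    refine Finset.sup_le fun x _ => ?_
    split_ifs with h
    · have h1 := rowGain_le (P := P i) hΔ h
      have h2 := ih x
      omega
    · omega

/-- The dynamic program. -/
def dpProg : Program := forUp 20 5 (forUp 21 10 (.seq rowProg updateProg))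

lemma dpProg_run {n Δ₁ Δ₂ k T F m D c : ℕ} {P : ℕ → Finset ℕ} (hn : 0 < n) (hT : 0 < T)
    (h1 : 0 < Δ₁) (h2 : 0 < Δ₂)
    (hp : Params n Δ₁ Δ₂ k T F m ((T * T * n) ^ m) D s)
    (hD : D = F + n * (T + 1))
    (hP : ∀ i, ∀ t ∈ P i, 1 ≤ t ∧ t ≤ T)
    (hmem : ∀ i < n - 1, ∀ t ≤ T, s.mem (F + n * t + i) = if t ∈ P i then 1 else 0)
    (hinit : ∀ y < (T * T * n) ^ m,
      s.mem (D + y) = dpValue Δ₁ Δ₂ T (T * T * n) m k P 0 y)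
    (hzero : ∀ a, D + (T * T * n) ^ m ≤ a → s.mem a = 0)
    (hgain : ∀ i < n, ∀ y, ∀ j ≤ m, rowGain T (T * T * n) j i (P i) y ≤ M)
    (hloss : ∀ i < n, ∀ y, ∀ j ≤ m, (P i).card + rowLoss Δ₁ T (T * T * n) j i (P i) y ≤ M)
    (hTM : T + 1 ≤ M) (hkM : k + 1 ≤ M) (hmM : m * (2 * m + 1) + m + 1 ≤ M)
    (hc : (n - 1) * ((T * T * n) ^ m * ((T * T * n) ^ m * (m * (m * 400 + 300) + 130) +
      (m + 1) * (50 * T + 240) + 20) + 20) + 6 ≤ c) :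
    Run w M dpProg s c fun s' => Frame 20 s s' ∧ ∀ y < (T * T * n) ^ m,
      s'.mem (D + (n - 1) * (T * T * n) ^ m + y) =
        dpValue Δ₁ Δ₂ T (T * T * n) m k P (n - 1) y := by
  set S := (T * T * n) ^ m with hS
  set V := dpValue Δ₁ Δ₂ T (T * T * n) m k P with hV
  refine Run.forUp (N := n - 1) (c := S * (S * (m * (m * 400 + 300) + 130) +
      (m + 1) * (50 * T + 240) + 20) + 12) (fun i s' =>
      -- Below `D` the bitmap stays intact, row `i` of the table is complete, and all later cells
      -- are still 0, as the running maxima require.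
      (∀ a < D, s'.mem a = s.mem a) ∧ (∀ y < S, s'.mem (D + i * S + y) = V i y) ∧
      ∀ a, D + (i + 1) * S ≤ a → s'.mem a = 0)
    (by norm_num) hp.r5 ⟨fun a _ => rfl, by simpa using hinit, by simpa using hzero⟩
    (fun i hi s1 f1 hr1 hI => ?_) (fun s' hfr hI => ⟨hfr, hI.2.1⟩) (le_trans (Nat.add_le_add_right
      (Nat.mul_le_mul_left (n - 1) (by omega)) 6) hc)
  obtain ⟨i1, i2, i3⟩ := hI
  have hp1 := hp.frame f1 (by omega)
  have hstep : (i + 1 + 1) * S = (i + 1) * S + S := Nat.succ_mul _ _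
  have hstep' : (i + 1) * S = i * S + S := Nat.succ_mul _ _
  refine Run.forUp (N := S) (c := S * (m * (m * 400 + 300) + 130) +
      (m + 1) * (50 * T + 240) + 12) (fun y s' =>
      (∀ a < D + (i + 1) * S, s'.mem a = s1.mem a) ∧
      (∀ y' < y, s'.mem (D + (i + 1) * S + y') = V (i + 1) y') ∧
      ∀ a, D + (i + 1) * S + y ≤ a → s'.mem a = 0)
    (by norm_num) hp1.r10
    ⟨fun a _ => rfl, fun y' hy' => absurd hy' (Nat.not_lt_zero _), by simpa using i3⟩
    (fun y hy s2 f2 hr2 hI => ?_) (fun s' hfr hI => ?_) (by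
      rw [show S * (m * (m * 400 + 300) + 130) + (m + 1) * (50 * T + 240) + 12 + 8 =
        S * (m * (m * 400 + 300) + 130) + (m + 1) * (50 * T + 240) + 20 by ring]
      omega)
  swap
  · obtain ⟨j1, j2, j3⟩ := hI
    refine ⟨hfr, fun a ha => ?_, j2, fun a ha => j3 a (by omega)⟩
    rw [State.set_mem, j1 a (by omega), i1 a ha]
  obtain ⟨j1, j2, j3⟩ := hI
  have hp2 := hp1.frame f2 (by omega)
  have a20 : s2.reg 20 = i := by rw [f2 20 (by norm_num), hr1]
  refine Run.seq_le (b := 50 * T + 60 + m * (50 * T + 240))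
    (b' := S * (m * (m * 400 + 300) + 130) + 6) ((rowProg_run (P := P i) h1 hT hn hp2 a20 hr2
      (hP i) ?_ (hgain i (by omega) y) (hloss i (by omega) y) hTM).mono le_rfl
      fun s3 h3 => ?_) (by rw [Nat.add_mul]; omega)
  · intro t ht
    have hlt : n * t + i < n * (T + 1) := by
      have := Nat.mul_le_mul_left n ht
      rw [Nat.mul_add]
      omega
    rw [j1 _ (by omega), i1 _ (by omega), hmem i hi t ht]
  obtain ⟨f3, m3, e24, e25⟩ := h3
  have hp3 := hp2.frame f3 (by omega)
  have b20 : s3.reg 20 = i := by rw [f3 20 (by norm_num), a20]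
  have b21 : s3.reg 21 = y := by rw [f3 21 (by norm_num), hr2]
  refine (updateProg_run (v := V i) hn hT hp3 b20 b21 e24 e25 hmM ?_ ?_ ?_ le_rfl).mono le_rfl
    fun s4 h4 => ?_
  · intro x hx
    rw [m3, j1 _ (by omega), i2 x hx]
  · rw [m3, j3 _ le_rfl]
  · intro x hx hb
    have g1 := rowGain_le (P := P i) h2 hb
    have g2 := dpValue_le (Δ₁ := Δ₁) (T := T) (B := T * T * n) (m := m) (k := k) (P := P) h2 i x
    rw [← hV] at g2
    omega
  · obtain ⟨f4, k1, k2⟩ := h4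
    refine ⟨(f3.mono (by omega)).trans (f4.mono (by omega)), fun a ha => ?_, fun y' hy' => ?_,
      fun a ha => ?_⟩
    · rw [State.set_mem, k1 a (by omega), m3, j1 a ha]
    · rw [State.set_mem]
      rcases Nat.lt_succ_iff_lt_or_eq.mp hy' with h | h
      · rw [k1 _ (by omega), m3, j2 y' h]
      · rw [h, k2]
        rfl
    · rw [State.set_mem, k1 a (by omega), m3, j3 a (by omega)]

end WordRAM

/-! ## Reading the input -/

section Input

variable {n : ℕ}

/-- The input words of one entry. -/
def entryWords (x : Fin n × Fin n × List ℕ) : List ℕ :=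
  [(x.1 : ℕ), (x.2.1 : ℕ), x.2.2.length] ++ x.2.2

/-- The address of the entry number `j`. -/
def entryAddr (L : List (Fin n × Fin n × List ℕ)) (j : ℕ) : ℕ :=
  5 + ((L.take j).flatMap entryWords).length

lemma etcInput_eq (L : List (Fin n × Fin n × List ℕ)) (Δ₁ Δ₂ k : ℕ) :
    etcInput L Δ₁ Δ₂ k = [n, L.length, Δ₁, Δ₂, k] ++ L.flatMap entryWords := rfl

lemma length_entryWords (x : Fin n × Fin n × List ℕ) :
    (entryWords x).length = 3 + x.2.2.length := by
  simp [entryWords]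
  omega

lemma entryAddr_succ {L : List (Fin n × Fin n × List ℕ)} {j : ℕ} (hj : j < L.length) :
    entryAddr L (j + 1) = entryAddr L j + 3 + L[j].2.2.length := by
  rw [entryAddr, entryAddr, ← List.take_concat_get' L j hj, List.flatMap_append, List.length_append,
    List.flatMap_singleton, length_entryWords]
  omega

lemma entryAddr_length (L : List (Fin n × Fin n × List ℕ)) (Δ₁ Δ₂ k : ℕ) :
    entryAddr L L.length = (etcInput L Δ₁ Δ₂ k).length := by
  simp [entryAddr, etcInput_eq]
  omega

lemma etcInput_getD {L : List (Fin n × Fin n × List ℕ)} (Δ₁ Δ₂ k : ℕ) {j r : ℕ}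
    (hj : j < L.length) (hr : r < 3 + L[j].2.2.length) :
    entryAddr L j + r < (etcInput L Δ₁ Δ₂ k).length ∧
      (etcInput L Δ₁ Δ₂ k).getD (entryAddr L j + r) 0 = (entryWords L[j]).getD r 0 := by
  have hsplit : etcInput L Δ₁ Δ₂ k = ([n, L.length, Δ₁, Δ₂, k] ++ (L.take j).flatMap entryWords) ++
      (entryWords L[j] ++ (L.drop (j + 1)).flatMap entryWords) := by
    rw [etcInput_eq, List.append_assoc]
    congr 1
    conv_lhs => rw [← List.take_append_drop j L, List.drop_eq_getElem_cons hj]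
    rw [List.flatMap_append, List.flatMap_cons]
  have hlen : entryAddr L j =
      ([n, L.length, Δ₁, Δ₂, k] ++ (L.take j).flatMap entryWords).length := by
    simp [entryAddr]
    omega
  rw [hsplit]
  constructor
  · rw [List.length_append, ← hlen, List.length_append, length_entryWords]
    omega
  · rw [List.getD_append_right _ _ _ _ (by omega), ← hlen, Nat.add_sub_cancel_left,
      List.getD_append _ _ _ _ (by rw [length_entryWords]; exact hr)]

/-- The appearances read from the first `j` entries and the first `c` times of the next one. -/
def readItems (L : List (Fin n × Fin n × List ℕ)) (j c : ℕ) :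
    Set ((Fin n × Fin n × List ℕ) × ℕ) :=
  {p | (p.1 ∈ L.take j ∧ p.2 ∈ p.1.2.2) ∨ (p.1 ∈ L[j]? ∧ p.2 ∈ p.1.2.2.take c)}

lemma readItems_zero (L : List (Fin n × Fin n × List ℕ)) : readItems L 0 0 = ∅ := by
  ext p
  simp [readItems]

lemma readItems_succ {L : List (Fin n × Fin n × List ℕ)} {j c : ℕ} (hj : j < L.length)
    (hc : c < L[j].2.2.length) :
    readItems L j (c + 1) = insert (L[j], L[j].2.2[c]) (readItems L j c) := by
  ext ⟨x, t⟩
  simp only [readItems, Set.mem_ofPred_eq, Set.mem_insert_iff, Prod.mk.injEq,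
    List.getElem?_eq_getElem hj, Option.mem_def, Option.some.injEq]
  constructor
  · rintro (h | ⟨rfl, h⟩)
    · exact Or.inr (Or.inl h)
    · rw [← List.take_concat_get' _ _ hc, List.mem_append, List.mem_singleton] at h
      rcases h with h | h
      · exact Or.inr (Or.inr ⟨rfl, h⟩)
      · exact Or.inl ⟨rfl, h⟩
  · rintro (⟨rfl, rfl⟩ | h | ⟨rfl, h⟩)
    · right
      refine ⟨rfl, ?_⟩
      rw [← List.take_concat_get' _ _ hc]
      exact List.mem_append_right _ (List.mem_singleton.mpr rfl)
    · exact Or.inl h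
    · right
      refine ⟨rfl, ?_⟩
      rw [← List.take_concat_get' _ _ hc]
      exact List.mem_append_left _ h

lemma readItems_length {L : List (Fin n × Fin n × List ℕ)} {j : ℕ} (hj : j < L.length) :
    readItems L j L[j].2.2.length = readItems L (j + 1) 0 := by
  ext ⟨x, t⟩
  simp only [readItems, Set.mem_ofPred_eq, List.getElem?_eq_getElem hj, Option.mem_def,
    Option.some.injEq, List.take_zero, List.not_mem_nil, and_false, or_false]
  rw [← List.take_concat_get' L j hj, List.mem_append, List.mem_singleton]
  constructor
  · rintro (h | ⟨rfl, h⟩)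
    · exact ⟨Or.inl h.1, h.2⟩
    · exact ⟨Or.inr rfl, List.mem_of_mem_take h⟩
  · rintro ⟨h | h, h'⟩
    · exact Or.inl ⟨h, h'⟩
    · subst h
      exact Or.inr ⟨rfl, by rwa [List.take_length]⟩

lemma readItems_all (L : List (Fin n × Fin n × List ℕ)) :
    readItems L L.length 0 = {p | p.1 ∈ L ∧ p.2 ∈ p.1.2.2} := by
  ext ⟨x, t⟩
  simp [readItems]

/-- `v` is the maximum of a set of numbers, or `0` if the set is empty. -/
def MaxOf (X : Set ℕ) (v : ℕ) : Prop := (∀ t ∈ X, t ≤ v) ∧ (v = 0 ∨ v ∈ X)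

lemma MaxOf.insert {X : Set ℕ} {v t : ℕ} (h : MaxOf X v) : MaxOf (insert t X) (v + (t - v)) := by
  obtain ⟨h1, h2⟩ := h
  rcases le_total t v with h | h
  · rw [Nat.sub_eq_zero_of_le h, add_zero]
    refine ⟨?_, h2.imp_right fun h => Or.inr h⟩
    rintro s (rfl | hs)
    · exact h
    · exact h1 s hs
  · rw [Nat.add_sub_cancel' h]
    refine ⟨?_, Or.inr (Or.inl rfl)⟩
    rintro s (rfl | hs)
    · exact le_rfl
    · exact (h1 s hs).trans h

end Input

/-! ### Computing the lifetime and the bitmap of appearances -/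

namespace WordRAM

open WordRAM.Expr

variable {w M : ℕ} {s : State}

/-- Compute the lifetime in register 25 and the length of the input in register 21. -/
def lifetimeProg : Program :=
  .seq (block [(21, const 5), (25, const 0)]) (forUp 20 5 (.seq
    (block [(22, load (reg 21 + const 2))])
    (.seq (forUp 24 22 (block
        [(25, reg 25 + (load (reg 21 + const 3 + reg 24) - reg 25))]))
      (block [(21, reg 21 + const 3 + reg 22)]))))

lemma lifetimeProg_run {n Δ₁ Δ₂ k T : ℕ} {L : List (Fin n × Fin n × List ℕ)}
    (hlen : ∀ x ∈ L, x.2.2.length ≤ T) (hT : ∀ x ∈ L, ∀ t ∈ x.2.2, t ≤ T)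
    (h5 : s.reg 5 = L.length)
    (hmem : ∀ a, s.mem a = (etcInput L Δ₁ Δ₂ k).getD a 0)
    (hM : (etcInput L Δ₁ Δ₂ k).length + 5 ≤ M) (hTM : T ≤ M) :
    Run w M lifetimeProg s (20 + L.length * (30 * T + 60)) fun s' => Frame 20 s s' ∧
      s'.mem = s.mem ∧ s'.reg 21 = (etcInput L Δ₁ Δ₂ k).length ∧
      MaxOf {t | ∃ x ∈ L, t ∈ x.2.2} (s'.reg 25) := by
  refine Run.block_seq 10 (by decide) (by decide) (b' := 10 + L.length * (30 * T + 60)) (by omega)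
    ?_ ?_
  · simp [BlockLe]
    omega
  have hf0 : Frame 20 s (blockState [(21, const 5), (25, const 0)] s) :=
    (Frame.refl _ _).blockState (by decide)
  refine Run.forUp (N := L.length) (c := 30 * T + 52) (fun j s' => s'.mem = s.mem ∧
      s'.reg 21 = entryAddr L j ∧ s'.reg 25 ≤ T ∧ MaxOf (Prod.snd '' readItems L j 0) (s'.reg 25))
    (by norm_num) (by rw [hf0 5 (by norm_num), h5]) ?_ (fun j hj s' hf hr hI => ?_)
    (fun s' hf hI => ?_) (by
      rw [show 30 * T + 52 + 8 = 30 * T + 60 by ring]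
      omega)
  · simp [blockState, readItems_zero, MaxOf, entryAddr]
  · obtain ⟨i1, i2, i3, i4⟩ := hI
    have hx : L[j] ∈ L := List.getElem_mem hj
    have hadd := entryAddr_succ hj
    have hget := fun r hr => etcInput_getD (L := L) Δ₁ Δ₂ k (j := j) (r := r) hj hr
    have hl2 : s'.mem (entryAddr L j + 2) = L[j].2.2.length := by
      rw [i1, hmem, (hget 2 (by omega)).2]
      simp [entryWords]
    refine Run.block_seq 10 (by decide) (by decide) (b' := 30 * T + 40) (by omega) ?_ ?_
    · simp only [BlockLe, val_load, val_add, val_reg, val_const, i2, hl2]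
      exact ⟨(hlen _ hx).trans hTM, trivial⟩
    set s1 := blockState [(22, load (reg 21 + const 2))] s' with hs1
    have a21 : s1.reg 21 = entryAddr L j := by simp [hs1, blockState, i2]
    have a22 : s1.reg 22 = L[j].2.2.length := by simp [hs1, blockState, i2, hl2]
    have a25 : s1.reg 25 = s'.reg 25 := by simp [hs1, blockState]
    have am : s1.mem = s.mem := by rw [hs1, blockState_mem, i1]
    have hf1 : Frame 21 s' s1 := (Frame.refl _ _).blockState (by decide)
    refine Run.seq_le (b := 30 * T + 10) (b' := 20) (Run.forUp (N := L[j].2.2.length) (c := 20)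
      (fun c s2 => s2.mem = s.mem ∧ s2.reg 25 ≤ T ∧
        MaxOf (Prod.snd '' readItems L j c) (s2.reg 25)) (by norm_num) a22 ?_
      (fun c hc s2 hf2 hr2 hI2 => ?_) (fun s2 hf2 hI2 => ?_) ?_) (by omega)
    · simp only [State.set_reg, State.set_mem, am]
      simpa [a25] using ⟨i3, i4⟩
    · obtain ⟨j1, j2, j3⟩ := hI2
      have ht : L[j].2.2[c] ≤ T := hT _ hx _ (List.getElem_mem hc)
      have hld : s2.mem (entryAddr L j + 3 + c) = L[j].2.2[c] := by
        rw [j1, hmem, add_assoc, (hget (3 + c) (by omega)).2, entryWords,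
          List.getD_append_right _ _ _ _ (by simp)]
        simp [List.getElem?_eq_getElem hc]
      have b21 : s2.reg 21 = entryAddr L j := by rw [hf2 21 (by norm_num), a21]
      refine Run.block_le (by decide) (by decide) ?_
        ⟨(Frame.refl _ _).blockState (by decide), ?_⟩
      · simp only [BlockLe, val_load, val_add, val_sub, val_reg, val_const, b21, hr2, hld]
        exact ⟨by omega, trivial⟩
      · simp only [blockState, val_load, val_add, val_sub, val_reg, val_const, b21, hr2, hld,
          State.set_reg, State.set_mem]
        simp only [Nat.reduceEqDiff, if_true, if_false]
        refine ⟨j1, by omega, ?_⟩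
        rw [readItems_succ hj hc, Set.image_insert_eq]
        exact j3.insert
    · obtain ⟨j1, j2, j3⟩ := hI2
      have b21 : s2.reg 21 = entryAddr L j := by rw [hf2 21 (by norm_num), a21]
      have b22 : s2.reg 22 = L[j].2.2.length := by rw [hf2 22 (by norm_num), a22]
      have hle := (hget (2 + L[j].2.2.length) (by omega)).1
      refine Run.block_le (by decide) (by decide) ?_
        ⟨(hf1.trans (hf2.mono (by omega)) : Frame 21 s' s2).blockState (by decide), ?_⟩
      · simp only [BlockLe, val_add, val_reg, val_const, b21, b22]
        exact ⟨by omega, trivial⟩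
      · simp only [blockState, val_add, val_reg, val_const, b21, b22, State.set_reg, State.set_mem]
        simp only [Nat.reduceEqDiff, if_true, if_false]
        refine ⟨j1, hadd.symm, j2, ?_⟩
        rw [← readItems_length hj]
        exact j3
    · have := hlen _ hx
      omega
  · obtain ⟨i1, i2, i3, i4⟩ := hI
    refine ⟨hf0.trans hf, i1, by rw [i2, entryAddr_length], ?_⟩
    rw [readItems_all] at i4
    convert i4 using 1
    ext t
    simp

/-- The address of the bit for the appearance `t` of an entry. -/
def bitAddr {n : ℕ} (F : ℕ) (p : (Fin n × Fin n × List ℕ) × ℕ) : ℕ :=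
  F + n * p.2 + min (p.1.1 : ℕ) p.1.2.1

open Classical in
/-- The memory holding the input and the bits of the appearances in a set. -/
noncomputable def bitMem {n : ℕ} (L : List (Fin n × Fin n × List ℕ)) (Δ₁ Δ₂ k : ℕ)
    (X : Set ((Fin n × Fin n × List ℕ) × ℕ)) (a : ℕ) : ℕ :=
  if a < (etcInput L Δ₁ Δ₂ k).length then (etcInput L Δ₁ Δ₂ k).getD a 0
  else if a ∈ bitAddr (etcInput L Δ₁ Δ₂ k).length '' X then 1 else 0

/-- Mark the appearances of all edges. -/
def bitmapProg : Program :=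
  .seq (block [(21, const 5)]) (forUp 20 5 (.seq
    (block [(22, load (reg 21 + const 2)),
      (23, load (reg 21) - (load (reg 21) - load (reg 21 + const 1)))])
    (.seq (forUp 24 22
        (.store (reg 7 + reg 1 * load (reg 21 + const 3 + reg 24) + reg 23) (const 1)))
      (block [(21, reg 21 + const 3 + reg 22)]))))

lemma bitmapProg_run {n Δ₁ Δ₂ k T : ℕ} {L : List (Fin n × Fin n × List ℕ)}
    (hlen : ∀ x ∈ L, x.2.2.length ≤ T)
    (h1 : s.reg 1 = n) (h5 : s.reg 5 = L.length)
    (h7 : s.reg 7 = (etcInput L Δ₁ Δ₂ k).length)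
    (hmem : ∀ a, s.mem a = (etcInput L Δ₁ Δ₂ k).getD a 0)
    (hM : (etcInput L Δ₁ Δ₂ k).length + 5 ≤ M) (hTM : T ≤ M) (hnM : n ≤ M) :
    Run w M bitmapProg s (20 + L.length * (30 * T + 80)) fun s' => Frame 20 s s' ∧
      ∀ a, s'.mem a = bitMem L Δ₁ Δ₂ k {p | p.1 ∈ L ∧ p.2 ∈ p.1.2.2} a := by
  refine Run.block_seq 10 (by decide) (by decide) (b' := 10 + L.length * (30 * T + 80)) (by omega)
    ?_ ?_
  · simp [BlockLe]
    omega
  have hf0 : Frame 20 s (blockState [(21, const 5)] s) := (Frame.refl _ _).blockState (by decide)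
  refine Run.forUp (N := L.length) (c := 30 * T + 72) (fun j s' =>
      (∀ a, s'.mem a = bitMem L Δ₁ Δ₂ k (readItems L j 0) a) ∧ s'.reg 21 = entryAddr L j)
    (by norm_num) (by rw [hf0 5 (by norm_num), h5]) ?_ (fun j hj s' hf hr hI => ?_)
    (fun s' hf hI => ?_) (by
      rw [show 30 * T + 72 + 8 = 30 * T + 80 by ring]
      omega)
  · refine ⟨fun a => ?_, by simp [blockState, entryAddr]⟩
    rw [State.set_mem, blockState_mem, hmem, bitMem, readItems_zero]
    split_ifs with h1 h2
    · rfl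
    · simp at h2
    · exact List.getD_eq_default _ _ (by omega)
  · obtain ⟨i1, i2⟩ := hI
    have hx : L[j] ∈ L := List.getElem_mem hj
    have hadd := entryAddr_succ hj
    have hget := fun r hr => etcInput_getD (L := L) Δ₁ Δ₂ k (j := j) (r := r) hj hr
    have hld : ∀ X r, r < 3 + L[j].2.2.length →
        bitMem L Δ₁ Δ₂ k X (entryAddr L j + r) = (entryWords L[j]).getD r 0 := by
      intro X r hr
      rw [bitMem, if_pos (hget r hr).1, (hget r hr).2]
    have hl0 : s'.mem (entryAddr L j) = L[j].1 := by
      have := hld (readItems L j 0) 0 (by omega)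
      rw [add_zero] at this
      rw [i1, this]
      simp [entryWords]
    have hl1 : s'.mem (entryAddr L j + 1) = L[j].2.1 := by
      rw [i1, hld _ 1 (by omega)]
      simp [entryWords]
    have hl2 : s'.mem (entryAddr L j + 2) = L[j].2.2.length := by
      rw [i1, hld _ 2 (by omega)]
      simp [entryWords]
    -- The endpoints come in either order; a double truncated subtraction finds the smaller one,
    -- which indexes the path edge.
    have hmin : (L[j].1 : ℕ) - ((L[j].1 : ℕ) - (L[j].2.1 : ℕ)) = min (L[j].1 : ℕ) L[j].2.1 := by
      omega
    refine Run.block_seq 30 (by decide) (by decide) (b' := 30 * T + 40) (by omega) ?_ ?_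
    · simp only [BlockLe, val_load, val_add, val_sub, val_reg, val_const, State.set_reg,
        State.set_mem, i2, hl2]
      simp only [Nat.reduceEqDiff, if_false, hl0, hl1]
      have := L[j].1.2
      exact ⟨(hlen _ hx).trans hTM, by omega, trivial⟩
    set s1 := blockState [(22, load (reg 21 + const 2)),
      (23, load (reg 21) - (load (reg 21) - load (reg 21 + const 1)))] s' with hs1
    have a21 : s1.reg 21 = entryAddr L j := by simp [hs1, blockState, i2]
    have a22 : s1.reg 22 = L[j].2.2.length := by simp [hs1, blockState, i2, hl2]
    have a23 : s1.reg 23 = min (L[j].1 : ℕ) L[j].2.1 := by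
      rw [← hmin]
      simp [hs1, blockState, i2, hl0, hl1]
    have am : s1.mem = s'.mem := by rw [hs1, blockState_mem]
    have hf1 : Frame 21 s' s1 := (Frame.refl _ _).blockState (by decide)
    have hfs : Frame 20 s s1 := hf0.trans (hf.trans (hf1.mono (by omega)))
    refine Run.seq_le (b := 30 * T + 10) (b' := 20) (Run.forUp (N := L[j].2.2.length) (c := 22)
      (fun c s2 => ∀ a, s2.mem a = bitMem L Δ₁ Δ₂ k (readItems L j c) a) (by norm_num) a22 ?_
      (fun c hc s2 hf2 hr2 hI2 => ?_) (fun s2 hf2 hI2 => ?_) ?_) (by omega)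
    · intro a
      rw [State.set_mem, am, i1]
    · have hld : s2.mem (entryAddr L j + 3 + c) = L[j].2.2[c] := by
        rw [hI2, add_assoc, hld _ (3 + c) (by omega), entryWords,
          List.getD_append_right _ _ _ _ (by simp)]
        simp [List.getElem?_eq_getElem hc]
      have b1 : s2.reg 1 = n := by rw [hf2 1 (by norm_num), hfs 1 (by norm_num), h1]
      have b7 : s2.reg 7 = (etcInput L Δ₁ Δ₂ k).length := by
        rw [hf2 7 (by norm_num), hfs 7 (by norm_num), h7]
      have b21 : s2.reg 21 = entryAddr L j := by rw [hf2 21 (by norm_num), a21]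
      have b23 : s2.reg 23 = min (L[j].1 : ℕ) L[j].2.1 := by rw [hf2 23 (by norm_num), a23]
      refine (Run.store (by decide) (by decide) ?_ ⟨Frame.refl _ _, ?_⟩).mono (b := _) (by decide)
        fun _ h => h
      · simp only [val_const]
        omega
      · intro a
        simp only [State.set_mem, State.put_mem, val_add, val_mul, val_load, val_reg, val_const,
          b1, b7, b21, b23, hr2, hld]
        rw [readItems_succ hj hc, bitMem, Set.image_insert_eq, Set.mem_insert_iff, hI2, bitMem]
        have hA : bitAddr (etcInput L Δ₁ Δ₂ k).length (L[j], L[j].2.2[c]) =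
            (etcInput L Δ₁ Δ₂ k).length + n * L[j].2.2[c] + min (L[j].1 : ℕ) L[j].2.1 := rfl
        rw [← hA]
        have hge : ¬ bitAddr (etcInput L Δ₁ Δ₂ k).length (L[j], L[j].2.2[c]) <
            (etcInput L Δ₁ Δ₂ k).length := by rw [hA]; omega
        by_cases ha : a = bitAddr (etcInput L Δ₁ Δ₂ k).length (L[j], L[j].2.2[c])
        · rw [if_pos ha, if_neg (ha ▸ hge), if_pos (Or.inl ha)]
        · rw [if_neg ha]
          split_ifs with h3 h4 h5 h6
          · rfl
          · rfl
          · exact absurd (Or.inr h4) h5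
          · exact absurd (h6.resolve_left ha) h4
          · rfl
    · have b21 : s2.reg 21 = entryAddr L j := by rw [hf2 21 (by norm_num), a21]
      have b22 : s2.reg 22 = L[j].2.2.length := by rw [hf2 22 (by norm_num), a22]
      have hle := (hget (2 + L[j].2.2.length) (by omega)).1
      refine Run.block_le (by decide) (by decide) ?_
        ⟨(hf1.trans (hf2.mono (by omega)) : Frame 21 s' s2).blockState (by decide), ?_⟩
      · simp only [BlockLe, val_add, val_reg, val_const, b21, b22]
        exact ⟨by omega, trivial⟩
      · simp only [blockState, val_add, val_reg, val_const, b21, b22, State.set_reg, State.set_mem]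
        simp only [Nat.reduceEqDiff, if_true, if_false]
        refine ⟨?_, hadd.symm⟩
        rw [← readItems_length hj]
        exact hI2
    · have := hlen _ hx
      omega
  · obtain ⟨i1, i2⟩ := hI
    refine ⟨hf0.trans hf, fun a => ?_⟩
    rw [i1, readItems_all]

end WordRAM

/-! ## Temporal graphs over a path -/

namespace TemporalGraph

variable {n : ℕ} {G : TemporalGraph (Fin n)} {L : List (Fin n × Fin n × List ℕ)}

lemma mem_pathTimes_bounds {i t : ℕ} (ht : t ∈ G.pathTimes i) : 1 ≤ t ∧ t ≤ G.lifetime := by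
  unfold pathTimes pairTimes at ht
  split_ifs at ht
  · exact ⟨G.times_pos _ _ ht, G.le_lifetime ht⟩
  · simp at ht

lemma pathTimes_nonempty (hG : G.graph = SimpleGraph.pathGraph n) {i : ℕ} (hi : i + 1 < n) :
    (G.pathTimes i).Nonempty := by
  rw [pathTimes, pairTimes, dif_pos ⟨by omega, hi⟩, times_nonempty_iff, hG, SimpleGraph.mem_edgeSet,
    SimpleGraph.pathGraph_adj]
  exact Or.inl rfl

lemma pathTimes_eq_empty {i : ℕ} (hi : n ≤ i + 1) : G.pathTimes i = ∅ := by
  rw [pathTimes, pairTimes, dif_neg (by omega)]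

lemma lifetime_pos (hG : G.graph = SimpleGraph.pathGraph n) (hn : 2 ≤ n) : 0 < G.lifetime := by
  obtain ⟨t, ht⟩ := pathTimes_nonempty hG (i := 0) (by omega)
  have := mem_pathTimes_bounds ht
  omega

lemma card_pathTimes_le (G : TemporalGraph (Fin n)) (i : ℕ) :
    (G.pathTimes i).card ≤ G.lifetime := by
  calc (G.pathTimes i).card ≤ (Finset.Icc 1 G.lifetime).card :=
        Finset.card_le_card fun t ht => Finset.mem_Icc.mpr (mem_pathTimes_bounds ht)
    _ = G.lifetime := by simp

lemma IsListing.adj (hL : G.IsListing L) (hG : G.graph = SimpleGraph.pathGraph n)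
    {x : Fin n × Fin n × List ℕ} (hx : x ∈ L) :
    (x.1 : ℕ) + 1 = x.2.1 ∨ (x.2.1 : ℕ) + 1 = x.1 := by
  have h := (hL.2.1 s(x.1, x.2.1)).mp (List.mem_map.mpr ⟨x, hx, rfl⟩)
  rwa [hG, SimpleGraph.mem_edgeSet, SimpleGraph.pathGraph_adj] at h

lemma IsListing.min_lt (hL : G.IsListing L) (hG : G.graph = SimpleGraph.pathGraph n)
    {x : Fin n × Fin n × List ℕ} (hx : x ∈ L) : min (x.1 : ℕ) x.2.1 < n - 1 := by
  have := hL.adj hG hx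
  have := x.1.2
  have := x.2.1.2
  omega

lemma IsListing.times_eq (hL : G.IsListing L) (hG : G.graph = SimpleGraph.pathGraph n)
    {x : Fin n × Fin n × List ℕ} (hx : x ∈ L) :
    x.2.2.toFinset = G.pathTimes (min (x.1 : ℕ) x.2.1) := by
  ext t
  rw [List.mem_toFinset, (hL.2.2 x hx).2 t, ← pairTimes_fin, pathTimes]
  rcases hL.adj hG hx with h | h
  · rw [min_eq_left (by omega), h]
  · rw [min_eq_right (by omega), h, pairTimes_comm]

lemma IsListing.length_times (hL : G.IsListing L) (hG : G.graph = SimpleGraph.pathGraph n)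
    {x : Fin n × Fin n × List ℕ} (hx : x ∈ L) :
    x.2.2.length = (G.pathTimes (min (x.1 : ℕ) x.2.1)).card := by
  rw [← hL.times_eq hG hx, List.toFinset_card_of_nodup (hL.2.2 x hx).1]

lemma IsListing.exists_entry (hL : G.IsListing L) (hG : G.graph = SimpleGraph.pathGraph n)
    {i : ℕ} (hi : i + 1 < n) : ∃ x ∈ L, min (x.1 : ℕ) x.2.1 = i := by
  have h : s((⟨i, by omega⟩ : Fin n), (⟨i + 1, hi⟩ : Fin n)) ∈ G.graph.edgeSet := by
    rw [hG, SimpleGraph.mem_edgeSet, SimpleGraph.pathGraph_adj]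
    exact Or.inl rfl
  obtain ⟨x, hx, he⟩ := List.mem_map.mp ((hL.2.1 _).mpr h)
  refine ⟨x, hx, ?_⟩
  rcases Sym2.eq_iff.mp he with ⟨h1, h2⟩ | ⟨h1, h2⟩ <;> rw [h1, h2] <;> simp

/-- A path edge is determined by its smaller endpoint, so the entries correspond to the numbers
below `n - 1`. -/
lemma IsListing.length_eq (hL : G.IsListing L) (hG : G.graph = SimpleGraph.pathGraph n) :
    L.length = n - 1 := by
  have hnd : (L.map fun x => min (x.1 : ℕ) x.2.1).Nodup := by
    have h1 := hL.1
    have h2 := h1.of_map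
    rw [List.nodup_map_iff_inj_on h2] at h1 ⊢
    intro x hx y hy hxy
    refine h1 x hx y hy ?_
    have a := hL.adj hG hx
    have b := hL.adj hG hy
    rw [Sym2.eq_iff, Fin.ext_iff, Fin.ext_iff, Fin.ext_iff, Fin.ext_iff]
    omega
  rw [← List.length_map (f := fun x : Fin n × Fin n × List ℕ => min (x.1 : ℕ) x.2.1),
    ← List.toFinset_card_of_nodup hnd, ← Finset.card_range (n - 1)]
  congr 1
  ext i
  rw [List.mem_toFinset, List.mem_map, Finset.mem_range]
  constructor
  · rintro ⟨x, hx, rfl⟩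
    exact hL.min_lt hG hx
  · intro hi
    obtain ⟨x, hx, h⟩ := hL.exists_entry hG (i := i) (by omega)
    exact ⟨x, hx, h⟩

lemma IsListing.mem_pathTimes_iff (hL : G.IsListing L) (hG : G.graph = SimpleGraph.pathGraph n)
    {i t : ℕ} : t ∈ G.pathTimes i ↔ ∃ x ∈ L, min (x.1 : ℕ) x.2.1 = i ∧ t ∈ x.2.2 := by
  constructor
  · intro ht
    have hi : i + 1 < n := by
      by_contra hi
      rw [pathTimes_eq_empty (by omega)] at ht
      simp at ht
    obtain ⟨x, hx, rfl⟩ := hL.exists_entry hG hi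
    rw [← hL.times_eq hG hx, List.mem_toFinset] at ht
    exact ⟨x, hx, rfl, ht⟩
  · rintro ⟨x, hx, rfl, ht⟩
    rwa [← hL.times_eq hG hx, List.mem_toFinset]

lemma IsListing.lifetime_eq (hL : G.IsListing L) {v : ℕ}
    (hv : MaxOf {t | ∃ x ∈ L, t ∈ x.2.2} v) : v = G.lifetime := by
  obtain ⟨h1, h2⟩ := hv
  apply le_antisymm
  · rcases h2 with rfl | ⟨x, hx, hv⟩
    · exact Nat.zero_le _
    · exact G.le_lifetime (((hL.2.2 x hx).2 v).mp hv)
  · refine Finset.sup_le fun e _ => Finset.sup_le fun t ht => h1 t ?_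
    obtain ⟨x, hx, rfl⟩ := List.mem_map.mp
      ((hL.2.1 e).mpr ((G.times_nonempty_iff e).mp ⟨t, ht⟩))
    exact ⟨x, hx, ((hL.2.2 x hx).2 t).mpr ht⟩

/-- As the edge indices are below `n`, quotient and remainder by `n` recover the time and the edge
from an address: bits do not collide. -/
lemma IsListing.bitMem_edge (hL : G.IsListing L) (hG : G.graph = SimpleGraph.pathGraph n)
    (Δ₁ Δ₂ k : ℕ) {i : ℕ} (hi : i < n - 1) (t : ℕ) :
    WordRAM.bitMem L Δ₁ Δ₂ k {p | p.1 ∈ L ∧ p.2 ∈ p.1.2.2} ((etcInput L Δ₁ Δ₂ k).length + n * t + i) =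
      if t ∈ G.pathTimes i then 1 else 0 := by
  rw [WordRAM.bitMem, if_neg (by omega)]
  have key : (etcInput L Δ₁ Δ₂ k).length + n * t + i ∈ WordRAM.bitAddr (etcInput L Δ₁ Δ₂ k).length ''
      {p | p.1 ∈ L ∧ p.2 ∈ p.1.2.2} ↔ t ∈ G.pathTimes i := by
    rw [hL.mem_pathTimes_iff hG]
    constructor
    · rintro ⟨⟨x, t'⟩, ⟨hx, ht'⟩, he⟩
      simp only at hx ht'
      have hm := hL.min_lt hG hx
      have he' : min (x.1 : ℕ) x.2.1 + n * t' = i + n * t := by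
        simp only [WordRAM.bitAddr] at he
        omega
      have h1 := congrArg (· % n) he'
      have h2 := congrArg (· / n) he'
      simp only [Nat.add_mul_mod_self_left] at h1
      rw [Nat.mod_eq_of_lt (by omega), Nat.mod_eq_of_lt (by omega)] at h1
      simp only [Nat.add_mul_div_left _ _ (show 0 < n by omega)] at h2
      rw [Nat.div_eq_of_lt (by omega), Nat.div_eq_of_lt (by omega), zero_add, zero_add] at h2
      exact ⟨x, hx, h1, h2 ▸ ht'⟩
    · rintro ⟨x, hx, rfl, ht⟩
      exact ⟨(x, t), ⟨hx, ht⟩, rfl⟩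
  by_cases h : t ∈ G.pathTimes i
  · rw [if_pos (key.mpr h), if_pos h]
  · rw [if_neg (mt key.mp h), if_neg h]

/-- The bitmap ends before this address, so the table that follows it starts with zeros. -/
lemma IsListing.bitMem_beyond (hL : G.IsListing L) (hG : G.graph = SimpleGraph.pathGraph n)
    (Δ₁ Δ₂ k : ℕ) {a : ℕ} (ha : (etcInput L Δ₁ Δ₂ k).length + n * (G.lifetime + 1) ≤ a) :
    WordRAM.bitMem L Δ₁ Δ₂ k {p | p.1 ∈ L ∧ p.2 ∈ p.1.2.2} a = 0 := by
  rw [WordRAM.bitMem, if_neg (by omega), if_neg]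
  rintro ⟨⟨x, t⟩, ⟨hx, ht⟩, rfl⟩
  simp only at hx ht
  have hm := hL.min_lt hG hx
  have ht' : t ≤ G.lifetime := G.le_lifetime (((hL.2.2 x hx).2 t).mp ht)
  have := Nat.mul_le_mul_left n ht'
  simp only [WordRAM.bitAddr, Nat.mul_succ] at ha
  omega

lemma IsListing.length_input_le (hL : G.IsListing L) (hG : G.graph = SimpleGraph.pathGraph n)
    (Δ₁ Δ₂ k : ℕ) : (etcInput L Δ₁ Δ₂ k).length ≤ 5 + n * (3 + G.lifetime) := by
  have h : (L.flatMap entryWords).length ≤ L.length * (3 + G.lifetime) := by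
    rw [List.length_flatMap]
    refine (List.sum_le_card_nsmul _ (3 + G.lifetime) ?_).trans (by simp)
    intro v hv
    obtain ⟨x, hx, rfl⟩ := List.mem_map.mp hv
    rw [length_entryWords, hL.length_times hG hx]
    have := card_pathTimes_le G (min (x.1 : ℕ) x.2.1)
    omega
  rw [hL.length_eq hG] at h
  have h' := Nat.mul_le_mul_right (3 + G.lifetime) (Nat.sub_le n 1)
  rw [etcInput_eq, List.length_append]
  simp only [List.length_cons, List.length_nil]
  omega

/-- With sufficiently long words, this shows that the initial reduction modulo `2 ^ w` leaves the
input unchanged. -/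
lemma IsListing.input_le (hL : G.IsListing L) (hG : G.graph = SimpleGraph.pathGraph n)
    {Δ₁ Δ₂ k V : ℕ} (hV : n + G.lifetime + k + Δ₁ + Δ₂ ≤ V) (a : ℕ) :
    (etcInput L Δ₁ Δ₂ k).getD a 0 ≤ V := by
  have key : ∀ v ∈ etcInput L Δ₁ Δ₂ k, v ≤ V := by
    intro v hv
    rw [etcInput_eq, List.mem_append, List.mem_flatMap] at hv
    rcases hv with hv | ⟨x, hx, hv⟩
    · have := hL.length_eq hG
      simp only [List.mem_cons, List.not_mem_nil, or_false] at hv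
      omega
    · have h1 := x.1.2
      have h2 := x.2.1.2
      have h3 := hL.length_times hG hx
      have h4 := card_pathTimes_le G (min (x.1 : ℕ) x.2.1)
      rw [entryWords, List.mem_append] at hv
      rcases hv with hv | hv
      · simp only [List.mem_cons, List.not_mem_nil, or_false] at hv
        omega
      · have := G.le_lifetime (((hL.2.2 x hx).2 v).mp hv)
        omega
  rw [List.getD_eq_getElem?_getD]
  rcases h : (etcInput L Δ₁ Δ₂ k)[a]? with _ | v
  · simp
  · exact key v (List.mem_of_getElem? h)

end TemporalGraph

/-! ## The remaining parts of the program -/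

namespace WordRAM

open WordRAM.Expr

variable {w M : ℕ} {s : State}

/-- Compute the largest number of times of an edge in register 21. -/
def maxCardProg : Program :=
  .seq (block [(21, const 0)]) (forUp 20 5 (.seq (block [(40, const 1), (41, reg 6)])
    (.seq scanProg (block [(21, reg 21 + (reg 43 - reg 21))]))))

lemma maxCardProg_run {n Δ N T F : ℕ} {P : ℕ → Finset ℕ} (hΔ : 0 < Δ)
    (h1 : s.reg 1 = n) (h2 : s.reg 2 = Δ) (h5 : s.reg 5 = N) (h6 : s.reg 6 = T)
    (h7 : s.reg 7 = F) (hP : ∀ i, ∀ t ∈ P i, 1 ≤ t ∧ t ≤ T)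
    (hmem : ∀ i < N, ∀ t ≤ T, s.mem (F + n * t + i) = if t ∈ P i then 1 else 0)
    (hM : 1 ≤ M) :
    Run w M maxCardProg s (20 + N * (50 * T + 60)) fun s' => Frame 20 s s' ∧ s'.mem = s.mem ∧
      s'.reg 21 = (Finset.range N).sup fun i => (P i).card := by
  refine Run.of_bounded fun hs => ?_
  have hTM : T ≤ M := h6 ▸ hs.1 6
  refine Run.block_seq 10 (by decide) (by decide) (b' := 10 + N * (50 * T + 60)) (by omega)
    (by simp [BlockLe]) ?_
  have hf0 : Frame 20 s (blockState [(21, const 0)] s) := (Frame.refl _ _).blockState (by decide)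
  refine Run.forUp (N := N) (c := 50 * T + 50) (fun i s' => s'.mem = s.mem ∧
      s'.reg 21 = (Finset.range i).sup fun i => (P i).card) (by norm_num)
    (by rw [hf0 5 (by norm_num), h5]) (by simp [blockState]) (fun i hi s' hf hr hI => ?_)
    (fun s' hf hI => ⟨hf0.trans hf, hI⟩) ?_
  · obtain ⟨i1, i2⟩ := hI
    have hfs := hf0.trans hf
    refine Run.block_seq 10 (by decide) (by decide) (b' := 50 * T + 40) (by omega) ?_ ?_
    · simp only [BlockLe, val_const, val_reg, State.set_reg]
      simp only [Nat.reduceEqDiff, if_false, hfs 6 (by norm_num), h6]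
      exact ⟨hM, hTM, trivial⟩
    set s1 := blockState [(40, const 1), (41, reg 6)] s' with hs1
    have hf1 : Frame 40 s' s1 := (Frame.refl _ _).blockState (by decide)
    have hfs1 : Frame 20 s s1 := hfs.trans (hf1.mono (by omega))
    have am : s1.mem = s.mem := by rw [hs1, blockState_mem, i1]
    refine Run.seq_le (b := 50 * T + 20) (b' := 20) (Run.mono
      (scanProg_run (n := n) (Δ := Δ) (F := F) (i := i) (a := 1) (l := T) (P := P i) hΔ
        (by rw [hfs1 1 (by norm_num), h1]) (by rw [hfs1 2 (by norm_num), h2])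
        (by rw [hfs1 7 (by norm_num), h7]) (by rw [hf1 20 (by norm_num), hr])
        (by simp [hs1, blockState])
        (by simp [hs1, blockState, hfs 6 (by norm_num), h6])
        (fun t _ ht => by rw [am]; exact hmem i hi t (by omega))) le_rfl
      fun s2 hs2 => Run.of_bounded fun hb2 => ?_) (by omega)
    obtain ⟨hf2, m2, c2, -⟩ := hs2
    rw [keepCount_eq_card (hP i)] at c2
    have b21 : s2.reg 21 = (Finset.range i).sup fun i => (P i).card := by
      rw [hf2 21 (by norm_num), hf1 21 (by norm_num), i2]
    have e1 := hb2.1 21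
    have e2 := hb2.1 43
    refine Run.block_le (by decide) (by decide) ?_
      ⟨((hf1.mono (by omega)).trans (hf2.mono (by omega)) : Frame 21 s' s2).blockState (by decide),
        ?_⟩
    · simp only [BlockLe, val_add, val_sub, val_reg]
      exact ⟨by omega, trivial⟩
    · refine ⟨by rw [State.set_mem, blockState_mem, m2, am], ?_⟩
      rw [Finset.range_add_one, Finset.sup_insert, ← b21, ← c2]
      simp only [blockState, val_add, val_sub, val_reg, State.set_reg]
      simp
      omega
  · rw [show 50 * T + 50 + 8 = 50 * T + 58 by ring]
    have : N * (50 * T + 58) ≤ N * (50 * T + 60) := Nat.mul_le_mul_left _ (by omega)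
    omega

/-- Compute the number of row codes, the parameters of the main loop and the first table entry. -/
def setupProg : Program :=
  .seq (block [(8, reg 21), (9, reg 6 * reg 6 * reg 1), (22, const 1)])
    (.seq (forUp 20 8 (block [(22, reg 22 * reg 9)]))
      (.seq (block [(10, reg 22), (11, reg 7 + reg 1 * (reg 6 + const 1))])
        (.store (reg 11) (reg 4 + const 1))))

lemma setupProg_run {n Δ₁ Δ₂ k T F m : ℕ} (hn : 0 < n) (hT : 0 < T)
    (h1 : s.reg 1 = n) (h2 : s.reg 2 = Δ₁) (h3 : s.reg 3 = Δ₂) (h4 : s.reg 4 = k)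
    (h5 : s.reg 5 = n - 1) (h6 : s.reg 6 = T) (h7 : s.reg 7 = F) (h21 : s.reg 21 = m)
    (hB : T * T * n ≤ M) (hS : (T * T * n) ^ m ≤ M) (hD : F + n * (T + 1) ≤ M) (hk : k + 1 ≤ M) :
    Run w M setupProg s (60 + m * 20) fun s' =>
      Params n Δ₁ Δ₂ k T F m ((T * T * n) ^ m) (F + n * (T + 1)) s' ∧
        s'.mem = Function.update s.mem (F + n * (T + 1)) (k + 1) := by
  refine Run.of_bounded fun hs => ?_
  have hmM : m ≤ M := h21 ▸ hs.1 21
  have hpos : 0 < T * T * n := by positivity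
  refine Run.block_seq 20 (by decide) (by decide) (b' := 40 + m * 20) (by omega) ?_ ?_
  · simp only [BlockLe, val_const, val_reg, val_mul, State.set_reg]
    simp only [Nat.reduceEqDiff, if_false, h21, h6, h1]
    exact ⟨hmM, hB, by omega, trivial⟩
  set s1 := blockState [(8, reg 21), (9, reg 6 * reg 6 * reg 1), (22, const 1)] s with hs1
  have hf1 : Frame 8 s s1 := (Frame.refl _ _).blockState (by decide)
  have a8 : s1.reg 8 = m := by simp [hs1, blockState, h21]
  have a9 : s1.reg 9 = T * T * n := by simp [hs1, blockState, h6, h1]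
  have am : s1.mem = s.mem := by rw [hs1, blockState_mem]
  refine Run.seq_le (b := 6 + m * 20) (b' := 34) (Run.forUp (N := m) (c := 12)
    (fun j s' => s'.mem = s.mem ∧ s'.reg 22 = (T * T * n) ^ j) (by norm_num) a8
    (by simp [hs1, blockState]) (fun j hj s' hf hr hI => ?_) (fun s2 hf2 hI2 => ?_)
    (by omega)) (by omega)
  · obtain ⟨i1, i2⟩ := hI
    have b9 : s'.reg 9 = T * T * n := by rw [hf 9 (by norm_num), a9]
    refine Run.block_le (by decide) (by decide) ?_ ⟨(Frame.refl _ _).blockState (by decide), ?_⟩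
    · simp only [BlockLe, val_mul, val_reg, i2, b9, ← pow_succ]
      exact ⟨(Nat.pow_le_pow_right hpos hj).trans hS, trivial⟩
    · simp [blockState, i1, i2, b9, pow_succ]
  obtain ⟨m2, c2⟩ := hI2
  have hfs : Frame 8 s s2 := hf1.trans (hf2.mono (by omega))
  refine Run.block_seq 20 (by decide) (by decide) (b' := 14) (by omega) ?_ ?_
  · simp only [BlockLe, val_const, val_reg, val_mul, val_add, State.set_reg]
    simp only [Nat.reduceEqDiff, if_false, hfs 1 (by norm_num), hfs 6 (by norm_num),
      hfs 7 (by norm_num), h1, h6, h7, c2]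
    exact ⟨hS, hD, trivial⟩
  set s3 := blockState [(10, reg 22), (11, reg 7 + reg 1 * (reg 6 + const 1))] s2 with hs3
  have hf3 : Frame 10 s2 s3 := (Frame.refl _ _).blockState (by decide)
  have hfs3 : Frame 8 s s3 := hfs.trans (hf3.mono (by omega))
  have am3 : s3.mem = s.mem := by rw [hs3, blockState_mem, m2]
  have b4 : s3.reg 4 = k := by rw [hfs3 4 (by norm_num), h4]
  have b11 : s3.reg 11 = F + n * (T + 1) := by
    simp [hs3, blockState, hfs 1 (by norm_num), hfs 6 (by norm_num), hfs 7 (by norm_num), h1, h6,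
      h7]
  refine (Run.store (by decide) (by decide) ?_ ⟨?_, ?_⟩).mono (b := _) (by decide) fun _ h => h
  · simpa [b4] using hk
  · constructor
    · rw [State.put_reg, hfs3 1 (by norm_num), h1]
    · rw [State.put_reg, hfs3 2 (by norm_num), h2]
    · rw [State.put_reg, hfs3 3 (by norm_num), h3]
    · rw [State.put_reg, hfs3 4 (by norm_num), h4]
    · rw [State.put_reg, hfs3 5 (by norm_num), h5]
    · rw [State.put_reg, hfs3 6 (by norm_num), h6]
    · rw [State.put_reg, hfs3 7 (by norm_num), h7]
    · rw [State.put_reg, hf3 8 (by norm_num), hf2 8 (by norm_num), a8]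
    · rw [State.put_reg, hf3 9 (by norm_num), hf2 9 (by norm_num), a9]
    · simp [hs3, blockState, c2]
    · exact b11
  · simp [State.put, b4, b11, am3]

/-- Search the last row of the table for a nonzero entry. -/
def answerProg : Program :=
  .seq (block [(21, const 0)]) (.seq
    (forUp 20 10 (block
      [(21, reg 21 + less (const 0) (load (reg 11 + reg 5 * reg 10 + reg 20)))]))
    (block [(0, less (const 0) (reg 21))]))

open Classical in
lemma answerProg_run {N S D : ℕ} (h5 : s.reg 5 = N) (h10 : s.reg 10 = S) (h11 : s.reg 11 = D)
    (hM : 1 ≤ M) :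
    Run w M answerProg s (40 + S * 40) fun s' =>
      s'.reg 0 = if ∃ y < S, 0 < s.mem (D + N * S + y) then 1 else 0 := by
  refine Run.of_bounded fun hs => ?_
  have hSM : S ≤ M := h10 ▸ hs.1 10
  refine Run.block_seq 10 (by decide) (by decide) (b' := 30 + S * 40) (by omega)
    (by simp [BlockLe]) ?_
  have hf0 : Frame 20 s (blockState [(21, const 0)] s) := (Frame.refl _ _).blockState (by decide)
  refine Run.seq_le (b := 6 + S * 40) (b' := 20) (Run.forUp (N := S) (c := 32)
    (fun j s' => s'.mem = s.mem ∧ s'.reg 21 ≤ j ∧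
      (0 < s'.reg 21 ↔ ∃ y < j, 0 < s.mem (D + N * S + y))) (by norm_num)
    (by rw [hf0 10 (by norm_num), h10]) (by simp [blockState]) (fun j hj s' hf hr hI => ?_)
    (fun s2 hf2 hI2 => ?_) (by omega)) (by omega)
  · obtain ⟨i1, i2, i3⟩ := hI
    have hfs := hf0.trans hf
    have b5 : s'.reg 5 = N := by rw [hfs 5 (by norm_num), h5]
    have b10 : s'.reg 10 = S := by rw [hfs 10 (by norm_num), h10]
    have b11 : s'.reg 11 = D := by rw [hfs 11 (by norm_num), h11]
    have hval : (reg 21 + less (const 0) (load (reg 11 + reg 5 * reg 10 + reg 20))).val s' =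
        s'.reg 21 + if 0 < s.mem (D + N * S + j) then 1 else 0 := by
      simp only [val_add, val_lt, val_load, val_mul, val_reg, val_const, b5, b10, b11, hr, i1]
    have hle : (if 0 < s.mem (D + N * S + j) then 1 else 0) ≤ 1 := by split_ifs <;> omega
    refine Run.block_le (by decide) (by decide) ?_ ⟨(Frame.refl _ _).blockState (by decide), ?_⟩
    · simp only [BlockLe, hval]
      exact ⟨by omega, trivial⟩
    · refine ⟨by rw [State.set_mem, blockState_mem, i1], ?_⟩
      simp only [blockState, hval, State.set_reg]
      simp only [Nat.reduceEqDiff, if_false, if_true]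
      refine ⟨by omega, ?_⟩
      constructor
      · intro h
        by_cases h0 : 0 < s.mem (D + N * S + j)
        · exact ⟨j, by omega, h0⟩
        · rw [if_neg h0, add_zero] at h
          obtain ⟨y, hy, h'⟩ := i3.mp h
          exact ⟨y, by omega, h'⟩
      · rintro ⟨y, hy, h'⟩
        rcases Nat.lt_succ_iff_lt_or_eq.mp hy with hy | rfl
        · have := i3.mpr ⟨y, hy, h'⟩
          omega
        · rw [if_pos h']
          omega
  · refine Run.block_le (by decide) (by decide) ?_ ?_
    · simp only [BlockLe, val_lt, val_const, val_reg]
      exact ⟨by split_ifs <;> omega, trivial⟩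
    · simp only [blockState, val_lt, val_const, val_reg, State.set_reg, if_true]
      by_cases h : 0 < s2.reg 21
      · rw [if_pos h, if_pos (hI2.2.2.mp h)]
      · rw [if_neg h, if_neg (mt hI2.2.2.mpr h)]

end WordRAM

/-! ## The whole program -/

lemma rowGain_le_mul (T B m i : ℕ) (P : Finset ℕ) (y : ℕ) :
    rowGain T B m i P y ≤ m * P.card := by
  refine (Finset.sum_le_card_nsmul _ _ P.card fun q _ => ?_).trans (by simp)
  split_ifs
  · exact Finset.card_le_card Finset.inter_subset_left
  · exact Nat.zero_le _

lemma addCost_le_succ (Δ : ℕ) (P : Finset ℕ) (a l : ℕ) : addCost Δ P a l ≤ l + 1 := by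
  have := greedyScan_fst_le_self Δ P a l
  unfold addCost
  split_ifs <;> omega

lemma rowLoss_le_mul {T : ℕ} (hT : 0 < T) (Δ₁ B m i : ℕ) (P : Finset ℕ) (y : ℕ) :
    rowLoss Δ₁ T B m i P y ≤ m * ((T + 1) + i * (T + 1)) := by
  refine (Finset.sum_le_card_nsmul _ _ ((T + 1) + i * (T + 1)) fun q _ => ?_).trans (by simp)
  split_ifs
  · have h : ∀ P : Finset ℕ, addCost Δ₁ P (decode T (digit B y q)).2.1
        ((decode T (digit B y q)).2.2 + 1 - (decode T (digit B y q)).2.1) ≤ T + 1 := by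
      intro P
      refine (addCost_le_succ _ _ _ _).trans ?_
      have := Nat.mod_lt (digit B y q / T) hT
      simp only [decode]
      omega
    exact Nat.add_le_add (h P) (Nat.mul_le_mul (Nat.sub_le _ _) (h ∅))
  · exact Nat.zero_le _

namespace WordRAM

open WordRAM.Expr

variable {w M : ℕ} {s : State}

/-- The program deciding ETC on paths. -/
def etcProg : Program :=
  .seq (block [(1, load (const 0)), (5, load (const 1)), (2, load (const 2)), (3, load (const 3)),
    (4, load (const 4))]) (.seq lifetimeProg (.seq (block [(6, reg 25), (7, reg 21)])
    (.seq bitmapProg (.seq maxCardProg (.seq setupProg (.seq dpProg answerProg))))))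

open Classical in
lemma etcProg_run {n Δ₁ Δ₂ k m V c : ℕ} {G : TemporalGraph (Fin n)}
    {L : List (Fin n × Fin n × List ℕ)} (hn : 2 ≤ n) (h1 : 0 < Δ₁) (h12 : Δ₁ < Δ₂)
    (hG : G.graph = SimpleGraph.pathGraph n) (hL : G.IsListing L)
    (hm : m = (Finset.range (n - 1)).sup fun i => (G.pathTimes i).card)
    (hV : n + G.lifetime + k + Δ₁ + Δ₂ ≤ V) (hVM : V ^ 4 ≤ M)
    (hSM : (G.lifetime * G.lifetime * n) ^ m ≤ M)
    (hmem : ∀ a, s.mem a = (etcInput L Δ₁ Δ₂ k).getD a 0)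
    (hc : 20 + (20 + (n - 1) * (30 * G.lifetime + 60) + (10 +
      (20 + (n - 1) * (30 * G.lifetime + 80) + (20 + (n - 1) * (50 * G.lifetime + 60) +
      (60 + m * 20 + ((n - 1) * ((G.lifetime * G.lifetime * n) ^ m *
        ((G.lifetime * G.lifetime * n) ^ m * (m * (m * 400 + 300) + 130) +
          (m + 1) * (50 * G.lifetime + 240) + 20) + 20) + 6 +
      (40 + (G.lifetime * G.lifetime * n) ^ m * 40))))))) ≤ c) :
    Run w M etcProg s c fun s' => s'.reg 0 = if G.ETC Δ₁ Δ₂ k then 1 else 0 := by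
  refine Run.mono ?_ hc fun _ h => h
  have hTpos := G.lifetime_pos hG hn
  have hmi : ∀ i, (G.pathTimes i).card ≤ m := by
    intro i
    by_cases hi : i < n - 1
    · rw [hm]
      exact Finset.le_sup (f := fun i => (G.pathTimes i).card) (Finset.mem_range.mpr hi)
    · rw [G.pathTimes_eq_empty (by omega)]
      simp
  have hmT : m ≤ G.lifetime := by
    rw [hm]
    exact Finset.sup_le fun i _ => G.card_pathTimes_le i
  rw [G.etc_iff_dpValue hG (by omega) h1 h12 hTpos hmi]
  have hlenL := hL.length_eq hG
  have hlenT : ∀ x ∈ L, x.2.2.length ≤ G.lifetime := fun x hx => by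
    rw [hL.length_times hG hx]
    exact G.card_pathTimes_le _
  have htT : ∀ x ∈ L, ∀ t ∈ x.2.2, t ≤ G.lifetime := fun x hx t ht =>
    G.le_lifetime (((hL.2.2 x hx).2 t).mp ht)
  have hF := hL.length_input_le hG Δ₁ Δ₂ k
  have hlife := fun v => hL.lifetime_eq (v := v)
  have hbounds := fun i => fun t (ht : t ∈ G.pathTimes i) => G.mem_pathTimes_bounds ht
  have hcardT := G.card_pathTimes_le
  have hbit := fun i => hL.bitMem_edge hG Δ₁ Δ₂ k (i := i)
  have hbeyond := fun a => hL.bitMem_beyond hG Δ₁ Δ₂ k (a := a)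
  have hin := hL.input_le hG hV
  generalize G.lifetime = T at *
  set F := (etcInput L Δ₁ Δ₂ k).length with hFdef
  set S := (T * T * n) ^ m with hSdef
  -- From `n ≥ 2`, `T ≥ 1`, `Δ₁ ≥ 1` and `Δ₂ ≥ 2`. Each power of `V` then absorbs six times the
  -- preceding one, so all the polynomial bounds fit below `V ^ 4`.
  have hV6 : 6 ≤ V := by omega
  have hnV : n ≤ V := by omega
  have hTV : T + 4 ≤ V := by omega
  have hmV : m ≤ V := by omega
  have hq : 6 * V ^ 3 ≤ V ^ 4 := by
    rw [pow_succ V 3, mul_comm]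
    exact Nat.mul_le_mul_left _ hV6
  have hq2 : 6 * V ^ 2 ≤ V ^ 3 := by
    rw [pow_succ V 2, mul_comm]
    exact Nat.mul_le_mul_left _ hV6
  have hq1 : 6 * V ≤ V ^ 2 := by
    rw [pow_succ V 1, pow_one]
    exact Nat.mul_le_mul_right _ hV6
  have b1 : n * (3 + T) ≤ V ^ 2 := by
    rw [pow_two]
    exact Nat.mul_le_mul hnV (by omega)
  have b2 : n * (T + 1) ≤ V ^ 2 := by
    rw [pow_two]
    exact Nat.mul_le_mul hnV (by omega)
  have b3 : T * T * n ≤ V ^ 3 := by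
    rw [pow_succ, pow_two]
    exact Nat.mul_le_mul (Nat.mul_le_mul (by omega) (by omega)) hnV
  have b4 : m * (2 * m + 1) ≤ 3 * V ^ 2 := by
    calc m * (2 * m + 1) ≤ V * (3 * V) := Nat.mul_le_mul hmV (by omega)
      _ = 3 * V ^ 2 := by ring
  have b5 : m * ((T + 1) + n * (T + 1)) ≤ 2 * V ^ 3 := by
    calc m * ((T + 1) + n * (T + 1)) ≤ V * (V ^ 2 + V ^ 2) :=
          Nat.mul_le_mul hmV (Nat.add_le_add (by omega) b2)
      _ = 2 * V ^ 3 := by ring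
  have b6 : m * T ≤ V ^ 2 := by
    rw [pow_two]
    exact Nat.mul_le_mul hmV (by omega)
  have hm0 : s.mem 0 = n := (hmem 0).trans rfl
  have hm1 : s.mem 1 = n - 1 := (hmem 1).trans hlenL
  have hm2 : s.mem 2 = Δ₁ := (hmem 2).trans rfl
  have hm3 : s.mem 3 = Δ₂ := (hmem 3).trans rfl
  have hm4 : s.mem 4 = k := (hmem 4).trans rfl
  refine Run.block_seq 20 (by decide) (by decide) (b' := _) le_rfl ?_ ?_
  · simp only [BlockLe, val_load, val_const, State.set_mem, hm0, hm1, hm2, hm3, hm4]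
    exact ⟨by omega, by omega, by omega, by omega, by omega, trivial⟩
  set s1 := blockState [(1, load (const 0)), (5, load (const 1)), (2, load (const 2)),
    (3, load (const 3)), (4, load (const 4))] s with hs1
  have m1 : s1.mem = s.mem := by rw [hs1, blockState_mem]
  have r1 : s1.reg 1 = n := by simp [hs1, blockState, hm0]
  have r2 : s1.reg 2 = Δ₁ := by simp [hs1, blockState, hm2]
  have r3 : s1.reg 3 = Δ₂ := by simp [hs1, blockState, hm3]
  have r4 : s1.reg 4 = k := by simp [hs1, blockState, hm4]
  have r5 : s1.reg 5 = n - 1 := by simp [hs1, blockState, hm1]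
  clear_value s1
  refine Run.seq_le (Run.mono (lifetimeProg_run (n := n) (Δ₁ := Δ₁) (Δ₂ := Δ₂) (k := k) (T := T)
    (L := L) hlenT htT (by rw [r5, hlenL]) (by rw [m1]; exact hmem) (by omega) (by omega))
    (by rw [hlenL]) fun s2 h2 => ?_) le_rfl
  obtain ⟨f2, m2, c21, c25⟩ := h2
  replace c25 := hlife _ c25
  refine Run.block_seq 10 (by decide) (by decide) (b' := _) le_rfl ?_ ?_
  · simp only [BlockLe, val_reg, State.set_reg]
    simp only [Nat.reduceEqDiff, if_false, c21, c25]
    exact ⟨by omega, by omega, trivial⟩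
  set s3 := blockState [(6, reg 25), (7, reg 21)] s2 with hs3
  have f3 : Frame 6 s1 s3 := (f2.mono (by omega)).blockState (by decide)
  have m3 : s3.mem = s.mem := by rw [hs3, blockState_mem, m2, m1]
  have d6 : s3.reg 6 = T := by simp [hs3, blockState, c25]
  have d7 : s3.reg 7 = F := by simp [hs3, blockState, c21, hFdef]
  clear_value s3
  refine Run.seq_le (Run.mono (bitmapProg_run (n := n) (Δ₁ := Δ₁) (Δ₂ := Δ₂) (k := k) (T := T)
    (L := L) hlenT (by rw [f3 1 (by norm_num), r1]) (by rw [f3 5 (by norm_num), r5, hlenL])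
    d7 (by rw [m3]; exact hmem) (by omega) (by omega) (by omega))
    (by rw [hlenL]) fun s4 h4 => ?_) le_rfl
  obtain ⟨f4, m4⟩ := h4
  have g4 : Frame 6 s1 s4 := f3.trans (f4.mono (by omega))
  have hbit4 : ∀ i < n - 1, ∀ t ≤ T, s4.mem (F + n * t + i) = if t ∈ G.pathTimes i then 1 else 0 :=
    fun i hi t _ => by rw [m4, hbit i hi]
  refine Run.seq_le (Run.mono (maxCardProg_run (n := n) (Δ := Δ₁) (N := n - 1) (T := T) (F := F)
    (P := G.pathTimes) h1 (by rw [g4 1 (by norm_num), r1]) (by rw [g4 2 (by norm_num), r2])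
    (by rw [g4 5 (by norm_num), r5]) (by rw [f4 6 (by norm_num), d6])
    (by rw [f4 7 (by norm_num), d7]) hbounds hbit4 (by omega)) le_rfl fun s5 h5 => ?_) le_rfl
  obtain ⟨f5, m5, c5⟩ := h5
  rw [← hm] at c5
  have g5 : Frame 6 s1 s5 := g4.trans (f5.mono (by omega))
  refine Run.seq_le (Run.mono (setupProg_run (n := n) (Δ₁ := Δ₁) (Δ₂ := Δ₂) (k := k) (T := T)
    (F := F) (m := m) (by omega) hTpos (by rw [g5 1 (by norm_num), r1])
    (by rw [g5 2 (by norm_num), r2]) (by rw [g5 3 (by norm_num), r3])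
    (by rw [g5 4 (by norm_num), r4]) (by rw [g5 5 (by norm_num), r5])
    (by rw [f5 6 (by norm_num), f4 6 (by norm_num), d6])
    (by rw [f5 7 (by norm_num), f4 7 (by norm_num), d7]) c5 (by omega) hSM (by omega) (by omega))
    le_rfl fun s6 h6 => ?_) le_rfl
  obtain ⟨hp6, m6⟩ := h6
  set D := F + n * (T + 1) with hD
  have hlow : ∀ a, a ≠ D → s6.mem a = s4.mem a := fun a ha => by
    rw [m6, Function.update_of_ne ha, m5]
  have hSpos : 0 < S := Nat.pow_pos (by positivity)
  refine Run.seq_le (Run.mono (dpProg_run (n := n) (Δ₁ := Δ₁) (Δ₂ := Δ₂) (k := k) (T := T)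
    (F := F) (m := m) (D := D) (P := G.pathTimes) (by omega) hTpos h1 (by omega) hp6 hD hbounds
    (fun i hi t ht => ?_) (fun y hy => ?_) (fun a ha => ?_) (fun i hi y j hj => ?_)
    (fun i hi y j hj => ?_) (by omega) (by omega) (by omega) le_rfl) le_rfl fun s7 h7 => ?_) le_rfl
  · rw [hlow _ ?_, hbit4 i hi t ht]
    have := Nat.mul_le_mul_left n ht
    rw [hD, Nat.mul_succ]
    omega
  -- The first table row: the cell `D` was set to `k + 1`, and the remaining cells were never
  -- written.
  · rcases Nat.eq_zero_or_pos y with rfl | hy0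
    · simp [m6, dpValue]
    · rw [hlow _ (by omega), m4, hbeyond _ (by omega)]
      simp [dpValue, hy0.ne']
  · rw [hlow _ (by omega), m4, hbeyond _ (by omega)]
  · have e1 := rowGain_le_mul T (T * T * n) j i (G.pathTimes i) y
    have e2 := Nat.mul_le_mul hj (hcardT i)
    omega
  · have e1 := rowLoss_le_mul hTpos Δ₁ (T * T * n) j i (G.pathTimes i) y
    have e2 : j * ((T + 1) + i * (T + 1)) ≤ m * ((T + 1) + n * (T + 1)) :=
      Nat.mul_le_mul hj (Nat.add_le_add_left (Nat.mul_le_mul_right _ hi.le) _)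
    have e3 := hcardT i
    omega
  obtain ⟨f7, m7⟩ := h7
  refine (answerProg_run (N := n - 1) (S := S) (D := D) (by rw [f7 5 (by norm_num), hp6.r5])
    (by rw [f7 10 (by norm_num), hp6.r10]) (by rw [f7 11 (by norm_num), hp6.r11])
    (by omega)).mono le_rfl fun s8 h8 => ?_
  rw [h8]
  have key : (∃ y < S, 0 < s7.mem (D + (n - 1) * S + y)) ↔ ∃ y < S,
      0 < dpValue Δ₁ Δ₂ T (T * T * n) m k G.pathTimes (n - 1) y :=
    exists_congr fun y => and_congr_right fun hy => by rw [m7 y hy]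
  split_ifs with h h' h'
  · rfl
  · exact absurd (key.mp h) h'
  · exact absurd (key.mpr h') h
  · rfl

end WordRAM

/-! ## The theorem -/

/-- The sum of the running times of the parts of the program. -/
lemma runningTime_le {n T m S : ℕ} (hn : 1 ≤ n) (hT : 1 ≤ T) (hm : 1 ≤ m) (hS : T ≤ S) :
    20 + (20 + (n - 1) * (30 * T + 60) + (10 + (20 + (n - 1) * (30 * T + 80) +
      (20 + (n - 1) * (50 * T + 60) + (60 + m * 20 + ((n - 1) * (S *
        (S * (m * (m * 400 + 300) + 130) + (m + 1) * (50 * T + 240) + 20) + 20) + 6 +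
          (40 + S * 40))))))) ≤ 3000 * (n * S ^ 2 * m ^ 2) := by
  have hS1 : 1 ≤ S := hT.trans hS
  have e0 : 1 ≤ m ^ 2 := Nat.one_le_pow _ _ hm
  have e1 : S ≤ S ^ 2 := Nat.le_self_pow (by norm_num) S
  have e2 : m ≤ m ^ 2 := Nat.le_self_pow (by norm_num) m
  have hX : S ^ 2 * m ^ 2 ≤ n * S ^ 2 * m ^ 2 := by
    rw [mul_assoc]
    exact Nat.le_mul_of_pos_left _ hn
  have x1 : S ^ 2 ≤ S ^ 2 * m ^ 2 := Nat.le_mul_of_pos_right _ e0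
  have x2 : m ^ 2 ≤ S ^ 2 * m ^ 2 := Nat.le_mul_of_pos_left _ (by positivity)
  have hnT : ∀ a, (n - 1) * (a * T + a * 2) ≤ a * 3 * (n * S ^ 2 * m ^ 2) := by
    intro a
    calc (n - 1) * (a * T + a * 2) ≤ n * (a * S ^ 2 + a * (2 * S ^ 2)) := by
          refine Nat.mul_le_mul (Nat.sub_le _ _) (Nat.add_le_add ?_ ?_)
          · exact Nat.mul_le_mul_left _ (by omega)
          · exact Nat.mul_le_mul_left _ (by omega)
      _ = a * 3 * (n * S ^ 2 * 1) := by ring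
      _ ≤ a * 3 * (n * S ^ 2 * m ^ 2) := by gcongr
  have l1 := hnT 30
  have l2 := hnT 40
  have l3 := hnT 50
  have k1 : (n - 1) * (30 * T + 60) ≤ (n - 1) * (30 * T + 30 * 2) := by gcongr
  have k2 : (n - 1) * (30 * T + 80) ≤ (n - 1) * (40 * T + 40 * 2) := by gcongr; norm_num
  have k3 : (n - 1) * (50 * T + 60) ≤ (n - 1) * (50 * T + 50 * 2) := by gcongr; norm_num
  have c1 : m * (m * 400 + 300) + 130 ≤ 830 * m ^ 2 := by nlinarith
  have c2 : (m + 1) * (50 * T + 240) ≤ (2 * m ^ 2) * (290 * S) :=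
    Nat.mul_le_mul (by omega) (by omega)
  -- The dominant term. The coefficients 830 for the checks, 2 · 290 for gains and losses and twice
  -- 20 for overhead sum to 1450.
  have l4 : (n - 1) * (S * (S * (m * (m * 400 + 300) + 130) + (m + 1) * (50 * T + 240) + 20) + 20) ≤
      1450 * (n * S ^ 2 * m ^ 2) := by
    calc _ ≤ n * (S * (S * (830 * m ^ 2) + (2 * m ^ 2) * (290 * S) + 20 * (S * m ^ 2)) +
            20 * (S ^ 2 * m ^ 2)) := by
          refine Nat.mul_le_mul (Nat.sub_le _ _) (Nat.add_le_add (Nat.mul_le_mul_left _ ?_) ?_)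
          · refine Nat.add_le_add (Nat.add_le_add (Nat.mul_le_mul_left _ c1) c2) ?_
            have : 1 ≤ S * m ^ 2 := Nat.mul_pos hS1 e0
            omega
          · omega
      _ = 1450 * (n * S ^ 2 * m ^ 2) := by ring
  omega

theorem mainTheorem4 :
    ∃ (p : WordRAM.Program) (c C : ℕ),
      ∀ (n σ k Δ₁ Δ₂ : ℕ) (G : TemporalGraph (Fin n)),
        2 ≤ n →
        0 < k → 0 < Δ₁ → Δ₁ < Δ₂ →
        G.graph = SimpleGraph.pathGraph n →
        (∀ e ∈ G.graph.edgeSet, (G.times e).card ≤ σ) →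
        ∀ L : List (Fin n × Fin n × List ℕ), G.IsListing L →
        ∀ w : ℕ, (n + G.lifetime + k + Δ₁ + Δ₂) ^ (c * σ) ≤ 2 ^ w →
          WordRAM.DecidesWithin w p (etcInput L Δ₁ Δ₂ k) (G.ETC Δ₁ Δ₂ k)
            (C * (G.lifetime ^ (4 * σ) * σ ^ 2 * n ^ (2 * σ + 1))) := by
  -- Stored values stay below `M = V ^ (4 * m)` and degrees below 300, so `V ^ (1200 * m)` must be
  -- less than `2 ^ w`; the extra 1 in 1201 makes the inequality strict. The factor 3000 is that of
  -- `runningTime_le`.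
  refine ⟨WordRAM.etcProg, 1201, 3000, fun n σ k Δ₁ Δ₂ G hn hk h1 h12 hG hσ L hL w hw => ?_⟩
  have hT := G.lifetime_pos hG hn
  set V := n + G.lifetime + k + Δ₁ + Δ₂ with hV
  -- Since `σ` is not part of the input, the program works with the actual maximum `m`; the bounds
  -- are monotone in `m ≤ σ`.
  set m := (Finset.range (n - 1)).sup fun i => (G.pathTimes i).card with hm
  have hcard : ∀ i, i + 1 < n → (G.pathTimes i).card ≤ σ := by
    intro i hi
    rw [TemporalGraph.pathTimes, TemporalGraph.pairTimes, dif_pos ⟨by omega, hi⟩]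
    refine hσ _ ?_
    rw [hG, SimpleGraph.mem_edgeSet, SimpleGraph.pathGraph_adj]
    exact Or.inl rfl
  have hmσ : m ≤ σ := Finset.sup_le fun i hi => hcard i (by
    have := Finset.mem_range.mp hi
    omega)
  -- Every path edge has a time. With `m ≥ 1`, the number of codes is at least `T`, and `V ^ (4 *
  -- m)` is at least `V ^ 4`.
  have hm1 : 1 ≤ m := (Finset.card_pos.mpr (G.pathTimes_nonempty hG (i := 0) (by omega))).trans_le
    (Finset.le_sup (f := fun i => (G.pathTimes i).card) (Finset.mem_range.mpr (by omega)))
  set S := (G.lifetime * G.lifetime * n) ^ m with hS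
  have hTS : G.lifetime ≤ S := by
    refine le_trans ?_ (Nat.le_self_pow (by omega) _)
    rw [mul_assoc]
    exact Nat.le_mul_of_pos_right _ (by positivity)
  have hV1 : 1 ≤ V := by omega
  have hSV : S ≤ V ^ (4 * m) := by
    rw [pow_mul]
    refine Nat.pow_le_pow_left ?_ m
    calc G.lifetime * G.lifetime * n ≤ V * V * V := by gcongr <;> omega
      _ = V ^ 3 := by ring
      _ ≤ V ^ 4 := Nat.pow_le_pow_right hV1 (by norm_num)
  have hVM : V ^ 4 ≤ V ^ (4 * m) := Nat.pow_le_pow_right hV1 (by omega)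
  have hV4 : V ≤ V ^ 4 := Nat.le_self_pow (by norm_num) V
  have hwM : (V ^ (4 * m)) ^ WordRAM.maxDeg < 2 ^ w := by
    refine lt_of_lt_of_le ?_ hw
    rw [← pow_mul]
    refine Nat.pow_lt_pow_right (by omega) ?_
    rw [WordRAM.maxDeg]
    omega
  have hin := hL.input_le hG (Δ₁ := Δ₁) (Δ₂ := Δ₂) (k := k) hV.ge
  have hmem : ∀ a, (WordRAM.initial w (etcInput L Δ₁ Δ₂ k)).mem a =
      (etcInput L Δ₁ Δ₂ k).getD a 0 := fun a => Nat.mod_eq_of_lt (by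
    refine ((hin a).trans (hV4.trans (hVM.trans ?_))).trans_lt hwM
    exact Nat.le_self_pow (by norm_num [WordRAM.maxDeg]) _)
  have htime : 3000 * (n * S ^ 2 * m ^ 2) ≤
      3000 * (G.lifetime ^ (4 * σ) * σ ^ 2 * n ^ (2 * σ + 1)) := by
    refine Nat.mul_le_mul_left _ ?_
    calc n * S ^ 2 * m ^ 2 = G.lifetime ^ (4 * m) * m ^ 2 * n ^ (2 * m + 1) := by
          rw [hS]
          ring
      _ ≤ G.lifetime ^ (4 * σ) * σ ^ 2 * n ^ (2 * σ + 1) := by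
          gcongr; omega
  obtain ⟨t, s, he, ht, -, hs⟩ := WordRAM.etcProg_run (w := w) (M := V ^ (4 * m)) hn h1 h12 hG hL hm
    hV.ge hVM hSV hmem ((runningTime_le (by omega) hT hm1 hTS).trans htime) (by omega) hwM
    ⟨fun r => Nat.zero_le _, fun a => by rw [hmem]; exact (hin a).trans (hV4.trans hVM)⟩
  exact ⟨t, s, he, ht, fun h => by rw [hs, if_pos h], fun h => by rw [hs, if_neg h]⟩
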